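/- Let $\mathbb T=(\mathbb R\cup\{-\infty\},\max,+)$ be the max-tropical semiring, $\oplus=\max$, $\odot=+$, with the order topology, and let $d\ge 1$, $m\ge 0$, $M\in\mathbb T^{d\times m}$. For $V\subseteq\mathbb T^d$ let $\operatorname{tconv}(V)$ be the set of all $\bigoplus_{j}\lambda_j\odot v_j$ (finite combinations) with $v_j\in V$, $\lambda_j\in\mathbb T$, $\bigoplus_j\lambda_j=0$; a matrix is identified with the set of its columns. Let $P=\operatorname{tconv}(M)$. For a tropical polytope $Q\subseteq\mathbb T^d$ let $\operatorname{vert}(Q)$ be its unique minimal generating set, and put $x_0:=0$ for $x\in\mathbb T^d$. The covector of $x\in Q$ is the set of pairs $(i,v)\in\{0,\dots,d\}\times\operatorname{vert}(Q)$ such that $x_i\ne-\infty$ and $\lambda\odot v_i=x_i$ for some $\lambda\in\mathbb T$ with $\lambda\odot v_k\le x_k$ for all $k\in\{0,\dots,d\}$. The (relatively open) cells of $Q$ are the classes of points of $Q$ with the same covector and the same set of finite coordinates. The $d$-trunk $\operatorname{Tr}_d(Q)$ is the union of all cells of $Q$ that are contained in the closure of a cell of dimension at least $d$. The tropical barycentric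 volume of $Q$ is $\operatorname{tlvol}(Q)=\max_{x\in \operatorname{Tr}_d(Q)}\sum_{i=1}^d x_i$, where $\max\emptyset=-\infty$. The tropical barycenter of a subset of $\mathbb T^d$ is its componentwise largest element, if it exists. For a set $J\subseteq\{1,\dots,m\}$ with $|J|=d+1$ let $M_J$ be the submatrix of the columns in $J$, and let $\overline{M_J}\in\mathbb T^{(d+1)\times(d+1)}$ arise from $M_J$ by adding a zero-th row all of whose entries are $0$. A square tropical matrix $A$ is called non-singular if the value $\max_\sigma\sum_i a_{i,\sigma(i)}$ of its tropical determinant is attained by at most one permutation. (1) If $\overline{M_J}$ is non-singular, then $\operatorname{Tr}_d(\operatorname{tconv}(M_J))$ has a tropical barycenter $\beta(\operatorname{tconv}(M_J))$; if $\operatorname{Tr}_d(P)\neq\emptyset$, then the maximum that defines $\operatorname{tlvol}(P)$ is attained; and $$\operatorname{tlvol}(P)=\max\Big\{\sum_{i=1}^d \beta(\operatorname{tconv}(M_J))_i \;:\; J\in\tbinom{[m]}{d+1},\ \overline{M_J}\text{ non-singular}\Big\},\qquad \max\emptyset=-\infty .$$ (2) There are a single program and a constant $C$ such that for all $d\ge1$,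 $m\ge 0$ and $M\in\mathbb T^{d\times m}$ the program, started with $d$, $m$, $M$, halts with output $\operatorname{tlvol}(\operatorname{tconv}(M))$ after at most $C\cdot\big(\binom{m}{d+1}\,d^3+1\big)$ steps. In particular, $\operatorname{tlvol}(P)$ can be computed in time $O\big(\binom{m}{d+1}\cdot d^3\big)$ for $m\ge d+1$ (and in constant time for $m\le d$). The machine is a random access machine at unit cost whose operations on $\mathbb T$ are the constants $0$ and $-\infty$, $\oplus$, $\odot$, negation of real numbers and comparison, and whose operations on natural numbers (used as indices of one-dimensional arrays of natural numbers and two-dimensional arrays of tropical numbers) are constants, addition, truncated subtraction and comparison. -/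

import Mathlib

namespace TropVol

/-! ### Tropical numbers and tropical polytopes -/

/-- The max-tropical numbers `ℝ ∪ {-∞}`: tropical addition is `⊔`, tropical multiplication is `+`,
the tropical zero is `⊥` and the tropical one is `0`. -/
abbrev TropNum : Type := WithBot ℝ

/-- The order topology on `ℝ ∪ {-∞}`. -/
instance instTopologicalSpaceTropNum : TopologicalSpace TropNum := Preorder.topology TropNum

/-- The tropical convex hull of a set of points of `(ℝ ∪ {-∞})^d`. -/
def tconv {d : ℕ} (V : Set (Fin d → TropNum)) : Set (Fin d → TropNum) :=
  {x | ∃ (n : ℕ) (c : Fin n → TropNum) (v : Fin n → Fin d → TropNum),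
    (∀ j, v j ∈ V) ∧ (Finset.univ.sup c = 0) ∧
      ∀ i, x i = Finset.univ.sup (fun j => c j + v j i)}

/-- The vertices of a tropical polytope: the points that every generating set has to contain.
They form the unique minimal generating set of a tropical polytope. -/
def vertices {d : ℕ} (P : Set (Fin d → TropNum)) : Set (Fin d → TropNum) :=
  {v | v ∈ P ∧ v ∉ tconv (P \ {v})}

/-- The point with a coordinate `0` (the tropical one) put in front, in row zero. -/
def homog {d : ℕ} (x : Fin d → TropNum) : Fin (d + 1) → TropNum := Fin.cons 0 x

/-! ### Covector decomposition and trunks -/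

/-- The covector of a point `x` with respect to the generators `V`: the pairs `(i, v)` such that
`x` has a finite `i`-th homogeneous coordinate and the largest tropical multiple of `v` below `x`
agrees with `x` in this coordinate. -/
def covector {d : ℕ} (V : Set (Fin d → TropNum)) (x : Fin d → TropNum) :
    Set (Fin (d + 1) × (Fin d → TropNum)) :=
  {p | p.2 ∈ V ∧ homog x p.1 ≠ ⊥ ∧
    ∃ c : TropNum, (∀ k, c + homog p.2 k ≤ homog x k) ∧ c + homog p.2 p.1 = homog x p.1}

/-- The (relatively open) cells of the covector decomposition of a tropical polytope `P`: the
classes of points of `P` with the same finite coordinates and the same covector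
with respect to the vertices of `P`. -/
def cells {d : ℕ} (P : Set (Fin d → TropNum)) : Set (Set (Fin d → TropNum)) :=
  {F | ∃ x ∈ P, F = {y | y ∈ P ∧ (∀ i, y i = ⊥ ↔ x i = ⊥) ∧
    covector (vertices P) y = covector (vertices P) x}}

/-- The dimension of a cell, i.e. the dimension of its affine span. On a cell the set of
coordinates equal to `-∞` is constant, so that replacing `-∞` by a constant does not
affect the dimension. -/
noncomputable def cellDim {d : ℕ} (F : Set (Fin d → TropNum)) : ℕ :=
  Module.finrank ℝ (vectorSpan ℝ ((fun (x : Fin d → TropNum) (i : Fin d) => (x i).unbotD 0) '' F))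

/-- The `i`-trunk of `P`: the union of all cells contained in the closure of a cell of
dimension at least `i`. -/
def trunk {d : ℕ} (i : ℕ) (P : Set (Fin d → TropNum)) : Set (Fin d → TropNum) :=
  ⋃₀ {F | F ∈ cells P ∧ ∃ G ∈ cells P, i ≤ cellDim G ∧ F ⊆ closure G}

/-- The sum of the coordinates of a point. -/
def coordSum {d : ℕ} (x : Fin d → TropNum) : TropNum := ∑ i, x i

/-- The tropical barycentric volume of `P`: the maximal coordinate sum of a point of the
`d`-trunk of `P`, which is `-∞` if the `d`-trunk is empty. -/
noncomputable def tlvol {d : ℕ} (P : Set (Fin d → TropNum)) : TropNum :=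
  sSup (coordSum '' trunk d P)

/-- The tropical barycenter of the `d`-trunk of `S`: its componentwise maximal point. -/
noncomputable def trunkBarycenter {d : ℕ} (S : Set (Fin d → TropNum)) : Fin d → TropNum :=
  fun i => sSup ((fun x : Fin d → TropNum => x i) '' trunk d S)

/-! ### Matrices -/

/-- The set of columns of a matrix. -/
def columns {d m : ℕ} (M : Matrix (Fin d) (Fin m) TropNum) : Set (Fin d → TropNum) :=
  Set.range fun j i => M i j

/-- The submatrix `M_J` of the columns in a `k`-element set `J`, in their order. -/
def colSubmatrix {d m k : ℕ} (M : Matrix (Fin d) (Fin m) TropNum)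
    (J : {J : Finset (Fin m) // J.card = k}) : Matrix (Fin d) (Fin k) TropNum :=
  M.submatrix id (J.1.orderEmbOfFin J.2)

/-- The matrix with a zero-th row filled with tropical ones `0` put on top. -/
def augment {d m : ℕ} (A : Matrix (Fin d) (Fin m) TropNum) :
    Matrix (Fin (d + 1)) (Fin m) TropNum :=
  Matrix.of fun i j => homog (fun k => A k j) i

/-- The weight of a permutation in a square tropical matrix. -/
def permWeight {n : ℕ} (A : Matrix (Fin n) (Fin n) TropNum) (σ : Equiv.Perm (Fin n)) : TropNum :=
  ∑ i, A i (σ i)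

/-- The tropical determinant. -/
def tdet {n : ℕ} (A : Matrix (Fin n) (Fin n) TropNum) : TropNum :=
  Finset.univ.sup (permWeight A)

/-- A square matrix is non-singular if the value of the tropical determinant is attained at most
once. -/
def Nonsingular {n : ℕ} (A : Matrix (Fin n) (Fin n) TropNum) : Prop :=
  ∀ σ τ : Equiv.Perm (Fin n), permWeight A σ = tdet A → permWeight A τ = tdet A → σ = τ

/-! ### A machine model with a step count

Programs of a random access machine with exact tropical arithmetic (and no other operation on
tropical numbers). A program mentions only finitely many arrays, which are named by numbers fixed
in the program: one-dimensional arrays of natural numbers, used for indices and counters, and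
two-dimensional arrays of tropical numbers. Every operation and every memory access costs one
step. -/

/-- The contents of the memory. -/
structure Memory where
  /-- `nat a i` is the entry `i` of the array of natural numbers with name `a`. -/
  nat : ℕ → ℕ → ℕ
  /-- `trop a i j` is the entry `(i, j)` of the array of tropical numbers with name `a`. -/
  trop : ℕ → ℕ → ℕ → TropNum

/-- Expressions with values in the natural numbers. -/
inductive NatExpr where
  | const (n : ℕ)
  | read (a : ℕ) (i : NatExpr)
  | add (e f : NatExpr)
  | sub (e f : NatExpr)

/-- The value of an expression; subtraction is truncated at `0`. -/
def NatExpr.eval (s : Memory) : NatExpr → ℕ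
  | .const n => n
  | .read a i => s.nat a (i.eval s)
  | .add e f => e.eval s + f.eval s
  | .sub e f => e.eval s - f.eval s

/-- The number of steps to evaluate an expression. -/
def NatExpr.cost : NatExpr → ℕ
  | .const _ => 1
  | .read _ i => i.cost + 1
  | .add e f => e.cost + f.cost + 1
  | .sub e f => e.cost + f.cost + 1

/-- Expressions with values in the tropical numbers. -/
inductive TropExpr where
  | zero
  | one
  | read (a : ℕ) (i j : NatExpr)
  | add (e f : TropExpr)
  | mul (e f : TropExpr)
  | inv (e : TropExpr)

/-- The value of an expression. Tropical addition is the maximum, tropical multiplication is `+`,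
the tropical inverse of a real number is its negative (and that of `-∞` is `-∞`). -/
def TropExpr.eval (s : Memory) : TropExpr → TropNum
  | .zero => ⊥
  | .one => 0
  | .read a i j => s.trop a (i.eval s) (j.eval s)
  | .add e f => e.eval s ⊔ f.eval s
  | .mul e f => e.eval s + f.eval s
  | .inv e => (e.eval s).map fun r => -r

/-- The number of steps to evaluate an expression. -/
def TropExpr.cost : TropExpr → ℕ
  | .zero => 1
  | .one => 1
  | .read _ i j => i.cost + j.cost + 1
  | .add e f => e.cost + f.cost + 1
  | .mul e f => e.cost + f.cost + 1
  | .inv e => e.cost + 1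

/-- Tests. -/
inductive Test where
  | natLt (e f : NatExpr)
  | tropLt (e f : TropExpr)
  | not (b : Test)
  | and (b c : Test)

/-- The truth value of a test. -/
def Test.eval (s : Memory) : Test → Prop
  | .natLt e f => e.eval s < f.eval s
  | .tropLt e f => e.eval s < f.eval s
  | .not b => ¬ b.eval s
  | .and b c => b.eval s ∧ c.eval s

/-- The number of steps to evaluate a test. -/
def Test.cost : Test → ℕ
  | .natLt e f => e.cost + f.cost + 1
  | .tropLt e f => e.cost + f.cost + 1
  | .not b => b.cost + 1
  | .and b c => b.cost + c.cost + 1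

/-- Programs. -/
inductive Program where
  | skip
  | setNat (a : ℕ) (i e : NatExpr)
  | setTrop (a : ℕ) (i j : NatExpr) (e : TropExpr)
  | seq (p q : Program)
  | ite (b : Test) (p q : Program)
  | loop (b : Test) (p : Program)

/-- The memory after `v` is stored at entry `i` of the array `a` of natural numbers. -/
def Memory.storeNat (s : Memory) (a i v : ℕ) : Memory :=
  ⟨Function.update s.nat a (Function.update (s.nat a) i v), s.trop⟩

/-- The memory after `v` is stored at entry `(i, j)` of the array `a` of tropical numbers. -/
def Memory.storeTrop (s : Memory) (a i j : ℕ) (v : TropNum) : Memory :=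
  ⟨s.nat, Function.update s.trop a
    (Function.update (s.trop a) i (Function.update (s.trop a i) j v))⟩

/-- `Exec p s t s'`: the program `p`, started with the memory `s`, halts after exactly `t` steps
with the memory `s'`. Here `loop b p` is the loop "while `b` do `p`". -/
inductive Exec : Program → Memory → ℕ → Memory → Prop
  | skip (s : Memory) : Exec .skip s 1 s
  | setNat (s : Memory) (a : ℕ) (i e : NatExpr) :
      Exec (.setNat a i e) s (i.cost + e.cost + 1) (s.storeNat a (i.eval s) (e.eval s))
  | setTrop (s : Memory) (a : ℕ) (i j : NatExpr) (e : TropExpr) :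
      Exec (.setTrop a i j e) s (i.cost + j.cost + e.cost + 1)
        (s.storeTrop a (i.eval s) (j.eval s) (e.eval s))
  | seq {p q : Program} {s s' s'' : Memory} {t t' : ℕ} :
      Exec p s t s' → Exec q s' t' s'' → Exec (.seq p q) s (t + t') s''
  | iteTrue {b : Test} {p q : Program} {s s' : Memory} {t : ℕ} :
      b.eval s → Exec p s t s' → Exec (.ite b p q) s (b.cost + 1 + t) s'
  | iteFalse {b : Test} {p q : Program} {s s' : Memory} {t : ℕ} :
      ¬ b.eval s → Exec q s t s' → Exec (.ite b p q) s (b.cost + 1 + t) s'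
  | loopTrue {b : Test} {p : Program} {s s' s'' : Memory} {t t' : ℕ} :
      b.eval s → Exec p s t s' → Exec (.loop b p) s' t' s'' →
        Exec (.loop b p) s (b.cost + 1 + t + t') s''
  | loopFalse {b : Test} {p : Program} {s : Memory} :
      ¬ b.eval s → Exec (.loop b p) s (b.cost + 1) s

/-- The initial memory for an input matrix: the first two entries of the array `0` of natural
numbers are `d` and `m`, the array `0` of tropical numbers holds the `d × m` matrix, and
everything else is cleared. -/
def inputMemory {d m : ℕ} (M : Matrix (Fin d) (Fin m) TropNum) : Memory where
  nat a i := if a = 0 ∧ i = 0 then d else if a = 0 ∧ i = 1 then m else 0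
  trop a i j := if h : a = 0 ∧ i < d ∧ j < m then M ⟨i, h.2.1⟩ ⟨j, h.2.2⟩ else ⊥

/-- The output of a halted program: the entry `(0, 0)` of the array `1` of tropical numbers. -/
def Memory.output (s : Memory) : TropNum := s.trop 1 0 0

end TropVol

namespace TropVol

/-! ### Arithmetic and order of tropical numbers -/

/-! Put a zero-th coordinate 0 in front of all points. A real point y lies in tconv V iff for every
i in {0, …, d} some generator v is `Tight` at i, that is, v_k - y_k is maximal at k = i. On a cell
of dimension d all coordinates are finite and every vertex is tight in only one coordinate, because
two tight coordinates confine y to a hyperplane. This leads to `ofReal_mem_trunk`: y belongs to the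
d-trunk iff there are generators σ_0, …, σ_d such that σ_i is tight at i for y and strictly tight at
i for some common point z. Given such a z, a small generic step from y ends in a full-dimensional
cell whose closure contains the cell of y. Strictness forces the σ_i to be distinct, so the real
trunk of P is the union of the real trunks of the simplices spanned by d + 1 columns.

For d + 1 columns, a point z that is strictly tight along a permutation π amounts to a dual solution
of the assignment problem for the augmented matrix that is tight on π only
(`exists_isStrictPotential_iff`), and such a dual solution exists for some π iff the matrix is
non-singular. The real trunk of the simplex is then `tightRegion`, given by difference inequalities,
bounded above and closed under componentwise suprema; hence it has a greatest point. Trunk points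
with a coordinate -∞ are limits of real trunk points, so this point is the barycenter of the whole
trunk. They also have coordinate sum -∞, so the volume formula follows.

A single simplex takes O(d³) steps. The Hungarian method finds an optimal matching with potentials
or shows that there is none. The matching is the only optimal one iff the digraph of tight edges is
acyclic, which is tested by peeling off sources. One more search, from an artificial row of zeros,
gives potentials for which every row is joined to the artificial one by tight edges; up to a shift
they are the coordinates of the barycenter (`IsPotential.isGreatest_tightRegion`). The column sets
are enumerated in colexicographic order with O(d) steps per set. The correctness proof of the
Hungarian method also supplies the duality theorem used above (`exists_isPotential`). -/

instance instOrderTopologyTropNum : OrderTopology TropNum := ⟨rfl⟩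

/-! ### Tropical convex hulls -/

/-- The tropical multiple `c ⊙ v` lies below `x` and touches `x` in the coordinate `i`. -/
def Touches {d : ℕ} (c : TropNum) (v x : Fin d → TropNum) (i : Fin (d + 1)) : Prop :=
  (∀ k, c + homog v k ≤ homog x k) ∧ c + homog v i = homog x i

@[simp] lemma homog_zero {d : ℕ} (x : Fin d → TropNum) : homog x 0 = 0 := rfl

@[simp] lemma homog_succ {d : ℕ} (x : Fin d → TropNum) (i : Fin d) : homog x i.succ = x i := rfl

lemma homog_injective {d : ℕ} : Function.Injective (homog (d := d)) := fun x y h => by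
  ext1 i; simpa using congrFun h i.succ

lemma Touches.trans {d : ℕ} {c c' : TropNum} {v w x : Fin d → TropNum} {i : Fin (d + 1)}
    (h : Touches c v x i) (h' : Touches c' w v i) : Touches (c + c') w x i := by
  refine ⟨fun k => ?_, ?_⟩
  · rw [add_assoc]
    exact (add_le_add_right (h'.1 k) c).trans (h.1 k)
  · rw [add_assoc, h'.2, h.2]

lemma touches_zero_self {d : ℕ} (x : Fin d → TropNum) (i : Fin (d + 1)) : Touches 0 x x i := by
  simp [Touches]

/-- Residuation: each coordinate of a tropical combination is attained by one of its summands, and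
all summands lie below x. Conversely one touching generator per coordinate suffices, so d + 1
summands always do; coordinate 0 supplies the normalization of the coefficients. -/
lemma mem_tconv_iff {d : ℕ} {V : Set (Fin d → TropNum)} {x : Fin d → TropNum} :
    x ∈ tconv V ↔ ∀ i, homog x i ≠ ⊥ → ∃ v ∈ V, ∃ c, Touches c v x i := by
  constructor
  · rintro ⟨n, c, v, hv, hc, hx⟩ i hi
    have hx' : ∀ k, homog x k = Finset.univ.sup fun j => c j + homog (v j) k := by
      refine Fin.cases ?_ fun k => ?_
      · simpa using hc.symm
      · simpa using hx k
    have hne : (Finset.univ : Finset (Fin n)).Nonempty := by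
      by_contra h
      rw [Finset.not_nonempty_iff_eq_empty] at h
      exact hi (by rw [hx' i, h, Finset.sup_empty])
    obtain ⟨j, -, hj⟩ := Finset.exists_mem_eq_sup Finset.univ hne fun j => c j + homog (v j) i
    refine ⟨v j, hv j, c j, fun k => ?_, ?_⟩
    · rw [hx' k]
      exact Finset.le_sup (f := fun j => c j + homog (v j) k) (Finset.mem_univ j)
    · rw [hx' i, hj]
  · intro h
    have h0 := h 0 (by simp)
    have h' : ∀ i, ∃ v ∈ V, ∃ c, (∀ k, c + homog v k ≤ homog x k) ∧
        c + homog v i = homog x i := by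
      intro i
      -- A coordinate -∞ needs no touching generator; the one for coordinate 0 with coefficient -∞
      -- fills the slot.
      by_cases hi : homog x i = ⊥
      · obtain ⟨v, hv, -⟩ := h0
        exact ⟨v, hv, ⊥, fun k => by simp, by simp [hi]⟩
      · exact h i hi
    choose v hv c hc hc' using h'
    have key : ∀ k, homog x k = Finset.univ.sup fun j => c j + homog (v j) k := by
      intro k
      refine le_antisymm ?_ (Finset.sup_le fun j _ => hc j k)
      rw [← hc' k]
      exact Finset.le_sup (f := fun j => c j + homog (v j) k) (Finset.mem_univ k)
    refine ⟨d + 1, c, v, hv, ?_, fun i => by simpa using key i.succ⟩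
    simpa using (key 0).symm

lemma subset_tconv {d : ℕ} (V : Set (Fin d → TropNum)) : V ⊆ tconv V := fun x hx =>
  mem_tconv_iff.2 fun i _ => ⟨x, hx, 0, touches_zero_self x i⟩

lemma Touches.ne_bot {d : ℕ} {c : TropNum} {v x : Fin d → TropNum} {i : Fin (d + 1)}
    (h : Touches c v x i) (hx : homog x i ≠ ⊥) : homog v i ≠ ⊥ := fun hv => by
  have := h.2
  rw [hv, WithBot.add_bot] at this
  exact hx this.symm

lemma tconv_subset {d : ℕ} {V W : Set (Fin d → TropNum)} (h : V ⊆ tconv W) :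
    tconv V ⊆ tconv W := by
  intro x hx
  rw [mem_tconv_iff] at hx ⊢
  intro i hi
  obtain ⟨v, hv, c, hc⟩ := hx i hi
  obtain ⟨w, hw, c', hc'⟩ := mem_tconv_iff.1 (h hv) i (hc.ne_bot hi)
  exact ⟨w, hw, c + c', hc.trans hc'⟩

lemma tconv_mono {d : ℕ} {V W : Set (Fin d → TropNum)} (h : V ⊆ W) : tconv V ⊆ tconv W :=
  tconv_subset (h.trans (subset_tconv W))

/-- If v is not in V, then V generates the polytope without using v. -/
lemma vertices_tconv_subset {d : ℕ} (V : Set (Fin d → TropNum)) : vertices (tconv V) ⊆ V := by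
  rintro v ⟨hv, hv'⟩
  by_contra hV
  have : V ⊆ tconv V \ {v} := fun w hw => ⟨subset_tconv V hw, fun h => hV (h ▸ hw)⟩
  exact hv' (tconv_mono this hv)

lemma Touches.le_zero {d : ℕ} {c : TropNum} {v x : Fin d → TropNum} {i : Fin (d + 1)}
    (h : Touches c v x i) : c ≤ 0 := by
  simpa using h.1 0

lemma TropNum.eq_zero_of_add_eq {c e : TropNum} (he : e ≠ ⊥) (h : c + e = e) : c = 0 := by
  lift e to ℝ using he
  induction c using WithBot.recBotCoe with
  | bot => simp at h
  | coe c => norm_cast at h ⊢; linarith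

lemma TropNum.eq_zero_of_add_eq_zero {c e : TropNum} (hc : c ≤ 0) (he : e ≤ 0) (h : c + e = 0) :
    c = 0 ∧ e = 0 := by
  induction c using WithBot.recBotCoe with
  | bot => simp at h
  | coe c =>
    induction e using WithBot.recBotCoe with
    | bot => simp at h
    | coe e => norm_cast at *; constructor <;> linarith

/-- A tropical polytope is generated by its vertices. -/
lemma tconv_vertices {d : ℕ} {V : Set (Fin d → TropNum)} (hV : V.Finite) :
    tconv (vertices (tconv V)) = tconv V := by
  -- An inclusion-minimal finite generating subset; it remains to see that all its points are
  -- vertices.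
  obtain ⟨W, hWV, hW⟩ := exists_minimal_le_of_wellFoundedLT
    (fun W : Finset (Fin d → TropNum) => tconv (W : Set (Fin d → TropNum)) = tconv V)
    hV.toFinset (by simp)
  rw [← hW.prop]
  refine (tconv_mono (vertices_tconv_subset _)).antisymm (tconv_mono fun v hv => ?_)
  refine ⟨subset_tconv _ hv, fun hv' => ?_⟩
  classical
  have key : v ∈ tconv ((W.erase v : Finset _) : Set (Fin d → TropNum)) := by
    rw [mem_tconv_iff] at hv' ⊢
    intro i hi
    obtain ⟨x, ⟨hxW, hxv⟩, c, hc⟩ := hv' i hi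
    obtain ⟨w, hw, c', hc'⟩ := mem_tconv_iff.1 hxW i (hc.ne_bot hi)
    refine ⟨w, ?_, _, hc.trans hc'⟩
    rw [Finset.coe_erase]
    refine ⟨hw, ?_⟩
    -- Passing from v to x and back multiplies by c + c' = 0. Both factors are at most 0, so both
    -- vanish, x ≤ v ≤ x and hence x = v.
    rintro rfl
    obtain ⟨rfl, rfl⟩ := TropNum.eq_zero_of_add_eq_zero hc.le_zero hc'.le_zero
      (TropNum.eq_zero_of_add_eq hi (hc.trans hc').2)
    refine hxv (homog_injective (funext fun k => le_antisymm ?_ ?_))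
    · simpa using hc.1 k
    · simpa using hc'.1 k
  have h1 : tconv ((W.erase v : Finset _) : Set (Fin d → TropNum)) = tconv V := by
    rw [← hW.prop]
    refine (tconv_mono (by simp)).antisymm (tconv_subset fun w hw => ?_)
    by_cases hwv : w = v
    · exact hwv ▸ key
    · exact subset_tconv _ (by simpa [hwv] using hw)
  exact Finset.notMem_erase v W (hW.le_of_le h1 (Finset.erase_subset v W) hv)

/-! ### Real points -/

/-- A real point as a tropical point. -/
def ofReal {d : ℕ} (y : Fin d → ℝ) : Fin d → TropNum := fun i => (y i : TropNum)

/-- A real point with a coordinate `0` put in front. -/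
def rhomog {d : ℕ} (y : Fin d → ℝ) : Fin (d + 1) → ℝ := Fin.cons 0 y

@[simp] lemma rhomog_zero {d : ℕ} (y : Fin d → ℝ) : rhomog y 0 = 0 := rfl

@[simp] lemma rhomog_succ {d : ℕ} (y : Fin d → ℝ) (i : Fin d) : rhomog y i.succ = y i := rfl

@[simp] lemma homog_ofReal {d : ℕ} (y : Fin d → ℝ) (i : Fin (d + 1)) :
    homog (ofReal y) i = (rhomog y i : ℝ) := by
  induction i using Fin.cases <;> rfl

lemma exists_ofReal_eq {d : ℕ} {x : Fin d → TropNum} (h : ∀ i, x i ≠ ⊥) :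
    ∃ y, ofReal y = x :=
  ⟨fun i => (x i).unbot (h i), funext fun _ => WithBot.coe_unbot _ _⟩

lemma continuous_rhomog {d : ℕ} (i : Fin (d + 1)) :
    Continuous fun y : Fin d → ℝ => rhomog y i := by
  induction i using Fin.cases with
  | zero => simpa using continuous_const
  | succ i => simpa using continuous_apply i

lemma rhomog_add_smul {d : ℕ} (y w : Fin d → ℝ) (t : ℝ) (i : Fin (d + 1)) :
    rhomog (y + t • w) i = rhomog y i + t * rhomog w i := by
  induction i using Fin.cases <;> simp

lemma rhomog_combo {d : ℕ} (y w : Fin d → ℝ) (s t : ℝ) (i : Fin (d + 1)) :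
    rhomog (s • y + t • w) i = s * rhomog y i + t * rhomog w i := by
  induction i using Fin.cases <;> simp

/-- The largest multiple of `v` below the real point `y` touches `y` in the coordinate `i`. -/
def Tight {d : ℕ} (v : Fin d → TropNum) (y : Fin d → ℝ) (i : Fin (d + 1)) : Prop :=
  ∀ k, homog v k + (rhomog y i : ℝ) ≤ homog v i + (rhomog y k : ℝ)

/-- The largest multiple of `v` below the real point `y` touches `y` only in the coordinate `i`. -/
def StrictlyTight {d : ℕ} (v : Fin d → TropNum) (y : Fin d → ℝ) (i : Fin (d + 1)) : Prop :=
  ∀ k, k ≠ i → homog v k + (rhomog y i : ℝ) < homog v i + (rhomog y k : ℝ)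

lemma StrictlyTight.tight {d : ℕ} {v : Fin d → TropNum} {y : Fin d → ℝ} {i : Fin (d + 1)}
    (h : StrictlyTight v y i) : Tight v y i := fun k => by
  by_cases hk : k = i
  · rw [hk]
  · exact (h k hk).le

lemma Tight.ne_bot {d : ℕ} {v : Fin d → TropNum} {y : Fin d → ℝ} {i : Fin (d + 1)}
    (h : Tight v y i) : homog v i ≠ ⊥ := fun hv => by
  have := h 0
  rw [hv, WithBot.bot_add, le_bot_iff, WithBot.add_eq_bot] at this
  simp at this

/-- The multiplier is forced to be y_i - v_i. The inequality v_k - y_k ≤ v_i - y_i in `Tight` is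
arranged so that -∞ is never subtracted. -/
lemma tight_iff_exists_touches {d : ℕ} {v : Fin d → TropNum} {y : Fin d → ℝ} {i : Fin (d + 1)} :
    Tight v y i ↔ ∃ c, Touches c v (ofReal y) i := by
  constructor
  · intro h
    obtain ⟨a, ha⟩ := WithBot.ne_bot_iff_exists.1 h.ne_bot
    refine ⟨((rhomog y i - a : ℝ) : TropNum), fun k => ?_, ?_⟩
    · have := h k
      rw [← ha] at this
      rw [homog_ofReal]
      generalize homog v k = b at this
      induction b using WithBot.recBotCoe with
      | bot => simp
      | coe b => norm_cast at this ⊢; linarith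
    · rw [homog_ofReal, ← ha]
      norm_cast
      ring
  · rintro ⟨c, hc⟩ k
    have hi := hc.ne_bot (by simp)
    obtain ⟨a, ha⟩ := WithBot.ne_bot_iff_exists.1 hi
    have h1 := hc.1 k
    have h2 := hc.2
    rw [homog_ofReal] at h1 h2
    rw [← ha] at h2 ⊢
    induction c using WithBot.recBotCoe with
    | bot => simp at h2
    | coe c =>
      generalize homog v k = b at h1
      induction b using WithBot.recBotCoe with
      | bot => simp
      | coe b => norm_cast at *; linarith

lemma mem_covector_ofReal {d : ℕ} {V : Set (Fin d → TropNum)} {y : Fin d → ℝ} {i : Fin (d + 1)}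
    {v : Fin d → TropNum} : (i, v) ∈ covector V (ofReal y) ↔ v ∈ V ∧ Tight v y i := by
  rw [tight_iff_exists_touches]
  simp [covector, Touches]

lemma ofReal_mem_tconv {d : ℕ} {V : Set (Fin d → TropNum)} {y : Fin d → ℝ} :
    ofReal y ∈ tconv V ↔ ∀ i, ∃ v ∈ V, Tight v y i := by
  simp [mem_tconv_iff, tight_iff_exists_touches]

lemma StrictlyTight.eq_of_tight {d : ℕ} {v : Fin d → TropNum} {y : Fin d → ℝ}
    {i k : Fin (d + 1)} (h : StrictlyTight v y i) (h' : Tight v y k) : k = i := by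
  by_contra hk
  exact (h k hk).not_ge (h' i)

/-- Equality in the inequality for k would make v_k - y_k maximal as well, so k would be a second
tight coordinate. -/
lemma strictlyTight_of_forall_tight {d : ℕ} {v : Fin d → TropNum} {y : Fin d → ℝ}
    {i : Fin (d + 1)} (h : Tight v y i) (h' : ∀ k, Tight v y k → k = i) :
    StrictlyTight v y i := by
  intro k hk
  refine (h k).lt_of_ne fun he => hk (h' k fun l => ?_)
  have h1 := h l
  obtain ⟨a, ha⟩ := WithBot.ne_bot_iff_exists.1 h.ne_bot
  rw [← ha] at he h1
  generalize homog v k = b at *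
  generalize homog v l = c at *
  induction b using WithBot.recBotCoe with
  | bot => simp [← WithBot.coe_add] at he
  | coe b =>
    induction c using WithBot.recBotCoe with
    | bot => simp
    | coe c => norm_cast at *; linarith

/-- Two tight coordinates confine y to a hyperplane that depends on v only. Both coordinates of v
are finite, so the default value 0 does not enter. -/
lemma Tight.add_eq {d : ℕ} {v : Fin d → TropNum} {y : Fin d → ℝ}
    {i k : Fin (d + 1)} (h : Tight v y i) (h' : Tight v y k) :
    rhomog y i - rhomog y k = (homog v i).unbotD 0 - (homog v k).unbotD 0 := by
  have h1 := le_antisymm (h k) (h' i)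
  obtain ⟨a, ha⟩ := WithBot.ne_bot_iff_exists.1 h.ne_bot
  obtain ⟨b, hb⟩ := WithBot.ne_bot_iff_exists.1 h'.ne_bot
  rw [← ha, ← hb] at h1 ⊢
  norm_cast at *
  simp only [WithBot.unbotD_coe]
  linarith

lemma exists_tight {d : ℕ} (v : Fin d → TropNum) (y : Fin d → ℝ) : ∃ i, Tight v y i := by
  obtain ⟨i, -, hi⟩ := Finset.exists_max_image Finset.univ
    (fun k => homog v k + (-rhomog y k : ℝ)) ⟨0, Finset.mem_univ 0⟩
  refine ⟨i, fun k => ?_⟩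
  have := hi k (Finset.mem_univ k)
  generalize homog v k = b at *
  generalize homog v i = c at *
  induction b using WithBot.recBotCoe with
  | bot => simp
  | coe b =>
    induction c using WithBot.recBotCoe with
    | bot => simp [← WithBot.coe_add] at this
    | coe c => norm_cast at *; linarith

/-- Strict tightness at one point and tightness at another one give strict tightness in between. -/
lemma StrictlyTight.combo {d : ℕ} {v : Fin d → TropNum} {y z : Fin d → ℝ}
    {i : Fin (d + 1)} (h : StrictlyTight v z i) (h' : Tight v y i) {s t : ℝ} (hs : 0 ≤ s)
    (ht : 0 < t) (hst : s + t = 1) : StrictlyTight v (s • y + t • z) i := by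
  intro k hk
  have h1 := h k hk
  have h2 := h' k
  obtain ⟨a, ha⟩ := WithBot.ne_bot_iff_exists.1 h'.ne_bot
  simp only [rhomog_combo]
  rw [← ha] at h1 h2 ⊢
  generalize homog v k = b at *
  induction b using WithBot.recBotCoe with
  | bot => rw [WithBot.bot_add, ← WithBot.coe_add]; exact WithBot.bot_lt_coe _
  | coe b =>
    norm_cast at *
    have : b = s * b + t * b := by rw [← add_mul, hst, one_mul]
    have : a = s * a + t * a := by rw [← add_mul, hst, one_mul]
    nlinarith

end TropVol

namespace TropVol
open Filter Topology

/-! ### Topology -/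

/-- The reals form the order-convex part above ⊥, so the order topology restricts to the usual one;
then take products. -/
lemma isInducing_ofReal {d : ℕ} : IsInducing (ofReal (d := d)) := by
  have h : IsInducing (fun r : ℝ => (r : TropNum)) :=
    (StrictMono.isEmbedding_of_ordConnected WithBot.coe_strictMono
      (by rw [WithBot.range_coe]; exact Set.ordConnected_Ioi)).isInducing
  exact IsInducing.piMap (f := fun _ : Fin d => fun r : ℝ => (r : TropNum)) fun _ => h

lemma ofReal_mem_closure_image {d : ℕ} {S : Set (Fin d → ℝ)} {y : Fin d → ℝ} :
    ofReal y ∈ closure (ofReal '' S) ↔ y ∈ closure S := by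
  rw [isInducing_ofReal.closure_eq_preimage_closure_image, Set.mem_preimage]

lemma isOpen_setOf_strictlyTight {d : ℕ} (v : Fin d → TropNum) (i : Fin (d + 1)) :
    IsOpen {y | StrictlyTight v y i} := by
  simp only [StrictlyTight, Set.ofPred_forall]
  refine isOpen_iInter_of_finite fun k => isOpen_iInter_of_finite fun _ => ?_
  generalize homog v k = b
  generalize homog v i = a
  induction b using WithBot.recBotCoe with
  | bot =>
    induction a using WithBot.recBotCoe with
    | bot => simp
    | coe a => simp [← WithBot.coe_add]
  | coe b =>
    induction a using WithBot.recBotCoe with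
    | bot => simp
    | coe a =>
      norm_cast
      exact isOpen_lt (continuous_const.add (continuous_rhomog i))
        (continuous_const.add (continuous_rhomog k))

lemma isClosed_setOf_tight {d : ℕ} (v : Fin d → TropNum) (i : Fin (d + 1)) :
    IsClosed {y | Tight v y i} := by
  simp only [Tight, Set.ofPred_forall]
  refine isClosed_iInter fun k => ?_
  generalize homog v k = b
  generalize homog v i = a
  induction b using WithBot.recBotCoe with
  | bot => simp
  | coe b =>
    induction a using WithBot.recBotCoe with
    | bot => simp [← WithBot.coe_add]
    | coe a =>
      norm_cast
      exact isClosed_le (continuous_const.add (continuous_rhomog i))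
        (continuous_const.add (continuous_rhomog k))

/-! ### Cells of full dimension -/

/-- The cell of the point `x`. -/
def cellOf {d : ℕ} (P : Set (Fin d → TropNum)) (x : Fin d → TropNum) : Set (Fin d → TropNum) :=
  {y | y ∈ P ∧ (∀ i, y i = ⊥ ↔ x i = ⊥) ∧
    covector (vertices P) y = covector (vertices P) x}

lemma cellOf_mem_cells {d : ℕ} {P : Set (Fin d → TropNum)} {x : Fin d → TropNum} (hx : x ∈ P) :
    cellOf P x ∈ cells P := ⟨x, hx, rfl⟩

lemma mem_cellOf_self {d : ℕ} {P : Set (Fin d → TropNum)} {x : Fin d → TropNum} (hx : x ∈ P) :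
    x ∈ cellOf P x := ⟨hx, fun _ => Iff.rfl, rfl⟩

lemma finrank_vectorSpan_lt {d : ℕ} {S : Set (Fin d → ℝ)} (l : (Fin d → ℝ) →ₗ[ℝ] ℝ) (hl : l ≠ 0)
    {c : ℝ} (hc : ∀ y ∈ S, l y = c) : Module.finrank ℝ (vectorSpan ℝ S) < d := by
  have h1 : vectorSpan ℝ S ≤ LinearMap.ker l := by
    rw [vectorSpan_def, Submodule.span_le]
    rintro _ ⟨x, hx, y, hy, rfl⟩
    simp [hc x hx, hc y hy]
  have h2 : vectorSpan ℝ S ≠ ⊤ := fun h => hl (by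
    rw [h, top_le_iff, LinearMap.ker_eq_top] at h1
    exact h1)
  simpa using Submodule.finrank_lt h2

/-- A homogeneous coordinate as a linear functional on real points. -/
def rhomogLinear {d : ℕ} (i : Fin (d + 1)) : (Fin d → ℝ) →ₗ[ℝ] ℝ where
  toFun y := rhomog y i
  map_add' y z := by simpa using rhomog_combo y z 1 1 i
  map_smul' c y := by simpa using rhomog_combo y 0 c 0 i

lemma rhomogLinear_sub_ne_zero {d : ℕ} {i k : Fin (d + 1)} (h : i ≠ k) :
    rhomogLinear i - rhomogLinear k ≠ 0 := by
  intro h0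
  have h1 : ∀ y : Fin d → ℝ, rhomog y i = rhomog y k := fun y =>
    sub_eq_zero.1 (LinearMap.congr_fun h0 y)
  induction i using Fin.cases with
  | zero =>
    induction k using Fin.cases with
    | zero => exact h rfl
    | succ k => simpa using h1 1
  | succ i =>
    induction k using Fin.cases with
    | zero => simpa using h1 1
    | succ k =>
      have := h1 (Pi.single i 1)
      simp only [rhomog_succ, Pi.single_eq_same] at this
      rw [Pi.single_eq_of_ne (fun hk => h (by rw [hk]))] at this
      exact one_ne_zero this

/-- The points of a cell of full dimension are real, and every vertex is tight
in exactly one coordinate. -/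
lemma exists_strictlyTight_of_le_cellDim {d : ℕ} {P : Set (Fin d → TropNum)}
    {x : Fin d → TropNum} (h : d ≤ cellDim (cellOf P x)) :
    (∀ i, x i ≠ ⊥) ∧ ∀ z, ofReal z ∈ cellOf P x → ∀ v ∈ vertices P, ∀ i, Tight v z i →
      StrictlyTight v z i := by
  have hx : ∀ i, x i ≠ ⊥ := by
    intro i hi
    -- A coordinate that is -∞ on the cell becomes constantly 0 in `cellDim`, so the cell would lie
    -- in a hyperplane.
    refine (finrank_vectorSpan_lt (rhomogLinear i.succ - rhomogLinear 0)
      (rhomogLinear_sub_ne_zero i.succ_ne_zero) (c := 0) ?_).not_ge h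
    rintro _ ⟨y, hy, rfl⟩
    have := (hy.2.1 i).2 hi
    simp [rhomogLinear, this]
  refine ⟨hx, fun z hz v hv i hi => strictlyTight_of_forall_tight hi fun k hk => ?_⟩
  by_contra hik
  refine (finrank_vectorSpan_lt (rhomogLinear i - rhomogLinear k)
    (rhomogLinear_sub_ne_zero (Ne.symm hik))
    (c := (homog v i).unbotD 0 - (homog v k).unbotD 0) ?_).not_ge h
  rintro _ ⟨y, hy, rfl⟩
  obtain ⟨y, rfl⟩ := exists_ofReal_eq (x := y) fun j hj => hx j ((hy.2.1 j).1 hj)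
  have h1 : covector (vertices P) (ofReal y) = covector (vertices P) (ofReal z) :=
    hy.2.2.trans hz.2.2.symm
  have h2 : ∀ j, Tight v z j → Tight v y j := fun j hj => by
    have : (j, v) ∈ covector (vertices P) (ofReal y) := by
      rw [h1]; exact mem_covector_ofReal.2 ⟨hv, hj⟩
    exact (mem_covector_ofReal.1 this).2
  exact (h2 i hi).add_eq (h2 k hk)

/-- The real points at which every vertex `v` is tight only in the coordinate `τ v` belong to
one cell. -/
lemma ofReal_mem_cellOf {d : ℕ} {P : Set (Fin d → TropNum)} {τ : (Fin d → TropNum) → Fin (d + 1)}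
    {x y : Fin d → ℝ} (hx : ∀ v ∈ vertices P, StrictlyTight v x (τ v))
    (hy : ∀ v ∈ vertices P, StrictlyTight v y (τ v)) (hyP : ofReal y ∈ P) :
    ofReal y ∈ cellOf P (ofReal x) := by
  refine ⟨hyP, fun i => by simp [ofReal], ?_⟩
  ext ⟨i, v⟩
  rw [mem_covector_ofReal, mem_covector_ofReal]
  refine and_congr_right fun hv => ⟨fun h => ?_, fun h => ?_⟩
  · rw [(hy v hv).eq_of_tight h]; exact (hx v hv).tight
  · rw [(hx v hv).eq_of_tight h]; exact (hy v hv).tight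

/-- Strict tightness of finitely many vertices is an open condition, so the cell contains a nonempty
open set, which spans the whole space. -/
lemma le_cellDim {d : ℕ} {P : Set (Fin d → TropNum)} (hP : (vertices P).Finite)
    (hP' : tconv (vertices P) = P) {τ : (Fin d → TropNum) → Fin (d + 1)}
    {x : Fin d → ℝ} (hx : ∀ v ∈ vertices P, StrictlyTight v x (τ v)) (hxP : ofReal x ∈ P) :
    d ≤ cellDim (cellOf P (ofReal x)) := by
  set U : Set (Fin d → ℝ) := {y | ∀ v ∈ vertices P, StrictlyTight v y (τ v)} with hU
  have hUo : IsOpen U := by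
    simp only [hU, Set.ofPred_forall]
    exact hP.isOpen_biInter fun v _ => isOpen_setOf_strictlyTight v (τ v)
  have hsub : U ⊆ (fun (x : Fin d → TropNum) (i : Fin d) => (x i).unbotD 0) ''
      cellOf P (ofReal x) := by
    intro y hy
    refine ⟨ofReal y, ofReal_mem_cellOf hx hy ?_, by ext i; simp [ofReal]⟩
    rw [← hP', ofReal_mem_tconv] at hxP ⊢
    -- A vertex tight at i for x satisfies τ v = i, so it is tight at i for y too.
    intro i
    obtain ⟨v, hv, hi⟩ := hxP i
    refine ⟨v, hv, ?_⟩
    rw [(hx v hv).eq_of_tight hi]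
    exact (hy v hv).tight
  have hne : U.Nonempty := ⟨x, by simpa [hU] using hx⟩
  have h1 : vectorSpan ℝ U = ⊤ := by
    have := hUo.affineSpan_eq_top hne
    rwa [AffineSubspace.affineSpan_eq_top_iff_vectorSpan_eq_top_of_nonempty ℝ _ _ hne] at this
  have h2 := vectorSpan_mono ℝ hsub
  rw [h1, top_le_iff] at h2
  rw [cellDim, h2]
  simp

/-! ### The real points of the trunk -/

/-- The direction e = (1, …, d) has the distinct homogeneous coordinates 0, 1, …, d. Hence two given
coordinates of z - y + t e agree for one value of t only, while strict tightness survives all small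
t. -/
lemma exists_perturbation {ι : Type*} [Finite ι] {d : ℕ} (v : ι → Fin d → TropNum)
    (i : ι → Fin (d + 1)) {z : Fin d → ℝ} (hz : ∀ j, StrictlyTight (v j) z (i j))
    (y : Fin d → ℝ) :
    ∃ z', (∀ j, StrictlyTight (v j) z' (i j)) ∧ Function.Injective (rhomog (z' - y)) := by
  set e : Fin d → ℝ := fun k => (k : ℝ) + 1 with he
  have hre : ∀ k, rhomog e k = (k : ℕ) := fun k => by
    induction k using Fin.cases <;> simp [he]
  have h1 : ∀ᶠ t in 𝓝[≠] (0 : ℝ), ∀ j, StrictlyTight (v j) (z + t • e) (i j) := by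
    refine eventually_all.2 fun j => ?_
    have hc : Tendsto (fun t : ℝ => z + t • e) (𝓝[≠] 0) (𝓝 z) := by
      have : Continuous fun t : ℝ => z + t • e := by fun_prop
      simpa using (this.tendsto 0).mono_left nhdsWithin_le_nhds
    exact hc.eventually ((isOpen_setOf_strictlyTight (v j) (i j)).mem_nhds (hz j))
  have h2 : ∀ᶠ t in 𝓝[≠] (0 : ℝ), ∀ k l, k ≠ l →
      rhomog (z - y + t • e) k ≠ rhomog (z - y + t • e) l := by
    refine eventually_all.2 fun k => eventually_all.2 fun l => ?_
    by_cases hkl : k = l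
    · simp [hkl]
    have hkl' : ((k : ℕ) : ℝ) - (l : ℕ) ≠ 0 := by
      rw [sub_ne_zero]
      exact_mod_cast fun h => hkl (Fin.ext h)
    have : ∀ᶠ t in 𝓝[≠] (0 : ℝ),
        t ≠ (rhomog (z - y) l - rhomog (z - y) k) / ((k : ℕ) - (l : ℕ)) := by
      by_cases h0 : (rhomog (z - y) l - rhomog (z - y) k) / (((k : ℕ) : ℝ) - (l : ℕ)) = 0
      · rw [h0]
        exact self_mem_nhdsWithin
      · exact nhdsWithin_le_nhds (isOpen_ne.mem_nhds (Ne.symm h0))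
    filter_upwards [this] with t ht _ h
    apply ht
    rw [rhomog_add_smul, rhomog_add_smul, hre, hre] at h
    rw [eq_div_iff hkl']
    linarith
  obtain ⟨t, ht1, ht2⟩ := (h1.and h2).exists
  refine ⟨z + t • e, ht1, fun k l h => ?_⟩
  by_contra hkl
  refine ht2 k l hkl ?_
  convert h using 2 <;> abel

/-- Moving a real point in a general direction by a small amount makes `v` tight in just one
coordinate, which does not depend on the amount. -/
lemma exists_eventually_strictlyTight {d : ℕ} (v : Fin d → TropNum) (y w : Fin d → ℝ)
    (hw : Function.Injective (rhomog w)) :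
    ∃ i, Tight v y i ∧ ∀ᶠ t in 𝓝[>] (0 : ℝ), StrictlyTight v (y + t • w) i := by
  classical
  obtain ⟨i₀, hi₀⟩ := exists_tight v y
  -- Moving along w, the difference v_k - y_k decreases at rate w_k, so the tight coordinate with
  -- the smallest w_k wins; injectivity of w excludes ties.
  obtain ⟨i, hi, hmin⟩ := Finset.exists_min_image
    (Finset.univ.filter fun k => Tight v y k) (rhomog w) ⟨i₀, by simpa using hi₀⟩
  simp only [Finset.mem_filter, Finset.mem_univ, true_and] at hi hmin
  refine ⟨i, hi, ?_⟩
  simp only [StrictlyTight]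
  refine eventually_all.2 fun k => ?_
  by_cases hk : k = i
  · simp [hk]
  obtain ⟨a, ha⟩ := WithBot.ne_bot_iff_exists.1 hi.ne_bot
  have h1 := hi k
  simp only [rhomog_add_smul]
  rcases eq_or_ne (homog v k) ⊥ with hb | hb
  · refine Eventually.of_forall fun t _ => ?_
    rw [hb, WithBot.bot_add, ← ha, ← WithBot.coe_add]
    exact WithBot.bot_lt_coe _
  obtain ⟨b, hb⟩ := WithBot.ne_bot_iff_exists.1 hb
  rw [← ha, ← hb] at h1 ⊢
  norm_cast at h1 ⊢
  rcases h1.lt_or_eq with h1 | h1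
  · have hc : Continuous fun t : ℝ =>
        a + (rhomog y k + t * rhomog w k) - (b + (rhomog y i + t * rhomog w i)) := by fun_prop
    have := (hc.tendsto 0).eventually (lt_mem_nhds (a := 0) (by simpa using h1))
    filter_upwards [nhdsWithin_le_nhds this] with t ht _
    linarith
  · have hk' : Tight v y k := fun l => by
      have h2 := hi l
      rw [← hb]
      rw [← ha] at h2
      generalize homog v l = c at *
      induction c using WithBot.recBotCoe with
      | bot => simp
      | coe c => norm_cast at *; linarith
    have h2 : rhomog w i < rhomog w k :=
      (hmin k hk').lt_of_ne fun h => hk (hw h).symm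
    filter_upwards [self_mem_nhdsWithin] with t ht _
    have : 0 < t * (rhomog w k - rhomog w i) := mul_pos ht (sub_pos.2 h2)
    linarith

/-- The real points of the trunk of a tropical polytope in terms of an arbitrary finite generating
set. -/
theorem ofReal_mem_trunk {d : ℕ} {V : Set (Fin d → TropNum)} (hV : V.Finite) {y : Fin d → ℝ} :
    ofReal y ∈ trunk d (tconv V) ↔ ∃ σ : Fin (d + 1) → Fin d → TropNum, (∀ i, σ i ∈ V) ∧
      (∃ z, ∀ i, StrictlyTight (σ i) z i) ∧ ∀ i, Tight (σ i) y i := by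
  have hWV := vertices_tconv_subset V
  have hW := tconv_vertices hV
  have hWf := hV.subset hWV
  set P := tconv V with hP
  constructor
  · rintro ⟨F, ⟨hF, _, ⟨x, hxP, rfl⟩, hdim, hFG⟩, hyF⟩
    change d ≤ cellDim (cellOf P x) at hdim
    change F ⊆ closure (cellOf P x) at hFG
    obtain ⟨hx, hst⟩ := exists_strictlyTight_of_le_cellDim hdim
    obtain ⟨z, rfl⟩ := exists_ofReal_eq hx
    have hz := hst z (mem_cellOf_self hxP)
    have h1 := hxP
    rw [← hW, ofReal_mem_tconv] at h1
    choose σ hσ hσ' using h1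
    refine ⟨σ, fun i => hWV (hσ i), ⟨z, fun i => hz _ (hσ i) _ (hσ' i)⟩, fun i => ?_⟩
    have h2 : cellOf P (ofReal z) ⊆ ofReal '' {y | Tight (σ i) y i} := by
      intro y hy
      obtain ⟨y, rfl⟩ := exists_ofReal_eq (x := y) fun j hj => hx j ((hy.2.1 j).1 hj)
      refine ⟨y, ?_, rfl⟩
      have : (i, σ i) ∈ covector (vertices P) (ofReal y) := by
        rw [hy.2.2]; exact mem_covector_ofReal.2 ⟨hσ i, hσ' i⟩
      exact (mem_covector_ofReal.1 this).2
    -- Tightness is a closed condition, so it passes from the full-dimensional cell to its closure.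
    have h3 := closure_mono h2 (hFG hyF)
    rwa [ofReal_mem_closure_image, (isClosed_setOf_tight _ _).closure_eq] at h3
  · rintro ⟨σ, hσV, ⟨z, hz⟩, hy⟩
    obtain ⟨z', hz', hinj⟩ := exists_perturbation σ id hz y
    set w := z' - y with hw
    choose τ hτ hτ' using fun v => exists_eventually_strictlyTight v y w hinj
    -- On the segment from y to z', without y, the generators σ i are strictly tight, which keeps
    -- the segment in P.
    have hmem : ∀ t ∈ Set.Ioc (0 : ℝ) 1, ofReal (y + t • w) ∈ P := by
      intro t ht
      have h1 : y + t • w = (1 - t) • y + t • z' := by rw [hw]; module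
      rw [h1, hP, ofReal_mem_tconv]
      exact fun i => ⟨σ i, hσV i, ((hz' i).combo (hy i) (by linarith [ht.2]) ht.1
        (by ring)).tight⟩
    -- Close to y every vertex v is tight in the single coordinate τ v, so x will lie in a cell of
    -- full dimension.
    have hev : ∀ᶠ t in 𝓝[>] (0 : ℝ), ∀ v ∈ vertices P, StrictlyTight v (y + t • w) (τ v) :=
      (eventually_all_finite hWf).2 fun v _ => hτ' v
    obtain ⟨t, ht, ht'⟩ := (hev.and (Ioc_mem_nhdsGT one_pos)).exists
    set x := y + t • w with hx
    have hxP := hmem t ht'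
    have hyP : ofReal y ∈ P := ofReal_mem_tconv.2 fun i => ⟨σ i, hσV i, hy i⟩
    refine ⟨cellOf P (ofReal y), ⟨cellOf_mem_cells hyP, cellOf P (ofReal x),
      cellOf_mem_cells hxP, le_cellDim hWf hW ht hxP, ?_⟩, mem_cellOf_self hyP⟩
    intro u hu
    obtain ⟨u, rfl⟩ := exists_ofReal_eq (x := u) fun j hj => by simpa [ofReal] using (hu.2.1 j).1 hj
    have hu' : ∀ v ∈ vertices P, Tight v u (τ v) := by
      intro v hv
      have : (τ v, v) ∈ covector (vertices P) (ofReal u) := by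
        rw [hu.2.2]; exact mem_covector_ofReal.2 ⟨hv, hτ v⟩
      exact (mem_covector_ofReal.1 this).2
    -- All points u of the cell of y have v tight at τ v, so the segment from u to x, without u,
    -- stays in the cell of x.
    have h1 : ofReal '' ((fun s : ℝ => (1 - s) • u + s • x) '' Set.Ioc 0 1) ⊆
        cellOf P (ofReal x) := by
      rintro _ ⟨_, ⟨s, hs, rfl⟩, rfl⟩
      have h2 : ∀ v ∈ vertices P, StrictlyTight v ((1 - s) • u + s • x) (τ v) := fun v hv =>
        (ht v hv).combo (hu' v hv) (by linarith [hs.2]) hs.1 (by ring)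
      refine ofReal_mem_cellOf ht h2 ?_
      rw [← hW, ofReal_mem_tconv] at hxP ⊢
      intro i
      obtain ⟨v, hv, hi⟩ := hxP i
      refine ⟨v, hv, ?_⟩
      rw [(ht v hv).eq_of_tight hi]
      exact (h2 v hv).tight
    refine closure_mono h1 (ofReal_mem_closure_image.2 ?_)
    have hc : Continuous fun s : ℝ => (1 - s) • u + s • x := by fun_prop
    have h0 : (0 : ℝ) ∈ closure (Set.Ioc (0 : ℝ) 1) := by
      rw [closure_Ioc zero_ne_one]; simp
    have := image_closure_subset_closure_image hc ⟨0, h0, rfl⟩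
    simpa using this

end TropVol

namespace TropVol

/-! ### Reasoning about programs -/

attribute [simp] NatExpr.eval TropExpr.eval Test.eval

/-- The program `p`, started with the memory `s`, halts after at most `B` steps with a memory that
satisfies `Q`. -/
def Runs (p : Program) (s : Memory) (B : ℕ) (Q : Memory → Prop) : Prop :=
  ∃ t s', Exec p s t s' ∧ t ≤ B ∧ Q s'

/-- Whether a program contains an assignment to an array of natural numbers. -/
def Program.writesNat : Program → ℕ → Bool
  | .skip, _ => false
  | .setNat a _ _, b => a == b
  | .setTrop _ _ _ _, _ => false
  | .seq p q, b => p.writesNat b || q.writesNat b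
  | .ite _ p q, b => p.writesNat b || q.writesNat b
  | .loop _ p, b => p.writesNat b

/-- Whether a program contains an assignment to an array of tropical numbers. -/
def Program.writesTrop : Program → ℕ → Bool
  | .skip, _ => false
  | .setNat _ _ _, _ => false
  | .setTrop a _ _ _, b => a == b
  | .seq p q, b => p.writesTrop b || q.writesTrop b
  | .ite _ p q, b => p.writesTrop b || q.writesTrop b
  | .loop _ p, b => p.writesTrop b

/-- The memories `s` and `s'` agree on all arrays that `p` does not assign to. -/
structure SameOutside (p : Program) (s s' : Memory) : Prop where
  nat : ∀ a, p.writesNat a = false → s'.nat a = s.nat a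
  trop : ∀ a, p.writesTrop a = false → s'.trop a = s.trop a

@[simp] lemma Memory.storeNat_nat_self (s : Memory) (a i v : ℕ) :
    (s.storeNat a i v).nat a = Function.update (s.nat a) i v := by
  simp [Memory.storeNat]

@[simp] lemma Memory.storeNat_nat_of_ne (s : Memory) {a b : ℕ} (i v : ℕ) (h : b ≠ a) :
    (s.storeNat a i v).nat b = s.nat b := by
  simp [Memory.storeNat, h]

@[simp] lemma Memory.storeNat_trop (s : Memory) (a i v : ℕ) :
    (s.storeNat a i v).trop = s.trop := rfl

@[simp] lemma Memory.storeTrop_trop_self (s : Memory) (a i j : ℕ) (v : TropNum) :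
    (s.storeTrop a i j v).trop a =
      Function.update (s.trop a) i (Function.update (s.trop a i) j v) := by
  simp [Memory.storeTrop]

@[simp] lemma Memory.storeTrop_trop_of_ne (s : Memory) {a b : ℕ} (i j : ℕ) (v : TropNum) (h : b ≠ a) :
    (s.storeTrop a i j v).trop b = s.trop b := by
  simp [Memory.storeTrop, h]

@[simp] lemma Memory.storeTrop_nat (s : Memory) (a i j : ℕ) (v : TropNum) :
    (s.storeTrop a i j v).nat = s.nat := rfl

/-- This frame property spares the loop invariants from listing everything that stays fixed. -/
lemma Exec.sameOutside {p : Program} {s s' : Memory} {t : ℕ} (h : Exec p s t s') :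
    SameOutside p s s' := by
  induction h with
  | skip s => exact ⟨fun _ _ => rfl, fun _ _ => rfl⟩
  | setNat s a i e =>
    refine ⟨fun b hb => Memory.storeNat_nat_of_ne _ _ _ ?_, fun _ _ => rfl⟩
    rintro rfl
    simp [Program.writesNat] at hb
  | setTrop s a i j e =>
    refine ⟨fun _ _ => rfl, fun b hb => Memory.storeTrop_trop_of_ne _ _ _ _ ?_⟩
    rintro rfl
    simp [Program.writesTrop] at hb
  | seq _ _ ih1 ih2 =>
    refine ⟨fun b hb => ?_, fun b hb => ?_⟩
    · simp only [Program.writesNat, Bool.or_eq_false_iff] at hb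
      rw [ih2.nat b hb.2, ih1.nat b hb.1]
    · simp only [Program.writesTrop, Bool.or_eq_false_iff] at hb
      rw [ih2.trop b hb.2, ih1.trop b hb.1]
  | iteTrue _ _ ih =>
    refine ⟨fun b hb => ?_, fun b hb => ?_⟩
    · simp only [Program.writesNat, Bool.or_eq_false_iff] at hb
      exact ih.nat b hb.1
    · simp only [Program.writesTrop, Bool.or_eq_false_iff] at hb
      exact ih.trop b hb.1
  | iteFalse _ _ ih =>
    refine ⟨fun b hb => ?_, fun b hb => ?_⟩
    · simp only [Program.writesNat, Bool.or_eq_false_iff] at hb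
      exact ih.nat b hb.2
    · simp only [Program.writesTrop, Bool.or_eq_false_iff] at hb
      exact ih.trop b hb.2
  | loopTrue _ _ _ ih1 ih2 =>
    exact ⟨fun b hb => by rw [ih2.nat b hb, ih1.nat b hb],
      fun b hb => by rw [ih2.trop b hb, ih1.trop b hb]⟩
  | loopFalse _ => exact ⟨fun _ _ => rfl, fun _ _ => rfl⟩

lemma SameOutside.trans {p : Program} {s s' s'' : Memory} (h : SameOutside p s s')
    (h' : SameOutside p s' s'') : SameOutside p s s'' :=
  ⟨fun a ha => (h'.nat a ha).trans (h.nat a ha), fun a ha => (h'.trop a ha).trans (h.trop a ha)⟩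

lemma Runs.mono {p : Program} {s : Memory} {B B' : ℕ} {Q Q' : Memory → Prop}
    (h : Runs p s B Q) (hB : B ≤ B') (hQ : ∀ s', Q s' → SameOutside p s s' → Q' s') :
    Runs p s B' Q' := by
  obtain ⟨t, s', he, ht, hs⟩ := h
  exact ⟨t, s', he, ht.trans hB, hQ s' hs he.sameOutside⟩

lemma Runs.le {p : Program} {s : Memory} {B B' : ℕ} {Q : Memory → Prop}
    (h : Runs p s B Q) (hB : B ≤ B') : Runs p s B' Q :=
  h.mono hB fun _ h _ => h

lemma Runs.skip {s : Memory} {Q : Memory → Prop} (h : Q s) : Runs .skip s 1 Q :=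
  ⟨1, s, .skip s, le_rfl, h⟩

lemma Runs.setNat {s : Memory} {a : ℕ} {i e : NatExpr} {Q : Memory → Prop}
    (h : Q (s.storeNat a (i.eval s) (e.eval s))) :
    Runs (.setNat a i e) s (i.cost + e.cost + 1) Q :=
  ⟨_, _, .setNat s a i e, le_rfl, h⟩

lemma Runs.setTrop {s : Memory} {a : ℕ} {i j : NatExpr} {e : TropExpr} {Q : Memory → Prop}
    (h : Q (s.storeTrop a (i.eval s) (j.eval s) (e.eval s))) :
    Runs (.setTrop a i j e) s (i.cost + j.cost + e.cost + 1) Q :=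
  ⟨_, _, .setTrop s a i j e, le_rfl, h⟩

/-- Unlike in `Runs.seq`, the analysis of `q` may use the frame property of `p`. -/
lemma Runs.seq_same {p q : Program} {s : Memory} {B B' : ℕ} {Q : Memory → Prop}
    (h : Runs p s B fun s' => SameOutside p s s' → Runs q s' B' Q) :
    Runs (.seq p q) s (B + B') Q := by
  obtain ⟨t, s', he, ht, hs⟩ := h
  obtain ⟨t', s'', he', ht', hs'⟩ := hs he.sameOutside
  exact ⟨t + t', s'', .seq he he', add_le_add ht ht', hs'⟩

lemma Runs.seq {p q : Program} {s : Memory} {B B' : ℕ} {Q : Memory → Prop}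
    (h : Runs p s B fun s' => Runs q s' B' Q) : Runs (.seq p q) s (B + B') Q :=
  Runs.seq_same (h.mono le_rfl fun _ h _ _ => h)

lemma Runs.ite {b : Test} {p q : Program} {s : Memory} {B B' : ℕ} {Q : Memory → Prop}
    (h : b.eval s → Runs p s B Q) (h' : ¬ b.eval s → Runs q s B' Q) :
    Runs (.ite b p q) s (b.cost + 1 + max B B') Q := by
  by_cases hb : b.eval s
  · obtain ⟨t, s', he, ht, hs⟩ := h hb
    exact ⟨_, s', .iteTrue hb he, by omega, hs⟩
  · obtain ⟨t, s', he, ht, hs⟩ := h' hb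
    exact ⟨_, s', .iteFalse hb he, by omega, hs⟩

lemma Runs.ite_pos {b : Test} {p q : Program} {s : Memory} {B : ℕ} {Q : Memory → Prop}
    (hb : b.eval s) (h : Runs p s B Q) : Runs (.ite b p q) s (b.cost + 1 + B) Q := by
  obtain ⟨t, s', he, ht, hs⟩ := h
  exact ⟨_, s', .iteTrue hb he, by omega, hs⟩

lemma Runs.ite_neg {b : Test} {p q : Program} {s : Memory} {B : ℕ} {Q : Memory → Prop}
    (hb : ¬ b.eval s) (h : Runs q s B Q) : Runs (.ite b p q) s (b.cost + 1 + B) Q := by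
  obtain ⟨t, s', he, ht, hs⟩ := h
  exact ⟨_, s', .iteFalse hb he, by omega, hs⟩

/-- The entry `0` of an array of natural numbers, used as a variable. -/
abbrev NatExpr.var (a : ℕ) : NatExpr := .read a (.const 0)

/-- The loop "for `i` from `0` to `N - 1` do `p`". -/
def Program.for (i : ℕ) (N : NatExpr) (p : Program) : Program :=
  .seq (.setNat i (.const 0) (.const 0)) (.loop (.natLt (.var i) N)
    (.seq p (.setNat i (.const 0) (.add (.var i) (.const 1)))))

/-- Induction on the number `r` of remaining rounds. A round costs `B` for the body, `N.cost + 4`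
for the test and 6 for the counter; the final failing test costs `N.cost + 4` again. -/
lemma Runs.for_aux {i : ℕ} {N : NatExpr} {p : Program} {s₀ : Memory} {n B : ℕ}
    (I : ℕ → Memory → Prop) (hi : p.writesNat i = false)
    (hN : ∀ s', SameOutside (.for i N p) s₀ s' → N.eval s' = n)
    (hstep : ∀ k < n, ∀ s', I k s' → s'.nat i 0 = k → SameOutside (.for i N p) s₀ s' →
      Runs p s' B fun s'' => SameOutside p s' s'' → I (k + 1) (s''.storeNat i 0 (k + 1))) :
    ∀ r k s, r + k = n → I k s → s.nat i 0 = k → SameOutside (.for i N p) s₀ s →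
      Runs (.loop (.natLt (.var i) N) (.seq p (.setNat i (.const 0) (.add (.var i) (.const 1)))))
        s (r * (B + N.cost + 10) + N.cost + 4)
        fun s' => I n s' ∧ s'.nat i 0 = n ∧ SameOutside (.for i N p) s₀ s' := by
  intro r
  induction r with
  | zero =>
    intro k s hk hI hs hS
    obtain rfl : k = n := by omega
    refine ⟨_, s, .loopFalse ?_, ?_, hI, hs, hS⟩
    · simp [Test.eval, NatExpr.eval, hs, hN s hS]
    · simp [Test.cost, NatExpr.cost]; omega
  | succ r ih =>
    intro k s hk hI hs hS
    obtain ⟨t, s', he, ht, hs'⟩ := hstep k (by omega) s hI hs hS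
    have hS1 := he.sameOutside
    have hs'' := hs' hS1
    have hik : s'.nat i 0 = k := by rw [hS1.nat i hi, hs]
    have he2 := Exec.setNat s' i (.const 0) (.add (.var i) (.const 1))
    have he3 := Exec.seq he he2
    simp only [NatExpr.eval, NatExpr.cost, hik] at he3
    have hS2 : SameOutside (.for i N p) s s' :=
      ⟨fun a ha => hS1.nat a (by simp [Program.for, Program.writesNat] at ha; exact ha.2.1),
        fun a ha => hS1.trop a (by simpa [Program.for, Program.writesTrop] using ha)⟩
    have hS3 : SameOutside (.for i N p) s' (s'.storeNat i 0 (k + 1)) :=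
      ⟨fun a ha => Memory.storeNat_nat_of_ne _ _ _ (by
        rintro rfl; simp [Program.for, Program.writesNat] at ha), fun a ha => rfl⟩
    obtain ⟨t', s3, he', ht', hs3⟩ := ih (k + 1) _ (by omega) hs'' (by simp)
      ((hS.trans hS2).trans hS3)
    refine ⟨_, s3, .loopTrue ?_ he3 he', ?_, hs3⟩
    · simp [Test.eval, NatExpr.eval, hs, hN s hS]
      omega
    · simp only [Test.cost, NatExpr.cost]
      rw [Nat.succ_mul]
      omega

/-- The rule for loops with a counter: `I k` is the invariant at the beginning of round `k`. -/
lemma Runs.for {i : ℕ} {N : NatExpr} {p : Program} {s : Memory} {n B : ℕ} {Q : Memory → Prop}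
    (I : ℕ → Memory → Prop) (hi : p.writesNat i = false)
    (hN : ∀ s', SameOutside (.for i N p) s s' → N.eval s' = n)
    (h0 : I 0 (s.storeNat i 0 0))
    (hstep : ∀ k < n, ∀ s', I k s' → s'.nat i 0 = k → SameOutside (.for i N p) s s' →
      Runs p s' B fun s'' => SameOutside p s' s'' → I (k + 1) (s''.storeNat i 0 (k + 1)))
    (hQ : ∀ s', I n s' → s'.nat i 0 = n → SameOutside (.for i N p) s s' → Q s') :
    Runs (.for i N p) s (n * (B + N.cost + 10) + N.cost + 7) Q := by
  have hS : SameOutside (.for i N p) s (s.storeNat i 0 0) :=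
    ⟨fun a ha => Memory.storeNat_nat_of_ne _ _ _ (by
      rintro rfl; simp [Program.for, Program.writesNat] at ha), fun a ha => rfl⟩
  obtain ⟨t, s', he, ht, h1, h2, h3⟩ :=
    Runs.for_aux I hi hN hstep n 0 (s.storeNat i 0 0) rfl h0 (by simp) hS
  refine ⟨_, s', .seq (.setNat s i (.const 0) (.const 0)) he, ?_, hQ s' h1 h2 h3⟩
  simp only [NatExpr.cost]
  omega

end TropVol

namespace TropVol

/-! ### The program

Arrays of natural numbers: `2` the current set of columns, `3` the row matched to a column,
`4` the time at which a column was reached, `5` the predecessor of a column, `6` the columns not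
yet peeled off. Variables: `10` the size `n` of the simplex, `11` and `12` columns, `13` and `15`
flags, `20`, ..., `24` counters.

Arrays of tropical numbers: `2` the matrix, `3` and `4` the potentials of rows and columns,
`5` the distances; `6`, `7` and `8` are variables. -/

namespace Prog
open NatExpr TropExpr Test Program

/-- Assignment to a variable with values in the natural numbers. -/
abbrev letNat (a : ℕ) (e : NatExpr) : Program := .setNat a (.const 0) e

/-- Assignment to an entry of a vector of tropical numbers. -/
abbrev setVec (a : ℕ) (j : NatExpr) (e : TropExpr) : Program := .setTrop a (.const 0) j e

/-- An entry of a vector of tropical numbers. -/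
abbrev vec (a : ℕ) (j : NatExpr) : TropExpr := .read a (.const 0) j

/-- The disequality of two numbers. -/
abbrev natNe (e f : NatExpr) : Test := .not (.and (.not (.natLt e f)) (.not (.natLt f e)))

/-- Copies the selected columns, with a row of zeros above and another one below. -/
def copy : Program :=
  .for 20 (var 10) (.seq (.setTrop 2 (.const 0) (var 20) .one)
    (.seq (.setTrop 2 (var 10) (var 20) .one)
      (.for 21 (var 0) (.setTrop 2 (.add (var 21) (.const 1)) (var 20)
        (.read 0 (var 21) (.read 2 (var 20)))))))

/-- Starts with the empty matching and zero potentials. -/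
def init : Program :=
  .seq (.for 20 (var 10) (.seq (.setNat 3 (var 20) (.add (var 10) (.const 1)))
    (.seq (setVec 3 (var 20) .one) (setVec 4 (var 20) .one))))
    (.seq (setVec 3 (var 10) .one) (letNat 13 (.const 0)))

/-- Prepares the search for a shortest path from the row in variable `22`. -/
def searchInit : Program :=
  .seq (.for 20 (var 10) (.seq (.setNat 4 (var 20) (.const 0)) (setVec 5 (var 20) .zero)))
    (.seq (.setNat 4 (var 10) (.const 1)) (.seq (setVec 5 (var 10) .one)
      (.seq (.setNat 3 (var 10) (var 22)) (letNat 11 (var 10)))))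

/-- Updates the distance of the column in variable `24`. -/
def relax : Program :=
  .ite (.natLt (.read 4 (var 24)) (.const 1))
    (.seq (setVec 7 (.const 0) (.mul (.mul (.mul (vec 5 (var 11))
        (.read 2 (.read 3 (var 11)) (var 24))) (.inv (vec 3 (.read 3 (var 11)))))
        (.inv (vec 4 (var 24)))))
      (.seq (.ite (.tropLt (vec 5 (var 24)) (vec 7 (.const 0)))
          (.seq (setVec 5 (var 24) (vec 7 (.const 0))) (.setNat 5 (var 24) (var 11))) .skip)
        (.ite (.tropLt (vec 6 (.const 0)) (vec 5 (var 24)))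
          (.seq (setVec 6 (.const 0) (vec 5 (var 24))) (letNat 12 (var 24))) .skip)))
    .skip

/-- Updates all distances and determines the best new column. -/
def scan : Program :=
  .seq (setVec 6 (.const 0) .zero) (.seq (letNat 12 (var 10)) (.for 24 (var 10) relax))

/-- Adds the best new column to the tree of shortest paths. -/
def grow : Program :=
  .ite (.natLt (.read 3 (var 11)) (.add (var 10) (.const 1)))
    (.seq scan (.ite (.natLt (var 12) (var 10))
      (.seq (letNat 11 (var 12)) (.setNat 4 (var 11) (.add (var 23) (.const 2)))) .skip)) .skip

/-- The search for a shortest path from the row in variable `22` to an unmatched column. -/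
def search : Program := .seq searchInit (.for 23 (var 10) grow)

/-- Updates the potentials after a search. -/
def update : Program :=
  .seq (setVec 6 (.const 0) (vec 5 (var 11)))
    (.for 20 (.add (var 10) (.const 1)) (.ite (.natLt (.const 0) (.read 4 (var 20)))
      (.seq (setVec 7 (.const 0) (.mul (vec 6 (.const 0)) (.inv (vec 5 (var 20)))))
        (.seq (setVec 3 (.read 3 (var 20)) (.mul (vec 3 (.read 3 (var 20))) (vec 7 (.const 0))))
          (setVec 4 (var 20) (.mul (vec 4 (var 20)) (.inv (vec 7 (.const 0))))))) .skip))

/-- Augments the matching along the shortest path. -/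
def augmentPath : Program :=
  .for 23 (var 10) (.ite (.natLt (var 11) (var 10))
    (.seq (letNat 12 (.read 5 (var 11)))
      (.seq (.setNat 3 (var 11) (.read 3 (var 12))) (letNat 11 (var 12)))) .skip)

/-- Matches the row in variable `22`; variable `13` is set to `1` if this is not possible. -/
def insertRow : Program :=
  .ite (.natLt (var 13) (.const 1))
    (.seq search (.ite (.natLt (.read 3 (var 11)) (.add (var 10) (.const 1)))
      (letNat 13 (.const 1)) (.seq update augmentPath))) .skip

/-- Peels off the column in variable `20` if no other remaining column precedes it. -/
def peelColumn : Program :=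
  .seq (letNat 15 (.const 1)) (.seq
    (.for 24 (var 10) (.ite (.and (.natLt (.const 0) (.read 6 (var 24)))
      (.and (natNe (var 24) (var 20)) (.not (.tropLt (.read 2 (.read 3 (var 24)) (var 20))
        (.mul (vec 3 (.read 3 (var 24))) (vec 4 (var 20)))))))
      (letNat 15 (.const 0)) .skip))
    (.ite (.natLt (.const 0) (var 15)) (.setNat 6 (var 20) (.const 0)) .skip))

/-- Decides whether the matching is the only optimal one; the answer is stored in
variable `15`. -/
def peel : Program :=
  .seq (.for 20 (var 10) (.setNat 6 (var 20) (.const 1)))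
    (.seq (.for 23 (var 10) (.for 20 (var 10) peelColumn))
      (.seq (letNat 15 (.const 1)) (.for 20 (var 10)
        (.ite (.natLt (.const 0) (.read 6 (var 20))) (letNat 15 (.const 0)) .skip))))

/-- Adds the coordinate sum of the barycenter to the output. -/
def record : Program :=
  .seq (setVec 8 (.const 0) .one) (.seq
    (.for 20 (var 10) (setVec 8 (.const 0) (.mul (vec 8 (.const 0))
      (.mul (.mul (vec 3 (.read 3 (var 20))) (.inv (vec 5 (var 20)))) (.inv (vec 3 (var 10)))))))
    (setVec 1 (.const 0) (.add (vec 1 (.const 0)) (vec 8 (.const 0)))))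

/-- Finds an optimal matching, if there is one. -/
def hungarian : Program := .seq init (.for 22 (var 10) insertRow)

/-- Processes one simplex. -/
def simplex : Program :=
  .seq copy (.seq hungarian (.ite (.natLt (var 13) (.const 1))
    (.seq search (.seq peel (.ite (.natLt (.const 0) (var 15)) record .skip))) .skip))

/-- Proceeds to the next set of columns; variable `14` is set to `0` if there is none. -/
def next : Program :=
  .seq (letNat 15 (.const 1)) (.seq
    (.for 20 (var 10) (.ite (.natLt (.const 0) (var 15))
      (.ite (.natLt (.add (.read 2 (var 20)) (.const 1)) (.read 2 (.add (var 20) (.const 1))))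
        (.seq (.setNat 2 (var 20) (.add (.read 2 (var 20)) (.const 1))) (letNat 15 (.const 0)))
        (.setNat 2 (var 20) (var 20))) .skip))
    (letNat 14 (.sub (.const 1) (var 15))))

/-- Prepares the first set of columns. -/
def start : Program :=
  .seq (letNat 10 (.add (var 0) (.const 1))) (.seq
    (.for 20 (var 10) (.setNat 2 (var 20) (var 20)))
    (.seq (.setNat 2 (var 10) (.read 0 (.const 1))) (letNat 14 (.const 1))))

/-- The program that computes the tropical barycentric volume. -/
def main : Program :=
  .ite (.natLt (var 0) (.read 0 (.const 1)))
    (.seq start (.loop (.natLt (.const 0) (var 14)) (.seq simplex next))) .skip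

end Prog
end TropVol

namespace TropVol
open Function

/-! ### Searching for a shortest path -/

/-- The tropical number `x + a - u - v`. -/
def reduced (x a u v : TropNum) : TropNum :=
  x + a + u.map (fun r => -r) + v.map (fun r => -r)

/-- The length of the path to column `j` via the column in variable `11`. -/
def Memory.newDist (s : Memory) (j : ℕ) : TropNum :=
  reduced (s.trop 5 0 (s.nat 11 0)) (s.trop 2 (s.nat 3 (s.nat 11 0)) j)
    (s.trop 3 0 (s.nat 3 (s.nat 11 0))) (s.trop 4 0 j)

/-- The state of a scan before column `k`: `s` is the memory before the scan. -/
structure ScanInv (s : Memory) (n k : ℕ) (s' : Memory) : Prop where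
  done : ∀ j < k, s.nat 4 j = 0 → s'.trop 5 0 j = max (s.trop 5 0 j) (s.newDist j) ∧
    s'.nat 5 j = if s.trop 5 0 j < s.newDist j then s.nat 11 0 else s.nat 5 j
  same : ∀ j, (j < k → s.nat 4 j ≠ 0) → s'.trop 5 0 j = s.trop 5 0 j ∧ s'.nat 5 j = s.nat 5 j
  best : ∀ j < k, s.nat 4 j = 0 → s'.trop 5 0 j ≤ s'.trop 6 0 0
  arg : (s'.nat 12 0 = n ∧ s'.trop 6 0 0 = ⊥) ∨ (s'.nat 12 0 < k ∧ s.nat 4 (s'.nat 12 0) = 0 ∧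
    s'.trop 6 0 0 = s'.trop 5 0 (s'.nat 12 0) ∧ s'.trop 6 0 0 ≠ ⊥)

lemma ScanInv.succ {s₀ s s' : Memory} {n k : ℕ} (h : ScanInv s₀ n k s) (hk : s₀.nat 4 k = 0)
    (hD : s'.trop 5 0 k = max (s.trop 5 0 k) (s₀.newDist k))
    (hw : s'.nat 5 k = if s.trop 5 0 k < s₀.newDist k then s₀.nat 11 0 else s.nat 5 k)
    (hne : ∀ j ≠ k, s'.trop 5 0 j = s.trop 5 0 j ∧ s'.nat 5 j = s.nat 5 j)
    (hb : (s'.trop 5 0 k ≤ s.trop 6 0 0 ∧ s'.trop 6 0 0 = s.trop 6 0 0 ∧ s'.nat 12 0 = s.nat 12 0) ∨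
      (s.trop 6 0 0 < s'.trop 5 0 k ∧ s'.trop 6 0 0 = s'.trop 5 0 k ∧ s'.nat 12 0 = k)) :
    ScanInv s₀ n (k + 1) s' := by
  have hs := h.same k fun h => absurd h (lt_irrefl k)
  refine ⟨fun j hj hj0 => ?_, fun j hj => ?_, fun j hj hj0 => ?_, ?_⟩
  · by_cases hjk : j = k
    · subst hjk
      rw [hD, hw, hs.1, hs.2]
      exact ⟨rfl, rfl⟩
    · rw [(hne j hjk).1, (hne j hjk).2]
      exact h.done j (by omega) hj0
  · have hjk : j ≠ k := by rintro rfl; exact hj (by omega) hk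
    rw [(hne j hjk).1, (hne j hjk).2]
    exact h.same j fun hj' => hj (by omega)
  · by_cases hjk : j = k
    · subst hjk
      rcases hb with ⟨h1, h2, -⟩ | ⟨-, h2, -⟩
      · rwa [h2]
      · rw [h2]
    · rw [(hne j hjk).1]
      have := h.best j (by omega) hj0
      rcases hb with ⟨h1, h2, -⟩ | ⟨h1, h2, -⟩
      · rwa [h2]
      · rw [h2]; exact this.trans h1.le
  · rcases hb with ⟨h1, h2, h3⟩ | ⟨h1, h2, h3⟩
    · rw [h2, h3]
      rcases h.arg with h4 | ⟨h4, h5, h6, h7⟩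
      · exact .inl h4
      · rw [(hne _ h4.ne).1]
        exact .inr ⟨by omega, h5, h6, h7⟩
    · rw [h2, h3]
      exact .inr ⟨by omega, hk, rfl, (bot_le.trans_lt h1).ne'⟩

lemma ScanInv.skip {s₀ s : Memory} {n k : ℕ} (h : ScanInv s₀ n k s) (hk : s₀.nat 4 k ≠ 0) :
    ScanInv s₀ n (k + 1) s where
  done j hj hj0 := h.done j (by
    have : j ≠ k := by rintro rfl; exact hk hj0
    omega) hj0
  same j hj := h.same j fun h => hj (by omega)
  best j hj hj0 := h.best j (by
    have : j ≠ k := by rintro rfl; exact hk hj0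
    omega) hj0
  arg := h.arg.imp_right fun ⟨h1, h2⟩ => ⟨by omega, h2⟩

/-- The column in variable 11 is already in the tree, so a scan does not change its distance, and
`newDist` may refer to the memory before the scan. -/
theorem runs_relax {s₀ s : Memory} {n k : ℕ} (hk : s.nat 24 0 = k)
    (e3 : s.nat 3 = s₀.nat 3) (e4 : s.nat 4 = s₀.nat 4) (e11 : s.nat 11 = s₀.nat 11)
    (t2 : s.trop 2 = s₀.trop 2) (t3 : s.trop 3 = s₀.trop 3) (t4 : s.trop 4 = s₀.trop 4)
    (hused : s₀.nat 4 (s₀.nat 11 0) ≠ 0)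
    (h : ScanInv s₀ n k s) : Runs Prog.relax s 100 (ScanInv s₀ n (k + 1)) := by
  have hD : s.trop 5 0 (s₀.nat 11 0) = s₀.trop 5 0 (s₀.nat 11 0) := (h.same _ fun _ => hused).1
  -- Unfolded on the right only, so that `simp` can fold the expression of the program back into
  -- `newDist`.
  have hnew : s₀.newDist k = s₀.newDist k := rfl
  conv_rhs at hnew => simp only [Memory.newDist, reduced]
  refine Runs.le (Runs.ite (fun hb => .seq (.setTrop (.seq
    (.ite (fun h1 => .seq (.setTrop (.setNat
      (.ite (fun h2 => .seq (.setTrop (.setNat ?_))) fun h2 => .skip ?_))))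
      fun h1 => .skip
      (.ite (fun h2 => .seq (.setTrop (.setNat ?_))) fun h2 => .skip ?_)))))
    fun hb => .skip ?_) (by decide)
  on_goal 5 => exact h.skip (by simpa [hk, e4] using hb)
  all_goals
    simp [hk, e3, e4, e11, t2, t3, t4, hD, ← hnew] at hb h1 h2
    refine h.succ hb ?_ ?_ ?_ ?_ <;>
    simp +contextual [hk, e3, e11, t2, t3, t4, hD, ← hnew, h1, h2]
  all_goals exact h1.le

theorem runs_scan {s : Memory} {n : ℕ} (hn : s.nat 10 0 = n)
    (hused : s.nat 4 (s.nat 11 0) ≠ 0) :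
    Runs Prog.scan s (200 * n + 50) (ScanInv s n n) := by
  refine Runs.le (.seq (.setTrop (.seq (.setNat (.for (n := n) (B := 100) (ScanInv s n)
    (by decide) ?_ ?_ ?_ fun s' h _ _ => h))))) ?_
  · intro s' hS
    simp [hS.nat 10 (by decide), hn]
  · refine ⟨by simp, by simp, by simp, .inl (by simp [hn])⟩
  · intro k hk s' h hs' hS
    refine (runs_relax hs' ?_ ?_ ?_ ?_ ?_ ?_ hused h).mono le_rfl fun s'' h' hS' _ => ?_
    · rw [hS.nat 3 (by decide)]; simp
    · rw [hS.nat 4 (by decide)]; simp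
    · rw [hS.nat 11 (by decide)]; simp
    · rw [hS.trop 2 (by decide)]; simp
    · rw [hS.trop 3 (by decide)]; simp
    · rw [hS.trop 4 (by decide)]; simp
    · obtain ⟨h1, h2, h3, h4⟩ := h'
      exact ⟨by simpa using h1, by simpa using h2, by simpa using h3, by simpa using h4⟩
  · simp only [NatExpr.cost, TropExpr.cost]
    omega

lemma reduced_add (x a : TropNum) (u v : ℝ) : reduced x a u v + (u + v : ℝ) = x + a := by
  simp only [reduced, WithBot.map_coe]
  induction x using WithBot.recBotCoe with
  | bot => simp
  | coe x =>
    induction a using WithBot.recBotCoe with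
    | bot => simp
    | coe a => norm_cast; ring

lemma TropNum.add_coe_le_add_coe_iff {x y : TropNum} (r : ℝ) :
    x + (r : TropNum) ≤ y + (r : TropNum) ↔ x ≤ y := by
  induction x using WithBot.recBotCoe with
  | bot => simp
  | coe x =>
    induction y using WithBot.recBotCoe with
    | bot => simp [← WithBot.coe_add]
    | coe y => norm_cast; exact add_le_add_iff_right r

lemma reduced_le_iff {x a y : TropNum} {u v : ℝ} :
    reduced x a u v ≤ y ↔ x + a ≤ y + (u + v : ℝ) := by
  rw [← reduced_add x a u v, TropNum.add_coe_le_add_coe_iff]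

/-- A matching `p` of the rows `i < r` of the matrix `A` with columns `j < n`, where a number
`p j > n` means that the column `j` is not matched, and potentials `U`, `V` for these rows and all
columns which are tight on the matching. -/
structure PartialMatching (A : ℕ → ℕ → TropNum) (n r : ℕ) (p : ℕ → ℕ) (U V : ℕ → ℝ) : Prop where
  le : ∀ i < r, ∀ j < n, A i j ≤ (U i + V j : ℝ)
  tight : ∀ j < n, p j ≤ n → p j < r ∧ A (p j) j = (U (p j) + V j : ℝ)
  inj : ∀ j < n, ∀ j' < n, p j ≤ n → p j = p j' → j = j'
  surj : ∀ i < r, ∃ j < n, p j = i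

lemma PartialMatching.congr {A : ℕ → ℕ → TropNum} {n r : ℕ} {p p' : ℕ → ℕ} {U V : ℕ → ℝ}
    (hp : PartialMatching A n r p U V) (h : ∀ j < n, p' j = p j) :
    PartialMatching A n r p' U V := by
  refine ⟨hp.le, fun j hj => ?_, fun j hj j' hj' => ?_, fun i hi => ?_⟩
  · rw [h j hj]; exact hp.tight j hj
  · rw [h j hj, h j' hj']; exact hp.inj j hj j' hj'
  · obtain ⟨j, hj, hij⟩ := hp.surj i hi
    exact ⟨j, hj, by rw [h j hj, hij]⟩

/-- A tree of longest paths with respect to the reduced weights. Its root is the artificial column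
`n`. The columns `j` with `used j ≠ 0` belong to the tree; `last` is the column added last, and
`full` says whether the distances `D` take the row matched to the last column into account. -/
structure Tree (A : ℕ → ℕ → TropNum) (n : ℕ) (p : ℕ → ℕ) (U V : ℕ → ℝ) (used way : ℕ → ℕ)
    (D : ℕ → TropNum) (last t : ℕ) (full : Prop) : Prop where
  used_root : used n = 1
  dist_root : D n = 0
  last_le : last ≤ n
  used_last : used last ≠ 0
  used_le : ∀ j ≤ n, used j ≤ t + 1
  two_le : ∀ j < n, used j ≠ 0 → 2 ≤ used j
  root_last : last = n → ∀ j < n, used j = 0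
  matched : ∀ j ≤ n, used j ≠ 0 → j ≠ last → p j ≤ n
  dist_ne : ∀ j ≤ n, used j ≠ 0 → D j ≠ ⊥
  last_min : last < n → ∀ k < n, used k ≠ 0 → D last ≤ D k
  mono : ∀ j < n, used j = 0 → ∀ k < n, used k ≠ 0 → D j ≤ D k
  relaxed : ∀ k ≤ n, used k ≠ 0 → (k ≠ last ∨ full) → ∀ j < n,
    D k + A (p k) j ≤ D j + (U (p k) + V j : ℝ)
  way : ∀ j < n, D j ≠ ⊥ → way j ≤ n ∧ used (way j) ≠ 0 ∧ p (way j) ≤ n ∧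
    (used j ≠ 0 → used (way j) < used j) ∧
    D (way j) + A (p (way j)) j = D j + (U (p (way j)) + V j : ℝ)

section Tree
variable {A : ℕ → ℕ → TropNum} {n r : ℕ} {p : ℕ → ℕ} {U V : ℕ → ℝ} {used way way' : ℕ → ℕ}
  {D D' : ℕ → TropNum} {last t : ℕ} {full : Prop}

/-- The reduced weights of inserted rows are nonpositive and the last column has the smallest
distance in the tree, so columns in the tree never need an update. The last column is not the root
here, whose row need not have feasible potentials. -/
lemma Tree.relaxed_last (h : Tree A n p U V used way D last t full)
    (hp : PartialMatching A n r p U V) (hl : p last ≤ n) {j : ℕ} (hj : j < n) (hj' : used j ≠ 0) :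
    D last + A (p last) j ≤ D j + (U (p last) + V j : ℝ) := by
  have hln : last < n := h.last_le.lt_of_ne fun he => hj' (h.root_last he j hj)
  exact add_le_add (h.last_min hln j hj hj') (hp.le _ (hp.tight last hln hl).1 j hj)

/-- Relaxing the edges out of the last column. As reduced weights are nonpositive, distances outside
the tree still do not exceed those inside. -/
lemma Tree.scan (h : Tree A n p U V used way D last t full) (hp : PartialMatching A n r p U V)
    (hl : p last ≤ n)
    (hD : ∀ j < n, used j = 0 → D' j = max (D j) (reduced (D last) (A (p last) j)
      (U (p last)) (V j)))
    (hway : ∀ j < n, used j = 0 → way' j =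
      if D j < reduced (D last) (A (p last) j) (U (p last)) (V j) then last else way j)
    (hsame : ∀ j ≤ n, used j ≠ 0 → D' j = D j ∧ way' j = way j) :
    Tree A n p U V used way' D' last t True where
  used_root := h.used_root
  dist_root := by rw [(hsame n le_rfl (by simp [h.used_root])).1, h.dist_root]
  last_le := h.last_le
  used_last := h.used_last
  used_le := h.used_le
  two_le := h.two_le
  root_last := h.root_last
  matched := h.matched
  dist_ne j hj hj' := by
    rw [(hsame j hj hj').1]
    exact h.dist_ne j hj hj'
  last_min hl k hk hk' := by
    rw [(hsame k hk.le hk').1, (hsame _ h.last_le h.used_last).1]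
    exact h.last_min hl k hk hk'
  mono j hj hj' k hk hk' := by
    rw [(hsame k hk.le hk').1, hD j hj hj', max_le_iff]
    refine ⟨h.mono j hj hj' k hk hk', ?_⟩
    have hln : last < n := h.last_le.lt_of_ne fun he => hk' (h.root_last he k hk)
    rw [reduced_le_iff]
    exact add_le_add (h.last_min hln k hk hk') (hp.le _ (hp.tight last hln hl).1 j hj)
  relaxed k hk hk' _ j hj := by
    rw [(hsame k hk hk').1]
    by_cases hj' : used j = 0
    · by_cases hkl : k = last
      · subst hkl
        rw [← reduced_le_iff, hD j hj hj']
        exact le_max_right _ _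
      · refine (h.relaxed k hk hk' (.inl hkl) j hj).trans ?_
        rw [hD j hj hj']
        exact add_le_add_left (le_max_left _ _) _
    · rw [(hsame j hj.le hj').1]
      by_cases hkl : k = last
      · subst hkl
        exact h.relaxed_last hp hl hj hj'
      · exact h.relaxed k hk hk' (.inl hkl) j hj
  way j hj hj0 := by
    by_cases hj' : used j = 0
    · rw [hD j hj hj'] at hj0 ⊢
      rw [hway j hj hj']
      split_ifs with hlt
      · refine ⟨h.last_le, h.used_last, hl, fun h => absurd hj' h, ?_⟩
        rw [max_eq_right hlt.le, reduced_add, (hsame _ h.last_le h.used_last).1]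
      · rw [max_eq_left (not_lt.1 hlt)] at hj0 ⊢
        obtain ⟨h1, h2, h3, h4, h5⟩ := h.way j hj hj0
        exact ⟨h1, h2, h3, h4, by rwa [(hsame _ h1 h2).1]⟩
    · rw [(hsame j hj.le hj').1] at hj0 ⊢
      rw [(hsame j hj.le hj').2]
      obtain ⟨h1, h2, h3, h4, h5⟩ := h.way j hj hj0
      exact ⟨h1, h2, h3, h4, by rwa [(hsame _ h1 h2).1]⟩

/-- The greedy step of Dijkstra's algorithm, with maxima in place of minima. The stamp `t + 2`
exceeds all earlier ones, so predecessors always have smaller stamps. -/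
lemma Tree.grow (h : Tree A n p U V used way D last t True) (hl : p last ≤ n) {j₁ : ℕ}
    (hj₁ : j₁ < n) (hused : used j₁ = 0) (hbot : D j₁ ≠ ⊥)
    (hbest : ∀ j < n, used j = 0 → D j ≤ D j₁) :
    Tree A n p U V (update used j₁ (t + 2)) way D j₁ (t + 1) False where
  used_root := by rw [update_of_ne hj₁.ne', h.used_root]
  dist_root := h.dist_root
  last_le := hj₁.le
  used_last := by simp
  used_le j hj := by
    by_cases hj' : j = j₁
    · simp [hj']
    · rw [update_of_ne hj']
      exact (h.used_le j hj).trans (by omega)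
  two_le j hj hj0 := by
    by_cases hj' : j = j₁
    · simp [hj']
    · rw [update_of_ne hj'] at hj0 ⊢
      exact h.two_le j hj hj0
  root_last he := absurd he hj₁.ne
  matched j hj hj0 hj' := by
    rw [update_of_ne hj'] at hj0
    by_cases hjl : j = last
    · rwa [hjl]
    · exact h.matched j hj hj0 hjl
  dist_ne j hj hj0 := by
    by_cases hj' : j = j₁
    · rwa [hj']
    · rw [update_of_ne hj'] at hj0
      exact h.dist_ne j hj hj0
  last_min _ k hk hk' := by
    by_cases hj' : k = j₁
    · rw [hj']
    · rw [update_of_ne hj'] at hk'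
      exact h.mono j₁ hj₁ hused k hk hk'
  mono j hj hj0 k hk hk' := by
    have hjj : j ≠ j₁ := by rintro rfl; simp at hj0
    rw [update_of_ne hjj] at hj0
    by_cases hj' : k = j₁
    · rw [hj']
      exact hbest j hj hj0
    · rw [update_of_ne hj'] at hk'
      exact h.mono j hj hj0 k hk hk'
  relaxed k hk hk' hor j hj := by
    have hkj : k ≠ j₁ := hor.resolve_right id
    rw [update_of_ne hkj] at hk'
    exact h.relaxed k hk hk' (.inr trivial) j hj
  way j hj hj0 := by
    obtain ⟨h1, h2, h3, h4, h5⟩ := h.way j hj hj0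
    have hne : way j ≠ j₁ := fun he => h2 (by rw [he, hused])
    rw [update_of_ne hne]
    refine ⟨h1, h2, h3, fun hj' => ?_, h5⟩
    by_cases hjj : j = j₁
    · rw [hjj, update_self]
      have := h.used_le _ h1
      rw [hjj] at this
      omega
    · rw [update_of_ne hjj] at hj' ⊢
      exact h4 hj'

lemma Tree.succ (h : Tree A n p U V used way D last t full) :
    Tree A n p U V used way D last (t + 1) full :=
  { h with used_le := fun j hj => (h.used_le j hj).trans (Nat.le_succ _) }

/-- The result of a complete search. -/
def SearchResult (A : ℕ → ℕ → TropNum) (n : ℕ) (p : ℕ → ℕ) (U V : ℕ → ℝ) (used way : ℕ → ℕ)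
    (D : ℕ → TropNum) (last t : ℕ) : Prop :=
  (Tree A n p U V used way D last t False ∧ n < p last) ∨
    (Tree A n p U V used way D last t True ∧ p last ≤ n ∧ ∀ j < n, used j = 0 → D j = ⊥)

/-- The state of a search after `t` rounds. -/
def SearchState (A : ℕ → ℕ → TropNum) (n : ℕ) (p : ℕ → ℕ) (U V : ℕ → ℝ) (used way : ℕ → ℕ)
    (D : ℕ → TropNum) (last t : ℕ) : Prop :=
  SearchResult A n p U V used way D last t ∨ (Tree A n p U V used way D last t False ∧
    p last ≤ n ∧ ((Finset.range n).filter fun j => used j ≠ 0).card = t)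

/-- An unfinished search has added a column in each round, so after n rounds all columns are in the
tree, and the missing relaxations hold by `Tree.relaxed_last`. -/
lemma SearchState.result (h : SearchState A n p U V used way D last n)
    (hp : PartialMatching A n r p U V) : SearchResult A n p U V used way D last n := by
  rcases h with h | ⟨h, hl, hc⟩
  · exact h
  have h1 : (Finset.range n).filter (fun j => used j ≠ 0) = Finset.range n :=
    Finset.eq_of_subset_of_card_le (Finset.filter_subset _ _) (by simp [hc])
  have h2 : ∀ j < n, used j ≠ 0 := fun j hj => by
    have : j ∈ Finset.range n := Finset.mem_range.2 hj
    rw [← h1] at this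
    exact (Finset.mem_filter.1 this).2
  refine .inr ⟨{ h with relaxed := fun k hk hk' _ j hj => ?_ }, hl, fun j hj hj' => absurd hj' (h2 j hj)⟩
  by_cases hkl : k = last
  · subst hkl
    exact h.relaxed_last hp hl hj (h2 j hj)
  · exact h.relaxed k hk hk' (.inl hkl) j hj

end Tree

end TropVol

/-! ### Correctness and cost of the search for longest paths -/

namespace TropVol
open Function

/-- The real vectors `U` and `V` are stored as the potentials. -/
structure Memory.HasPotentials (s : Memory) (n : ℕ) (U V : ℕ → ℝ) : Prop where
  row : ∀ i ≤ n, s.trop 3 0 i = (U i : TropNum)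
  col : ∀ j < n, s.trop 4 0 j = (V j : TropNum)

/-- A finished search stays finished under further rounds, so the loop can always run n times
without an early exit. -/
theorem runs_grow {s : Memory} {n r t : ℕ} {U V : ℕ → ℝ} (hn : s.nat 10 0 = n)
    (ht : s.nat 23 0 = t) (hpot : s.HasPotentials n U V)
    (hp : PartialMatching (s.trop 2) n r (s.nat 3) U V)
    (h : SearchState (s.trop 2) n (s.nat 3) U V (s.nat 4) (s.nat 5) (s.trop 5 0) (s.nat 11 0) t) :
    Runs Prog.grow s (200 * n + 100) fun s' =>
      SearchState (s.trop 2) n (s.nat 3) U V (s'.nat 4) (s'.nat 5) (s'.trop 5 0) (s'.nat 11 0)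
        (t + 1) := by
  have hscan : s.nat 3 (s.nat 11 0) ≤ n → ∃ full,
      Tree (s.trop 2) n (s.nat 3) U V (s.nat 4) (s.nat 5) (s.trop 5 0) (s.nat 11 0) t full ∧
      ((full ∧ ∀ j < n, s.nat 4 j = 0 → s.trop 5 0 j = ⊥) ∨
        ((Finset.range n).filter fun j => s.nat 4 j ≠ 0).card = t) := by
    rintro hl
    rcases h with (⟨-, h⟩ | ⟨h, -, h'⟩) | ⟨h, -, h'⟩
    · omega
    · exact ⟨True, h, .inl ⟨trivial, h'⟩⟩
    · exact ⟨False, h, .inr h'⟩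
  have hused : s.nat 4 (s.nat 11 0) ≠ 0 := by
    rcases h with (⟨h, -⟩ | ⟨h, -⟩) | ⟨h, -⟩ <;> exact h.used_last
  have key : ∀ s' : Memory, s.nat 3 (s.nat 11 0) ≤ n → ScanInv s n n s' →
      Tree (s.trop 2) n (s.nat 3) U V (s.nat 4) (s'.nat 5) (s'.trop 5 0) (s.nat 11 0) t True := by
    intro s' hl hs
    obtain ⟨full, hT, -⟩ := hscan hl
    have hnew : ∀ j < n, s.newDist j = reduced (s.trop 5 0 (s.nat 11 0))
        (s.trop 2 (s.nat 3 (s.nat 11 0)) j) (U (s.nat 3 (s.nat 11 0))) (V j) := fun j hj => by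
      rw [Memory.newDist, hpot.row _ hl, hpot.col j hj]
    exact hT.scan hp hl (fun j hj hj' => by rw [(hs.done j hj hj').1, hnew j hj])
      (fun j hj hj' => by rw [(hs.done j hj hj').2, hnew j hj]) fun j _ hj' => hs.same j fun _ => hj'
  refine Runs.le (.ite (fun hb => .seq_same ((runs_scan hn hused).mono le_rfl fun s' hs hS hS' =>
    .ite (fun hb' => .seq (.setNat (.setNat ?_))) fun hb' => .skip ?_)) fun hb => .skip ?_) ?_
  · have e3 := hS.nat 3 (by decide)
    have e4 := hS.nat 4 (by decide)
    have e10 := hS.nat 10 (by decide)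
    have e11 := hS.nat 11 (by decide)
    have e23 := hS.nat 23 (by decide)
    simp only [Test.eval, NatExpr.eval, hn, e10, Nat.lt_succ_iff] at hb hb'
    obtain ⟨full, hT, hor⟩ := hscan hb
    rcases hs.arg with ⟨h1, -⟩ | ⟨h1, h2, h3, h4⟩
    · omega
    have hT' := (key s' hb hs).grow hb h1 h2 (h3 ▸ h4)
      fun j hj hj' => (hs.best j hj hj').trans_eq h3
    have h5 : ((Finset.range n).filter
        fun j => update (s.nat 4) (s'.nat 12 0) (t + 2) j ≠ 0).card = t + 1 := by
      rcases hor with ⟨hfull, hor⟩ | hor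
      -- If the search was exhausted before, the relaxed inequality forces `newDist` to be ⊥ outside
      -- the tree, so no new column can be found.
      · have := (key s' hb hs).way
        refine absurd ?_ h4
        have h6 := (hs.done _ h1 h2).1
        rw [h3, h6, hor _ h1 h2, max_eq_right bot_le]
        rw [Memory.newDist, hpot.row _ hb, hpot.col _ h1, ← le_bot_iff, reduced_le_iff]
        have h7 := hT.relaxed _ hT.last_le hT.used_last (.inr hfull) _ h1
        rwa [hor _ h1 h2] at h7
      · rw [← hor, ← Finset.card_insert_of_notMem (a := s'.nat 12 0)
          (s := (Finset.range n).filter fun j => s.nat 4 j ≠ 0) (by simp [h2])]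
        congr 1
        ext j
        by_cases hj : j = s'.nat 12 0
        · simp [hj, h1]
        · simp [hj]
    have h8 : SearchState (s.trop 2) n (s.nat 3) U V
        (update (s.nat 4) (s'.nat 12 0) (t + 2)) (s'.nat 5) (s'.trop 5 0) (s'.nat 12 0) (t + 1) := by
      by_cases hl' : s.nat 3 (s'.nat 12 0) ≤ n
      · exact .inr ⟨hT', hl', h5⟩
      · exact .inl (.inl ⟨hT', not_le.1 hl'⟩)
    simpa [e4, e23, ht] using h8
  · have e4 := hS.nat 4 (by decide)
    have e10 := hS.nat 10 (by decide)
    have e11 := hS.nat 11 (by decide)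
    simp only [Test.eval, NatExpr.eval, hn, e10, Nat.lt_succ_iff] at hb hb'
    rcases hs.arg with ⟨-, h1⟩ | ⟨h1, -⟩
    · rw [e4, e11]
      refine .inl (.inr ⟨(key s' hb hs).succ, hb, fun j hj hj' => ?_⟩)
      rw [← le_bot_iff, ← h1]
      exact hs.best j hj hj'
    · omega
  · simp only [Test.eval, NatExpr.eval, hn, Nat.lt_succ_iff] at hb
    rcases h with (⟨h, h'⟩ | ⟨h, h', -⟩) | ⟨h, h', -⟩
    · exact .inl (.inl ⟨h.succ, h'⟩)
    · exact absurd h' hb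
    · exact absurd h' hb
  · simp only [NatExpr.cost, Test.cost]
    omega

lemma runs_searchInit {s : Memory} {n r : ℕ} (hn : s.nat 10 0 = n) (hr : s.nat 22 0 = r) :
    Runs Prog.searchInit s (40 * n + 50) fun s' =>
      s'.nat 3 = update (s.nat 3) n r ∧ s'.nat 11 0 = n ∧ s'.nat 4 n = 1 ∧ s'.trop 5 0 n = 0 ∧
        ∀ j < n, s'.nat 4 j = 0 ∧ s'.trop 5 0 j = ⊥ := by
  refine Runs.le (.seq_same (.for (n := n) (B := 20) (fun k s' => ∀ j < k, s'.nat 4 j = 0 ∧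
    s'.trop 5 0 j = ⊥) (by decide) (fun s' hS => ?_) (by simp) (fun k hk s' hI hs' hS =>
      .le (.seq (.setNat (.setTrop fun hS' => ?_))) (by decide))
    fun s' hI _ hS _ => .seq (.setNat (.seq (.setTrop (.seq (.setNat (.setNat ?_)))))))) ?_
  · simp [hS.nat 10 (by decide), hn]
  · intro j hj
    by_cases hjk : j = k
    · simp [hjk, hs']
    · simpa [hjk, hs'] using hI j (by omega)
  · have e10 := hS.nat 10 (by decide)
    have e22 := hS.nat 22 (by decide)
    have e3 := hS.nat 3 (by decide)
    simp [e10, e22, e3, hn, hr]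
    intro j hj
    simpa [hj.ne] using hI j hj
  · simp only [NatExpr.cost, TropExpr.cost]
    omega

/-- The memory after a search for a path from row `r`. -/
theorem runs_search {s : Memory} {n r : ℕ} {U V : ℕ → ℝ} (hn : s.nat 10 0 = n) (hn0 : 0 < n)
    (hr : s.nat 22 0 = r) (hrn : r ≤ n) (hpot : s.HasPotentials n U V)
    (hp : PartialMatching (s.trop 2) n r (s.nat 3) U V) :
    Runs Prog.search s (500 * (n + 1) ^ 2) fun s' =>
      s'.nat 3 = update (s.nat 3) n r ∧
      SearchResult (s.trop 2) n (s'.nat 3) U V (s'.nat 4) (s'.nat 5) (s'.trop 5 0)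
        (s'.nat 11 0) n := by
  -- The root of the search is the artificial column n, which carries the new row r; the real
  -- columns keep their rows.
  have hp' : PartialMatching (s.trop 2) n r (update (s.nat 3) n r) U V :=
    hp.congr fun j hj => update_of_ne hj.ne _ _
  refine Runs.le (.seq_same ((runs_searchInit hn hr).mono le_rfl
    fun s' ⟨h1, h2, h3, h4, h5⟩ hS _ => .for (n := n) (B := 200 * n + 100) (fun t s'' =>
        s''.nat 3 = update (s.nat 3) n r ∧ SearchState (s.trop 2) n (s''.nat 3) U V (s''.nat 4)
        (s''.nat 5) (s''.trop 5 0) (s''.nat 11 0) t) (by decide) (fun s'' hS' => ?_) ?_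
        (fun t ht s'' ⟨hI1, hI2⟩ hs' hS' => ?_) fun s'' hI' _ _ => ?_)) ?_
  · simp [hS'.nat 10 (by decide), hS.nat 10 (by decide), hn]
  · refine ⟨by simpa using h1, .inr ?_⟩
    have hj : ∀ j ≤ n, s'.nat 4 j ≠ 0 → j = n := fun j hj hj' => by
      by_contra hne
      exact hj' (h5 j (by omega)).1
    have hjn : ∀ j < n, ¬ s'.nat 4 j ≠ 0 := fun j hj hj' => hj' (h5 j hj).1
    have hT : Tree (s.trop 2) n (s'.nat 3) U V (s'.nat 4) (s'.nat 5) (s'.trop 5 0) n 0 False := by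
      refine ⟨h3, h4, le_rfl, by simp [h3], fun j hj => ?_, fun j hj hj' => absurd hj' (hjn j hj),
        fun _ j hj => (h5 j hj).1, fun j hj' h h' => absurd (hj j hj' h) h', fun j hj' h => ?_,
        fun h => absurd h (lt_irrefl n), fun _ _ _ k hk hk' => absurd hk' (hjn k hk),
        fun k hk hk' hor => absurd (hj k hk hk') (hor.resolve_right id),
        fun j hj hj' => absurd (h5 j hj).2 hj'⟩
      · rcases hj.lt_or_eq with h | h
        · simp [(h5 j h).1]
        · simp [h, h3]
      · simp [hj j hj' h, h4]
    refine ⟨by simpa [h2] using hT, by simp [h1, h2, hrn], ?_⟩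
    rw [Finset.card_eq_zero, Finset.filter_eq_empty_iff]
    intro j hj
    simpa using (h5 j (Finset.mem_range.1 hj)).1
  · have e2 : s''.trop 2 = s.trop 2 := (hS'.trop 2 (by decide)).trans (hS.trop 2 (by decide))
    have e3 : s''.trop 3 = s.trop 3 := (hS'.trop 3 (by decide)).trans (hS.trop 3 (by decide))
    have e4 : s''.trop 4 = s.trop 4 := (hS'.trop 4 (by decide)).trans (hS.trop 4 (by decide))
    have e10 : s''.nat 10 = s.nat 10 := (hS'.nat 10 (by decide)).trans (hS.nat 10 (by decide))
    refine (runs_grow (by rw [e10, hn]) hs' ⟨by rw [e3]; exact hpot.row, by rw [e4]; exact hpot.col⟩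
      (by rw [hI1, e2]; exact hp') (by rw [e2]; exact hI2)).mono le_rfl fun s3 h3 hS3 _ => ?_
    have e5 := hS3.nat 3 (by decide)
    rw [e2] at h3
    refine ⟨by simpa [e5] using hI1, by simpa [e5] using h3⟩
  · exact ⟨hI'.1, hI'.2.result (by rw [hI'.1]; exact hp')⟩
  · simp only [NatExpr.cost]
    nlinarith

end TropVol

namespace TropVol
open Function

/-! ### Augmenting the matching -/

section Augment
variable {A : ℕ → ℕ → TropNum} {n r : ℕ} {p : ℕ → ℕ} {U V U' V' : ℕ → ℝ} {used way : ℕ → ℕ}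
  {D : ℕ → TropNum} {last t : ℕ} {full : Prop}

/-- The amount by which the potential of column `j` decreases after a search. -/
def potentialStep (D : ℕ → TropNum) (last j : ℕ) : ℝ := (D last).unbotD 0 - (D j).unbotD 0

/-- A potential that is tight on a matching and on the edges of a tree of longest paths. -/
structure TreePotential (A : ℕ → ℕ → TropNum) (n r : ℕ) (p used way : ℕ → ℕ) (U V : ℕ → ℝ) :
    Prop where
  le : ∀ i ≤ r, ∀ j < n, A i j ≤ (U i + V j : ℝ)
  tight : ∀ j < n, p j ≤ n → A (p j) j = (U (p j) + V j : ℝ)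
  tree : ∀ j < n, used j ≠ 0 → A (p (way j)) j = (U (p (way j)) + V j : ℝ)

lemma Tree.exists_dist (h : Tree A n p U V used way D last t full) {j : ℕ} (hj : j ≤ n)
    (hj' : used j ≠ 0) : D j = ((D j).unbotD 0 : ℝ) := by
  obtain ⟨a, ha⟩ := WithBot.ne_bot_iff_exists.1 (h.dist_ne j hj hj')
  simp [← ha]

lemma PartialMatching.inj_root (hp : PartialMatching A n r p U V) (hr : p n = r) {j j' : ℕ}
    (hj : j ≤ n) (hj' : j' ≤ n) (hpj : p j ≤ n) (he : p j = p j') : j = j' := by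
  rcases hj.lt_or_eq with h | rfl
  · rcases hj'.lt_or_eq with h' | rfl
    · exact hp.inj j h j' h' hpj he
    · have := (hp.tight j h hpj).1
      omega
  · rcases hj'.lt_or_eq with h' | rfl
    · have := (hp.tight j' h' (by omega)).1
      omega
    · rfl

/-- The step of the Hungarian method. Shifting rows and columns of the tree by D last - D j keeps
matched edges tight, makes tree edges tight and turns the relaxed inequalities into feasibility.
Edges that leave or enter the tree are handled by D j ≤ D last outside the tree and D last ≤ D j for
its real columns. -/
lemma Tree.treePotential (h : Tree A n p U V used way D last t False) (hl : n < p last)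
    (hp : PartialMatching A n r p U V) (hr : p n = r) (hrn : r ≤ n)
    (hU : ∀ j ≤ n, used j ≠ 0 → p j ≤ n → U' (p j) = U (p j) + potentialStep D last j)
    (hU' : ∀ i ≤ n, (∀ j ≤ n, used j ≠ 0 → p j ≠ i) → U' i = U i)
    (hV : ∀ j < n, V' j = if used j ≠ 0 then V j - potentialStep D last j else V j) :
    TreePotential A n r p used way U' V' := by
  have hln : last < n := by
    refine h.last_le.lt_of_ne fun he => ?_
    rw [he] at hl
    omega
  have hlast := h.exists_dist h.last_le h.used_last
  simp only [potentialStep] at hU hV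
  have hunused : ∀ k ≤ n, p k ≤ n → used k = 0 → U' (p k) = U (p k) := fun k hk hpk hk' =>
    hU' _ hpk fun j hj hj' he => by
      have := hp.inj_root hr hk hj hpk he.symm
      exact hj' (this ▸ hk')
  refine ⟨fun i hi j hj => ?_, fun j hj hpj => ?_, fun j hj hj' => ?_⟩
  · obtain ⟨k, hk, rfl⟩ : ∃ k ≤ n, p k = i := by
      rcases hi.lt_or_eq with h | rfl
      · obtain ⟨k, hk, hk'⟩ := hp.surj i h
        exact ⟨k, hk.le, hk'⟩
      · exact ⟨n, le_rfl, hr⟩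
    have hpk : p k ≤ n := hi.trans hrn
    by_cases hk' : used k = 0
    · have hkn : k < n := hk.lt_of_ne fun he => by
        rw [he, h.used_root] at hk'
        omega
      rw [hunused k hk hpk hk', hV j hj]
      refine (hp.le _ (hp.tight k hkn hpk).1 j hj).trans ?_
      split_ifs with hj'
      · have := h.last_min hln j hj hj'
        rw [hlast, h.exists_dist hj.le hj'] at this
        norm_cast at *
        linarith
      · exact le_rfl
    · have hkl : k ≠ last := by rintro rfl; omega
      have h1 := h.relaxed k hk hk' (.inl hkl) j hj
      rw [hU k hk hk' hpk, hV j hj]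
      have hk2 := h.exists_dist hk hk'
      -- Outside the tree D j may be raised to D last, which fits the unchanged column potential.
      have h2 : D j ≤ ((if used j ≠ 0 then (D j).unbotD 0 else (D last).unbotD 0 : ℝ) : TropNum) := by
        split_ifs with hj'
        · exact (h.exists_dist hj.le hj').le
        · rw [← hlast]
          exact h.mono j hj (by simpa using hj') last hln h.used_last
      have h3 := h1.trans (add_le_add_left h2 _)
      rw [hk2] at h3
      generalize A (p k) j = a at *
      induction a using WithBot.recBotCoe with
      | bot => simp
      | coe a =>
        split_ifs at h3 ⊢ <;> norm_cast at * <;> linarith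
  · rw [(hp.tight j hj hpj).2, hV j hj]
    split_ifs with hj'
    · rw [hU j hj.le hj' hpj]
      norm_cast
      ring
    · rw [hunused j hj.le hpj (by simpa using hj')]
  · obtain ⟨h1, h2, h3, -, h5⟩ := h.way j hj (h.dist_ne j hj.le hj')
    rw [hU _ h1 h2 h3, hV j hj, if_pos hj']
    rw [h.exists_dist h1 h2, h.exists_dist hj.le hj'] at h5
    generalize A (p (way j)) j = a at *
    induction a using WithBot.recBotCoe with
    | bot => simp [← WithBot.coe_add] at h5
    | coe a => norm_cast at *; linarith

/-- The matching `p` while it is shifted along the path in a tree that leads to the unmatched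
column `hole`; `p₀` is the matching before. -/
structure Shifting (A : ℕ → ℕ → TropNum) (n r : ℕ) (p₀ p : ℕ → ℕ) (U V : ℕ → ℝ) (used : ℕ → ℕ)
    (hole : ℕ) : Prop where
  le : hole ≤ n
  used_ne : used hole ≠ 0
  same : ∀ j ≤ n, used j ≠ 0 → used j < used hole → p j = p₀ j
  row_le : ∀ j ≤ n, j ≠ hole → p j ≤ n → p j ≤ r
  tight : ∀ j < n, j ≠ hole → p j ≤ n → A (p j) j = (U (p j) + V j : ℝ)
  inj : ∀ j ≤ n, ∀ j' ≤ n, j ≠ hole → j' ≠ hole → p j ≤ n → p j = p j' → j = j'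
  surj : ∀ i ≤ r, ∃ j ≤ n, j ≠ hole ∧ p j = i

variable {p₀ : ℕ → ℕ} {hole : ℕ}

lemma Tree.shifting (h : Tree A n p U V used way D last t full) (hl : n < p last)
    (hp : PartialMatching A n r p U V) (hr : p n = r) (hrn : r ≤ n)
    (hpot : TreePotential A n r p used way U' V') : Shifting A n r p p U' V' used last where
  le := h.last_le
  used_ne := h.used_last
  same _ _ _ _ := rfl
  row_le j hj _ hpj := by
    rcases hj.lt_or_eq with h | rfl
    · exact (hp.tight j h hpj).1.le
    · exact hr.le
  tight j hj _ hpj := hpot.tight j hj hpj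
  inj j hj j' hj' _ _ hpj he := hp.inj_root hr hj hj' hpj he
  surj i hi := by
    obtain ⟨j, hj, rfl⟩ : ∃ j ≤ n, p j = i := by
      rcases hi.lt_or_eq with h | rfl
      · obtain ⟨k, hk, hk'⟩ := hp.surj i h
        exact ⟨k, hk.le, hk'⟩
      · exact ⟨n, le_rfl, hr⟩
    exact ⟨j, hj, by rintro rfl; omega, rfl⟩

/-- The hole takes over the row of its predecessor along a tight tree edge and moves there. Stamps
decrease along predecessors, so columns met later still carry their rows from `p₀`. -/
lemma Shifting.step (h : Shifting A n r p₀ p U' V' used hole) (hh : hole < n)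
    (hT : Tree A n p₀ U V used way D last t full)
    (hpot : TreePotential A n r p₀ used way U' V') :
    Shifting A n r p₀ (update p hole (p (way hole))) U' V' used (way hole) ∧
      used (way hole) < used hole := by
  obtain ⟨h1, h2, h3, h4, -⟩ := hT.way hole hh (hT.dist_ne hole hh.le h.used_ne)
  have h5 := h4 h.used_ne
  have hne : way hole ≠ hole := fun he => by rw [he] at h5; exact lt_irrefl _ h5
  have h6 := h.same _ h1 h2 h5
  refine ⟨⟨h1, h2, fun j hj hj' hlt => ?_, fun j hj hj' hpj => ?_, fun j hj hj' hpj => ?_,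
    fun j hj j' hj' hjw hjw' hpj he => ?_, fun i hi => ?_⟩, h5⟩
  · have : j ≠ hole := by rintro rfl; omega
    rw [update_of_ne this]
    exact h.same j hj hj' (hlt.trans h5)
  · by_cases hjh : j = hole
    · rw [hjh, update_self]
      exact h.row_le _ h1 hne (h6 ▸ h3)
    · rw [update_of_ne hjh] at hpj ⊢
      exact h.row_le j hj hjh hpj
  · by_cases hjh : j = hole
    · rw [hjh, update_self, h6]
      exact hpot.tree _ hh h.used_ne
    · rw [update_of_ne hjh] at hpj ⊢
      exact h.tight j hj hjh hpj
  · by_cases hjh : j = hole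
    · rw [hjh, update_self] at hpj he
      by_cases hjh' : j' = hole
      · rw [hjh, hjh']
      · rw [update_of_ne hjh'] at he
        exact absurd (h.inj _ h1 j' hj' hne hjh' hpj he).symm hjw'
    · rw [update_of_ne hjh] at hpj he
      by_cases hjh' : j' = hole
      · rw [hjh', update_self] at he
        exact absurd (h.inj j hj _ h1 hjh hne hpj he) hjw
      · rw [update_of_ne hjh'] at he
        exact h.inj j hj j' hj' hjh hjh' hpj he
  · obtain ⟨j, hj, hjh, hij⟩ := h.surj i hi
    by_cases hjw : j = way hole
    · exact ⟨hole, hh.le, hne.symm, by rw [update_self, ← hjw, hij]⟩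
    · exact ⟨j, hj, hjw, by rw [update_of_ne hjh, hij]⟩

/-- Once the hole is the artificial column, all rows up to r sit in real columns. -/
lemma Shifting.partialMatching (h : Shifting A n r p₀ p U' V' used n)
    (hpot : TreePotential A n r p₀ used way U' V') : PartialMatching A n (r + 1) p U' V' where
  le i hi j hj := hpot.le i (by omega) j hj
  tight j hj hpj := ⟨Nat.lt_succ_of_le (h.row_le j hj.le hj.ne hpj), h.tight j hj hj.ne hpj⟩
  inj j hj j' hj' hpj he := h.inj j hj.le j' hj'.le hj.ne hj'.ne hpj he
  surj i hi := by
    obtain ⟨j, hj, hjn, hij⟩ := h.surj i (by omega)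
    exact ⟨j, by omega, hij⟩

/-- The first `n` rows and columns of `A` have a perfect matching along finite entries. -/
def HasPerfectMatching (A : ℕ → ℕ → TropNum) (n : ℕ) : Prop :=
  ∃ σ : ℕ → ℕ, (∀ i < n, σ i < n ∧ A i (σ i) ≠ ⊥) ∧ ∀ i < n, ∀ k < n, σ i = σ k → i = k

/-- If an unmatched column cannot be reached, there is no perfect matching. -/
lemma Tree.not_hasPerfectMatching (h : Tree A n p U V used way D last t True) (hl : p last ≤ n)
    (hbot : ∀ j < n, used j = 0 → D j = ⊥) (hp : PartialMatching A n r p U V) (hr : p n = r)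
    (hrn : r < n) : ¬ HasPerfectMatching A n := by
  rintro ⟨σ, hσ, hσ'⟩
  have hpn : ∀ k ≤ n, used k ≠ 0 → p k < n := by
    intro k hk hk'
    have h1 : p k ≤ n := by
      by_cases hkl : k = last
      · rwa [hkl]
      · exact h.matched k hk hk' hkl
    rcases hk.lt_or_eq with h2 | rfl
    · have := (hp.tight k h2 h1).1
      omega
    · omega
  -- Hall's condition fails: k ↦ σ (p k) would inject the tree columns, root included, into the real
  -- tree columns, as a finite entry in a tree row makes its column reachable.
  have h1 : ((Finset.range (n + 1)).filter fun j => used j ≠ 0).card ≤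
      ((Finset.range n).filter fun j => used j ≠ 0).card := by
    refine Finset.card_le_card_of_injOn (fun k => σ (p k)) (fun k hk => ?_)
      fun k hk k' hk' he => ?_
    · simp only [Finset.coe_filter, Finset.mem_range, Set.mem_ofPred_eq, Nat.lt_succ_iff] at hk ⊢
      obtain ⟨h2, h3⟩ := hσ _ (hpn k hk.1 hk.2)
      refine ⟨h2, fun h4 => h3 ?_⟩
      have h5 := h.relaxed k hk.1 hk.2 (.inr trivial) _ h2
      rw [hbot _ h2 h4, WithBot.bot_add, le_bot_iff, WithBot.add_eq_bot] at h5
      exact h5.resolve_left (h.dist_ne k hk.1 hk.2)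
    · simp only [Finset.coe_filter, Finset.mem_range, Set.mem_ofPred_eq, Nat.lt_succ_iff] at hk hk'
      have h2 := hpn k hk.1 hk.2
      exact hp.inj_root hr hk.1 hk'.1 h2.le (hσ' _ h2 _ (hpn k' hk'.1 hk'.2) he)
  rw [Finset.range_add_one, Finset.filter_insert, if_pos (by simp [h.used_root]),
    Finset.card_insert_of_notMem (by simp)] at h1
  omega

end Augment

/-- The program updates the potentials. -/
theorem runs_update {s : Memory} {n r t : ℕ} {U V : ℕ → ℝ} (hn : s.nat 10 0 = n)
    (hpot : s.HasPotentials n U V) (hp : PartialMatching (s.trop 2) n r (s.nat 3) U V)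
    (hr : s.nat 3 n = r) (hrn : r ≤ n)
    (hT : Tree (s.trop 2) n (s.nat 3) U V (s.nat 4) (s.nat 5) (s.trop 5 0) (s.nat 11 0) t False)
    (hl : n < s.nat 3 (s.nat 11 0)) :
    Runs Prog.update s (100 * n + 200) fun s' => ∃ U' V', s'.HasPotentials n U' V' ∧
      TreePotential (s.trop 2) n r (s.nat 3) (s.nat 4) (s.nat 5) U' V' := by
  set δ := potentialStep (s.trop 5 0) (s.nat 11 0) with hδ
  set used := s.nat 4
  set p := s.nat 3
  -- There are n + 1 rounds because the artificial column carries row r, whose potential changes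
  -- too. Entry n of array 4 is overwritten as well, but no invariant mentions it.
  refine Runs.le (.seq_same (.setTrop fun hS => .for (n := n + 1) (B := 70) (fun k s' =>
    (∀ j < k, used j ≠ 0 → p j ≤ n → s'.trop 3 0 (p j) = (U (p j) + δ j : ℝ)) ∧
    (∀ i ≤ n, (∀ j < k, used j ≠ 0 → p j ≠ i) → s'.trop 3 0 i = (U i : ℝ)) ∧
    (∀ j < n, s'.trop 4 0 j = ((if j < k ∧ used j ≠ 0 then V j - δ j else V j : ℝ) : TropNum)) ∧
    s'.trop 6 0 0 = s.trop 5 0 (s.nat 11 0))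
    (by decide) (fun s' hS' => ?_) ?_ (fun k hk s' ⟨h1, h2, h3, h4⟩ hs' hS' => ?_)
    fun s' ⟨h1, h2, h3, h4⟩ _ _ => ?_)) ?_
  · simp [hS'.nat 10 (by decide), hn]
  · refine ⟨by simp, fun i hi _ => ?_, fun j hj => ?_, by simp⟩
    · simp [hpot.row i hi]
    · simp [hpot.col j hj]
  · have e3 : s'.nat 3 = p := by rw [hS'.nat 3 (by decide)]; simp [p]
    have e4 : s'.nat 4 = used := by rw [hS'.nat 4 (by decide)]; simp [used]
    have t5 : s'.trop 5 = s.trop 5 := by rw [hS'.trop 5 (by decide)]; simp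
    have e20 : s'.nat 20 0 = k := hs'
    -- Different columns carry different rows, so no row potential is changed twice.
    have hinj : ∀ j < k, used j ≠ 0 → p j ≤ n → p j ≠ p k := fun j hj _ hpj he =>
      hj.ne (hp.inj_root hr (by omega) (by omega) hpj he)
    refine Runs.le (.ite (fun hb => .seq (.setTrop (.seq (.setTrop (.setTrop fun _ => ?_)))))
      fun hb => .skip fun _ => ?_) (by decide)
    · have hb' : used k ≠ 0 := by simpa [e4, e20, Nat.pos_iff_ne_zero] using hb
      have hδk : s.trop 5 0 (s.nat 11 0) + (s.trop 5 0 k).map (fun r => -r) = (δ k : ℝ) := by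
        rw [hT.exists_dist hT.last_le hT.used_last, hT.exists_dist (Nat.lt_succ_iff.1 hk) hb']
        simp only [WithBot.map_coe, hδ, potentialStep]
        norm_cast
      refine ⟨fun j hj hj' hpj => ?_, fun i hi hij => ?_, fun j hj => ?_, by simpa using h4⟩
      · by_cases hjk : j = k
        · subst hjk
          have := h2 (p j) hpj fun j' hj' hj0 he => hinj j' hj' hj0 (he ▸ hpj) he
          simp [e3, e20, t5, h4, this, hδk]
        · have := hinj j (by omega) hj' hpj
          simpa [e3, e20, this] using h1 j (by omega) hj' hpj
      · have := hij k (by omega) hb'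
        simpa [e3, e20, this.symm] using h2 i hi fun j hj => hij j (by omega)
      · by_cases hjk : j = k
        · subst hjk
          have := h3 j hj
          rw [if_neg (by simp)] at this
          simp [e20, t5, h4, this, hδk, hb']
          norm_cast
        · have hlt : j < k + 1 ↔ j < k := by omega
          simpa [e20, hjk, hlt] using h3 j hj
    · have hb' : used k = 0 := by simpa [e4, e20, Nat.pos_iff_ne_zero] using hb
      have hlt : ∀ j, used j ≠ 0 → j < k + 1 → j < k := fun j hj hj' => by
        have : j ≠ k := by rintro rfl; exact hj hb'
        omega
      refine ⟨fun j hj hj' hpj => ?_, fun i hi hij => ?_, fun j hj => ?_, by simpa using h4⟩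
      · simpa using h1 j (hlt j hj' hj) hj' hpj
      · simpa using h2 i hi fun j hj => hij j (by omega)
      · have : (j ≤ k ∧ ¬used j = 0) ↔ (j < k ∧ ¬used j = 0) :=
          and_congr_left fun hj' => ⟨fun h => hlt j hj' (by omega), le_of_lt⟩
        simpa [this] using h3 j hj
  · have hrow : ∀ i ≤ n, s'.trop 3 0 i ≠ ⊥ := by
      intro i hi
      by_cases hex : ∃ j ≤ n, used j ≠ 0 ∧ p j = i
      · obtain ⟨j, hj, hj', rfl⟩ := hex
        rw [h1 j (by omega) hj' hi]
        exact WithBot.coe_ne_bot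
      · rw [h2 i hi fun j hj hj' he => hex ⟨j, by omega, hj', he⟩]
        exact WithBot.coe_ne_bot
    have hU : ∀ i ≤ n, s'.trop 3 0 i = ((s'.trop 3 0 i).unbotD 0 : ℝ) := fun i hi => by
      obtain ⟨a, ha⟩ := WithBot.ne_bot_iff_exists.1 (hrow i hi)
      simp [← ha]
    refine ⟨fun i => (s'.trop 3 0 i).unbotD 0, fun j => if used j ≠ 0 then V j - δ j else V j,
      ⟨hU, fun j hj => ?_⟩, hT.treePotential hl hp hr hrn (fun j hj hj' hpj => ?_)
        (fun i hi hij => ?_) fun j hj => rfl⟩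
    · rw [h3 j hj]
      simp [show j < n + 1 by omega]
    · simp only [h1 j (by omega) hj' hpj, WithBot.unbotD_coe, hδ]
    · simp only [h2 i hi fun j hj => hij j (by omega), WithBot.unbotD_coe]
  · simp only [NatExpr.cost, TropExpr.cost]
    omega

/-- The program augments the matching. -/
theorem runs_augmentPath {s : Memory} {n r : ℕ} {U V U' V' : ℕ → ℝ} {full : Prop}
    {D : ℕ → TropNum} (hn : s.nat 10 0 = n)
    (hT : Tree (s.trop 2) n (s.nat 3) U V (s.nat 4) (s.nat 5) D (s.nat 11 0) n full)
    (hpot : TreePotential (s.trop 2) n r (s.nat 3) (s.nat 4) (s.nat 5) U' V')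
    (hS : Shifting (s.trop 2) n r (s.nat 3) (s.nat 3) U' V' (s.nat 4) (s.nat 11 0)) :
    Runs Prog.augmentPath s (60 * n + 20) fun s' =>
      PartialMatching (s.trop 2) n (r + 1) (s'.nat 3) U' V' := by
  refine Runs.le (.for (n := n) (B := 40) (fun t s' =>
    Shifting (s.trop 2) n r (s.nat 3) (s'.nat 3) U' V' (s.nat 4) (s'.nat 11 0) ∧
      (s.nat 4 (s'.nat 11 0) + t ≤ n + 1 ∨ s'.nat 11 0 = n)) (by decide) (fun s' hS' => ?_) ?_
    (fun t ht s' ⟨h1, h2⟩ hs' hS' => ?_) fun s' ⟨h1, h2⟩ _ _ => ?_) ?_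
  · simp [hS'.nat 10 (by decide), hn]
  · exact ⟨by simpa using hS, .inl (by simpa using hT.used_le _ hT.last_le)⟩
  · have e5 := hS'.nat 5 (by decide)
    have e10 := hS'.nat 10 (by decide)
    refine Runs.le (.ite (fun hb => .seq (.setNat (.seq (.setNat (.setNat fun _ => ?_)))))
      fun hb => .skip fun _ => ?_) (by decide)
    · have hb' : s'.nat 11 0 < n := by simpa [e10, hn] using hb
      obtain ⟨h3, h4⟩ := h1.step hb' hT hpot
      refine ⟨by simpa [e5] using h3, .inl ?_⟩
      have := h2.resolve_right hb'.ne
      simp [e5]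
      omega
    · have hb' : n ≤ s'.nat 11 0 := by simpa [e10, hn] using hb
      exact ⟨by simpa using h1, .inr (by simpa using le_antisymm h1.le hb')⟩
  · have h3 : s'.nat 11 0 = n := by
      by_contra hne
      have := hT.two_le _ (h1.le.lt_of_ne hne) h1.used_ne
      omega
    rw [h3] at h1
    exact h1.partialMatching hpot
  · simp only [NatExpr.cost]
    omega

/-- The state of the construction of a matching after `r` rows. -/
def Memory.Matched (s : Memory) (A : ℕ → ℕ → TropNum) (n r : ℕ) : Prop :=
  (s.nat 13 0 = 0 ∧ ∃ U V, s.HasPotentials n U V ∧ PartialMatching A n r (s.nat 3) U V) ∨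
    (s.nat 13 0 ≠ 0 ∧ ¬ HasPerfectMatching A n)

lemma Memory.Matched.congr {s s' : Memory} {A : ℕ → ℕ → TropNum} {n r : ℕ}
    (h : s.Matched A n r) (h13 : s'.nat 13 = s.nat 13) (h3 : s'.nat 3 = s.nat 3)
    (t3 : s'.trop 3 = s.trop 3) (t4 : s'.trop 4 = s.trop 4) : s'.Matched A n r := by
  rw [Memory.Matched, h13, h3]
  refine h.imp_left fun ⟨h0, U, V, hpot, hp⟩ => ⟨h0, U, V, ⟨?_, ?_⟩, hp⟩
  · rw [t3]; exact hpot.row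
  · rw [t4]; exact hpot.col

/-- After a successful search, the program extends the matching. -/
theorem runs_extend {s : Memory} {n r : ℕ} {U V : ℕ → ℝ} (hn : s.nat 10 0 = n)
    (hpot : s.HasPotentials n U V) (hp : PartialMatching (s.trop 2) n r (s.nat 3) U V)
    (hr : s.nat 3 n = r) (hrn : r ≤ n)
    (hT : Tree (s.trop 2) n (s.nat 3) U V (s.nat 4) (s.nat 5) (s.trop 5 0) (s.nat 11 0) n False)
    (hl : n < s.nat 3 (s.nat 11 0)) :
    Runs (.seq Prog.update Prog.augmentPath) s (160 * n + 220) fun s' =>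
      ∃ U V, s'.HasPotentials n U V ∧ PartialMatching (s.trop 2) n (r + 1) (s'.nat 3) U V := by
  refine Runs.le (.seq ((runs_update hn hpot hp hr hrn hT hl).mono le_rfl
    fun s₁ ⟨U', V', h1, h2⟩ hS => ?_)) (B := 100 * n + 200 + (60 * n + 20)) (by omega)
  have t2 := hS.trop 2 (by decide)
  have e3 := hS.nat 3 (by decide)
  have e4 := hS.nat 4 (by decide)
  have e5 := hS.nat 5 (by decide)
  have e10 := hS.nat 10 (by decide)
  have e11 := hS.nat 11 (by decide)
  have hSh := hT.shifting hl hp hr hrn h2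
  refine (runs_augmentPath (s := s₁) (U := U) (V := V) (D := s.trop 5 0) (full := False)
    (r := r) (U' := U') (V' := V') (by rw [e10, hn]) ?_ ?_ ?_).mono le_rfl fun s₂ h3 hS' => ?_
  · rwa [t2, e3, e4, e5, e11]
  · rwa [t2, e3, e4, e5]
  · rwa [t2, e3, e4, e11]
  · rw [t2] at h3
    refine ⟨U', V', ⟨?_, ?_⟩, h3⟩
    · rw [hS'.trop 3 (by decide)]; exact h1.row
    · rw [hS'.trop 4 (by decide)]; exact h1.col

theorem runs_insertRow {s : Memory} {n r : ℕ} (hn : s.nat 10 0 = n) (hr : s.nat 22 0 = r)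
    (hrn : r < n) (h : s.Matched (s.trop 2) n r) :
    Runs Prog.insertRow s (1000 * (n + 1) ^ 2) fun s' => s'.Matched (s.trop 2) n (r + 1) := by
  by_cases h0 : s.nat 13 0 = 0
  · obtain ⟨-, U, V, hpot, hp⟩ := h.resolve_right fun h => h.1 h0
    refine Runs.le (.ite_pos (by simp [h0]) (.seq ((runs_search hn (by omega) hr hrn.le hpot
      hp).mono le_rfl fun s₁ ⟨h1, h2⟩ hS => .ite (B' := 160 * n + 220) (fun hb => .setNat ?_)
      fun hb => ?_))) ?_
    · have e10 := hS.nat 10 (by decide)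
      have hb' : s₁.nat 3 (s₁.nat 11 0) ≤ n := by simpa [e10, hn] using hb
      rcases h2 with ⟨-, h2⟩ | ⟨h2, -, h3⟩
      · omega
      · refine .inr ⟨by simp, h2.not_hasPerfectMatching hb' h3 (hp.congr fun j hj => ?_) ?_ hrn⟩
        · rw [h1, update_of_ne hj.ne]
        · rw [h1, update_self]
    · have e10 := hS.nat 10 (by decide)
      have t2 := hS.trop 2 (by decide)
      have t3 := hS.trop 3 (by decide)
      have t4 := hS.trop 4 (by decide)
      have hb' : n < s₁.nat 3 (s₁.nat 11 0) := by simpa [e10, hn] using hb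
      rcases h2 with ⟨h2, -⟩ | ⟨-, h2, -⟩
      · refine (runs_extend (s := s₁) (r := r) (U := U) (V := V) (by rw [e10, hn]) ⟨?_, ?_⟩ ?_ ?_
          hrn.le (by rwa [t2]) hb').mono le_rfl fun s₂ h3 hS' => ?_
        · rw [t3]; exact hpot.row
        · rw [t4]; exact hpot.col
        · rw [t2]
          exact hp.congr fun j hj => by rw [h1, update_of_ne hj.ne]
        · rw [h1, update_self]
        · rw [t2] at h3
          refine .inl ⟨?_, h3⟩
          rw [hS'.nat 13 (by decide), hS.nat 13 (by decide), h0]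
      · omega
    · simp only [Test.cost, NatExpr.cost]
      rw [max_eq_right (by omega)]
      nlinarith
  · refine Runs.le (.ite_neg (by simpa using h0) (.skip ?_)) ?_
    · exact .inr (h.resolve_left fun h => h0 h.1)
    · simp only [Test.cost, NatExpr.cost]
      nlinarith

lemma runs_init {s : Memory} {n : ℕ} (hn : s.nat 10 0 = n) :
    Runs Prog.init s (50 * n + 50) fun s' => s'.Matched (s.trop 2) n 0 := by
  refine Runs.le (.seq_same (.for (n := n) (B := 30) (fun k s' => ∀ j < k, s'.nat 3 j = n + 1 ∧
    s'.trop 3 0 j = 0 ∧ s'.trop 4 0 j = 0) (by decide) (fun s' hS => ?_) (by simp)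
    (fun k hk s' hI hs' hS => .le (.seq (.setNat (.seq (.setTrop (.setTrop fun hS' => ?_)))))
      (by decide)) fun s' hI _ hS _ => .seq (.setTrop (.setNat ?_)))) ?_
  · simp [hS.nat 10 (by decide), hn]
  · have e10 := hS.nat 10 (by decide)
    intro j hj
    by_cases hjk : j = k
    · simp [hjk, hs', e10, hn]
    · simpa [hjk, hs'] using hI j (by omega)
  · have e10 := hS.nat 10 (by decide)
    -- Zero potentials may be infeasible for A, but only inserted rows have to satisfy the
    -- inequalities. The entry n + 1 marks a column as free.
    refine .inl ⟨by simp, 0, 0, ⟨fun i hi => ?_, fun j hj => ?_⟩, ?_⟩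
    · rcases hi.lt_or_eq with h | h
      · simpa [e10, hn, h.ne] using (hI i h).2.1
      · simp [e10, hn, h]
    · simpa using (hI j hj).2.2
    · refine ⟨by simp, fun j hj hpj => ?_, fun j hj j' hj' hpj => ?_, by simp⟩
      · simp [(hI j hj).1] at hpj
      · simp [(hI j hj).1] at hpj
  · simp only [NatExpr.cost, TropExpr.cost]
    omega

/-- The program finds an optimal matching or detects that there is no perfect matching. -/
theorem runs_hungarian {s : Memory} {n : ℕ} (hn : s.nat 10 0 = n) :
    Runs Prog.hungarian s (1100 * (n + 1) ^ 3) fun s' =>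
      s'.Matched (s.trop 2) n n ∧ s'.nat 22 0 = n := by
  refine Runs.le (.seq ((runs_init hn).mono le_rfl fun s₁ h hS => .for (n := n)
    (B := 1000 * (n + 1) ^ 2) (fun r s' => s'.Matched (s.trop 2) n r) (by decide)
    (fun s' hS' => ?_) ?_ (fun r hr s' hI hs' hS' => ?_) fun s' hI h _ => ⟨hI, h⟩)) ?_
  · simp [hS'.nat 10 (by decide), hS.nat 10 (by decide), hn]
  · exact h.congr (by simp) (by simp) (by simp) (by simp)
  · have t2 : s'.trop 2 = s.trop 2 := (hS'.trop 2 (by decide)).trans (hS.trop 2 (by decide))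
    have e10 : s'.nat 10 = s.nat 10 := (hS'.nat 10 (by decide)).trans (hS.nat 10 (by decide))
    refine (runs_insertRow (by rw [e10, hn]) hs' hr (by rwa [t2])).mono le_rfl fun s'' h hS'' _ => ?_
    rw [t2] at h
    exact h.congr (by simp) (by simp) (by simp) (by simp)
  · simp only [NatExpr.cost]
    nlinarith

end TropVol

namespace TropVol
open Function

/-! ### Peeling off columns -/

/-- The tight edges between matched columns, directed towards the unmatched ends. -/
def TightEdge (A : ℕ → ℕ → TropNum) (p : ℕ → ℕ) (U V : ℕ → ℝ) (k j : ℕ) : Prop :=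
  k ≠ j ∧ ¬ A (p k) j < (U (p k) + V j : ℝ)

section Peel
variable {A : ℕ → ℕ → TropNum} {n : ℕ} {p : ℕ → ℕ} {U V : ℕ → ℝ} {alive alive' : ℕ → ℕ}

/-- The columns that were peeled off can be ranked along the tight edges. -/
def Ranked (n : ℕ) (E : ℕ → ℕ → Prop) (alive : ℕ → ℕ) : Prop :=
  ∃ f : ℕ → ℕ, ∀ j < n, alive j = 0 → ∀ k < n, E k j → alive k = 0 ∧ f k < f j

/-- All predecessors of the column were peeled off before, so it can be ranked above everything
else. -/
lemma Ranked.update {E : ℕ → ℕ → Prop} (h : Ranked n E alive) (hE : ∀ j, ¬ E j j) {j : ℕ}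
    (hj : ∀ k < n, E k j → alive k = 0) : Ranked n E (update alive j 0) := by
  by_cases h0 : alive j = 0
  · rwa [← h0, update_eq_self]
  obtain ⟨f, hf⟩ := h
  refine ⟨Function.update f j (1 + (Finset.range n).sup f), fun i hi hi' k hk hki => ?_⟩
  by_cases hij : i = j
  · subst hij
    have hki' : k ≠ i := by rintro rfl; exact hE _ hki
    rw [update_of_ne hki', update_of_ne hki', update_self]
    have := Finset.le_sup (f := f) (Finset.mem_range.2 hk)
    exact ⟨hj k hk hki, by omega⟩
  · rw [update_of_ne hij] at hi' ⊢
    obtain ⟨h1, h2⟩ := hf i hi hi' k hk hki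
    have hkj : k ≠ j := by rintro rfl; exact h0 h1
    rw [update_of_ne hkj, update_of_ne hkj]
    exact ⟨h1, h2⟩

end Peel

theorem runs_peelColumn {s : Memory} {n j : ℕ} {U V : ℕ → ℝ} (hn : s.nat 10 0 = n)
    (hj : s.nat 20 0 = j) (hjn : j < n) (hpot : s.HasPotentials n U V)
    (hp : ∀ k < n, s.nat 3 k < n) :
    Runs Prog.peelColumn s (60 * n + 40) fun s' =>
      ((∃ k < n, s.nat 6 k ≠ 0 ∧ TightEdge (s.trop 2) (s.nat 3) U V k j) ∧ s'.nat 6 = s.nat 6) ∨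
      ((∀ k < n, TightEdge (s.trop 2) (s.nat 3) U V k j → s.nat 6 k = 0) ∧
        s'.nat 6 = update (s.nat 6) j 0) := by
  refine Runs.le (.seq (.setNat (.seq_same (.for (n := n) (B := 45) (fun k s' =>
    s'.nat 15 0 = 0 ↔ ∃ i < k, s.nat 6 i ≠ 0 ∧ TightEdge (s.trop 2) (s.nat 3) U V i j) (by decide)
    (fun s' hS => ?_) ?_ (fun k hk s' hI hs' hS => ?_) fun s' hI _ hS _ =>
    .ite (fun hb => .setNat ?_) fun hb => .skip ?_)))) ?_
  · simp [hS.nat 10 (by decide), hn]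
  · simp
  · have e3 := hS.nat 3 (by decide)
    have e6 := hS.nat 6 (by decide)
    have e20 := hS.nat 20 (by decide)
    have t2 := hS.trop 2 (by decide)
    have t3 := hS.trop 3 (by decide)
    have t4 := hS.trop 4 (by decide)
    simp at e3 e6 e20 t2 t3 t4
    have hev : Test.eval s' (.and (.natLt (.const 0) (.read 6 (.var 24)))
      (.and (Prog.natNe (.var 24) (.var 20)) (.not (.tropLt (.read 2 (.read 3 (.var 24)) (.var 20))
        (.mul (Prog.vec 3 (.read 3 (.var 24))) (Prog.vec 4 (.var 20))))))) ↔
        s.nat 6 k ≠ 0 ∧ TightEdge (s.trop 2) (s.nat 3) U V k j := by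
      simp only [Test.eval, NatExpr.eval, TropExpr.eval, e3, e6, e20, t2, t3, t4, hs', hj,
        hpot.row _ (hp k hk).le, hpot.col j hjn, TightEdge, WithBot.coe_add]
      refine and_congr Nat.pos_iff_ne_zero (and_congr ?_ Iff.rfl)
      omega
    have hsucc : (∃ i < k + 1, s.nat 6 i ≠ 0 ∧ TightEdge (s.trop 2) (s.nat 3) U V i j) ↔
        (∃ i < k, s.nat 6 i ≠ 0 ∧ TightEdge (s.trop 2) (s.nat 3) U V i j) ∨
        (s.nat 6 k ≠ 0 ∧ TightEdge (s.trop 2) (s.nat 3) U V k j) := by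
      constructor
      · rintro ⟨i, hi, h⟩
        rcases Nat.lt_succ_iff_lt_or_eq.1 hi with h' | rfl
        · exact .inl ⟨i, h', h⟩
        · exact .inr h
      · rintro (⟨i, hi, h⟩ | h)
        · exact ⟨i, by omega, h⟩
        · exact ⟨k, by omega, h⟩
    refine Runs.le (.ite (fun hb => .setNat fun _ => ?_) fun hb => .skip fun _ => ?_) (by decide)
    · rw [hsucc]
      simpa using Or.inr (hev.1 hb)
    · rw [hsucc, or_iff_left (fun h => hb (hev.2 h))]
      simpa using hI
  · have e6 := hS.nat 6 (by decide)
    have e20 := hS.nat 20 (by decide)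
    simp at e6 e20
    have hb' : s'.nat 15 0 ≠ 0 := by simpa [Nat.pos_iff_ne_zero] using hb
    rw [Ne, hI] at hb'
    push Not at hb'
    refine .inr ⟨fun k hk hE => by_contra fun h => hb' k hk h hE, ?_⟩
    simp [e6, e20, hj]
  · have e6 := hS.nat 6 (by decide)
    simp at e6
    have hb' : s'.nat 15 0 = 0 := by simpa [Nat.pos_iff_ne_zero] using hb
    exact .inl ⟨hI.1 hb', e6⟩
  · simp only [NatExpr.cost, Test.cost]
    omega

/-- One round of peeling. -/
theorem runs_peelRound {s : Memory} {n : ℕ} {U V : ℕ → ℝ} (hn : s.nat 10 0 = n)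
    (hpot : s.HasPotentials n U V) (hp : ∀ k < n, s.nat 3 k < n)
    (h : Ranked n (TightEdge (s.trop 2) (s.nat 3) U V) (s.nat 6)) :
    Runs (.for 20 (.var 10) Prog.peelColumn) s (100 * (n + 1) ^ 2) fun s' =>
      Ranked n (TightEdge (s.trop 2) (s.nat 3) U V) (s'.nat 6) ∧
      (∀ j, s.nat 6 j = 0 → s'.nat 6 j = 0) ∧
      ∀ j < n, (∀ k < n, TightEdge (s.trop 2) (s.nat 3) U V k j → s.nat 6 k = 0) →
        s'.nat 6 j = 0 := by
  refine Runs.le (.for (n := n) (B := 60 * n + 40) (fun i s' =>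
      Ranked n (TightEdge (s.trop 2) (s.nat 3) U V) (s'.nat 6) ∧
      (∀ j, s.nat 6 j = 0 → s'.nat 6 j = 0) ∧
      ∀ j < i, (∀ k < n, TightEdge (s.trop 2) (s.nat 3) U V k j → s.nat 6 k = 0) →
        s'.nat 6 j = 0) (by decide)
    (fun s' hS => ?_) ?_ (fun i hi s' ⟨h1, h2, h3⟩ hs' hS => ?_) fun s' h _ _ => h) ?_
  · simp [hS.nat 10 (by decide), hn]
  · simpa using h
  · have e3 := hS.nat 3 (by decide)
    have e10 := hS.nat 10 (by decide)
    have t2 := hS.trop 2 (by decide)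
    have t3 := hS.trop 3 (by decide)
    have t4 := hS.trop 4 (by decide)
    refine (runs_peelColumn (by rw [e10, hn]) hs' hi (U := U) (V := V)
      ⟨by rw [t3]; exact hpot.row, by rw [t4]; exact hpot.col⟩ (by rwa [e3])).mono le_rfl
      fun s'' h hS' _ => ?_
    rw [t2, e3] at h
    rw [Memory.storeNat_nat_of_ne _ _ _ (by decide)]
    rcases h with ⟨⟨k, hk, hk', hE⟩, h5⟩ | ⟨h4, h5⟩
    · rw [h5]
      refine ⟨h1, h2, fun j hj hj' => ?_⟩
      rcases Nat.lt_succ_iff_lt_or_eq.1 hj with h | rfl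
      · exact h3 j h hj'
      · exact absurd (h2 k (hj' k hk hE)) hk'
    · rw [h5]
      refine ⟨h1.update (fun j h => h.1 rfl) h4, fun j hj => ?_, fun j hj hj' => ?_⟩
      · by_cases hji : j = i
        · simp [hji]
        · rw [update_of_ne hji]; exact h2 j hj
      · by_cases hji : j = i
        · simp [hji]
        · rw [update_of_ne hji]; exact h3 j (by omega) hj'
  · simp only [NatExpr.cost]
    nlinarith

/-- The program decides whether the tight edges are acyclic. -/
theorem runs_peel {s : Memory} {n : ℕ} {U V : ℕ → ℝ} (hn : s.nat 10 0 = n)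
    (hpot : s.HasPotentials n U V) (hp : ∀ k < n, s.nat 3 k < n) :
    Runs Prog.peel s (200 * (n + 1) ^ 3) fun s' =>
      (s'.nat 15 0 ≠ 0 → ∃ f : ℕ → ℕ, ∀ j < n, ∀ k < n,
        TightEdge (s.trop 2) (s.nat 3) U V k j → f k < f j) ∧
      ∀ f : ℕ → ℝ, (∀ j < n, ∀ k < n, TightEdge (s.trop 2) (s.nat 3) U V k j → f k < f j) →
        s'.nat 15 0 ≠ 0 := by
  set E := TightEdge (s.trop 2) (s.nat 3) U V with hE
  have h1 : Runs (.for 20 (.var 10) (.setNat 6 (.var 20) (.const 1))) s (20 * n + 20) fun s' =>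
      ∀ j < n, s'.nat 6 j = 1 := by
    refine Runs.le (.for (n := n) (B := 4) (fun k s' => ∀ j < k, s'.nat 6 j = 1) (by decide)
      (fun s' hS => ?_) (by simp) (fun k hk s' hI hs' hS => .le (.setNat fun _ j hj => ?_)
        (by decide)) fun s' h _ _ => h) ?_
    · simp [hS.nat 10 (by decide), hn]
    · by_cases hjk : j = k
      · simp [hjk, hs']
      · simpa [hjk, hs'] using hI j (by omega)
    · simp only [NatExpr.cost]
      omega
  have h2 : ∀ s₁ : Memory, (∀ j < n, s₁.nat 6 j = 1) → s₁.nat 10 = s.nat 10 →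
      s₁.nat 3 = s.nat 3 → s₁.trop 2 = s.trop 2 → s₁.trop 3 = s.trop 3 → s₁.trop 4 = s.trop 4 →
      Runs (.for 23 (.var 10) (.for 20 (.var 10) Prog.peelColumn)) s₁
        (120 * (n + 1) ^ 3) fun s' => Ranked n E (s'.nat 6) ∧
          ∀ f : ℕ → ℝ, (∀ j < n, ∀ k < n, E k j → f k < f j) → ∀ j < n, s'.nat 6 j = 0 := by
    intro s₁ halive e10 e3 t2 t3 t4
    refine Runs.le (.for (n := n) (B := 100 * (n + 1) ^ 2) (fun t s' => Ranked n E (s'.nat 6) ∧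
      ∀ f : ℕ → ℝ, (∀ j < n, ∀ k < n, E k j → f k < f j) →
        ((Finset.range n).filter fun j => s'.nat 6 j ≠ 0).card + t ≤ n) (by decide)
      (fun s' hS => ?_) ?_ (fun t ht s' ⟨hI, hI'⟩ hs' hS => ?_) fun s' ⟨hI, hI'⟩ _ _ => ⟨hI, ?_⟩) ?_
    · simp [hS.nat 10 (by decide), e10, hn]
    · refine ⟨⟨0, fun j hj hj' => ?_⟩, fun f hf => ?_⟩
      · simp [halive j hj] at hj'
      · exact (Finset.card_filter_le _ _).trans_eq (Finset.card_range n)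
    · have e3' : s'.nat 3 = s.nat 3 := (hS.nat 3 (by decide)).trans e3
      have e10' : s'.nat 10 = s.nat 10 := (hS.nat 10 (by decide)).trans e10
      have t2' : s'.trop 2 = s.trop 2 := (hS.trop 2 (by decide)).trans t2
      have t3' : s'.trop 3 = s.trop 3 := (hS.trop 3 (by decide)).trans t3
      have t4' : s'.trop 4 = s.trop 4 := (hS.trop 4 (by decide)).trans t4
      refine (runs_peelRound (by rw [e10', hn]) (U := U) (V := V)
        ⟨by rw [t3']; exact hpot.row, by rw [t4']; exact hpot.col⟩ (by rwa [e3'])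
        (by rwa [t2', e3'])).mono le_rfl fun s'' ⟨h4, h5, h6⟩ hS' _ => ?_
      rw [t2', e3', ← hE] at h4 h6
      rw [Memory.storeNat_nat_of_ne _ _ _ (by decide)]
      refine ⟨h4, fun f hf => ?_⟩
      have h7 := hI' f hf
      have hsub : (Finset.range n).filter (fun j => s''.nat 6 j ≠ 0) ⊆
          (Finset.range n).filter fun j => s'.nat 6 j ≠ 0 := fun j hj => by
        simp only [Finset.mem_filter] at hj ⊢
        exact ⟨hj.1, fun h => hj.2 (h5 j h)⟩
      rcases ((Finset.range n).filter fun j => s'.nat 6 j ≠ 0).eq_empty_or_nonempty with h | h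
      · rw [h, Finset.subset_empty] at hsub
        rw [hsub, Finset.card_empty]
        omega
      -- A remaining column with minimal f has no remaining predecessor, so every round peels off at
      -- least one column.
      · obtain ⟨j, hj, hmin⟩ := Finset.exists_min_image _ f h
        simp only [Finset.mem_filter, Finset.mem_range] at hj hmin
        have h8 : s''.nat 6 j = 0 := h6 j hj.1 fun k hk hkj => by_contra fun hk' =>
          (hmin k ⟨hk, hk'⟩).not_gt (hf j hj.1 k hk hkj)
        have h9 := Finset.card_lt_card (Finset.ssubset_iff_of_subset hsub |>.2
          ⟨j, by simpa using hj, by simp [h8]⟩)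
        omega
    · intro f hf j hj
      have h7 := hI' f hf
      have h8 : (Finset.range n).filter (fun j => s'.nat 6 j ≠ 0) = ∅ :=
        Finset.card_eq_zero.1 (by omega)
      by_contra h9
      have : j ∈ (Finset.range n).filter (fun j => s'.nat 6 j ≠ 0) := by simp [hj, h9]
      simp [h8] at this
    · simp only [NatExpr.cost]
      nlinarith
  have h3 : ∀ s₂ : Memory, s₂.nat 10 = s.nat 10 → Runs (.for 20 (.var 10)
      (.ite (.natLt (.const 0) (.read 6 (.var 20))) (Prog.letNat 15 (.const 0)) .skip)) s₂
      (30 * n + 20) fun s' => s'.nat 15 0 = 0 ↔ s₂.nat 15 0 = 0 ∨ ∃ j < n, s₂.nat 6 j ≠ 0 := by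
    intro s₂ e10
    refine Runs.le (.for (n := n) (B := 15) (fun k s' => s'.nat 15 0 = 0 ↔ s₂.nat 15 0 = 0 ∨
      ∃ j < k, s₂.nat 6 j ≠ 0) (by decide) (fun s' hS => ?_) (by simp)
      (fun k hk s' hI hs' hS => .le (.ite (fun hb => .setNat fun _ => ?_)
        fun hb => .skip fun _ => ?_) (by decide)) fun s' h _ _ => h) ?_
    · simp [hS.nat 10 (by decide), e10, hn]
    · have e6 := hS.nat 6 (by decide)
      have hb' : s₂.nat 6 k ≠ 0 := by simpa [e6, hs', Nat.pos_iff_ne_zero] using hb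
      simp
      exact .inr ⟨k, le_rfl, hb'⟩
    · have e6 := hS.nat 6 (by decide)
      have hb' : s₂.nat 6 k = 0 := by simpa [e6, hs', Nat.pos_iff_ne_zero] using hb
      rw [Memory.storeNat_nat_of_ne _ _ _ (by decide), hI]
      refine or_congr_right ⟨fun ⟨j, hj, hj'⟩ => ⟨j, by omega, hj'⟩, fun ⟨j, hj, hj'⟩ =>
        ⟨j, (Nat.lt_succ_iff.1 hj).lt_of_ne ?_, hj'⟩⟩
      rintro rfl
      exact hj' hb'
    · simp only [NatExpr.cost]
      omega
  refine Runs.le (.seq (h1.mono le_rfl fun s₁ h4 hS => .seq ((h2 s₁ h4 (hS.nat _ (by decide))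
    (hS.nat _ (by decide)) (hS.trop _ (by decide)) (hS.trop _ (by decide))
    (hS.trop _ (by decide))).mono le_rfl fun s₂ ⟨h5, h6⟩ hS' => .seq (.setNat ((h3 _ ?_).mono le_rfl
      fun s₃ h7 _ => ?_))))) ?_
  · simp [hS'.nat 10 (by decide), hS.nat 10 (by decide)]
  · have h8 : s₃.nat 15 0 = 0 ↔ ∃ j < n, s₂.nat 6 j ≠ 0 := by simpa using h7
    rw [Ne, h8]
    push Not
    refine ⟨fun h => ?_, fun f hf => h6 f hf⟩
    obtain ⟨f, hf⟩ := h5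
    exact ⟨f, fun j hj k hk hkj => (hf j hj (h j hj) k hk hkj).2⟩
  · simp only [NatExpr.cost]
    have : n + 1 ≤ (n + 1) ^ 3 := Nat.le_self_pow (by decide) _
    omega

end TropVol

namespace TropVol
open Filter Topology

/-! ### Potentials of the assignment problem -/

/-- Potentials `u`, `v` that are feasible for the matrix `A` and tight on the permutation `π`. -/
structure IsPotential {n : ℕ} (A : Matrix (Fin n) (Fin n) TropNum) (π : Equiv.Perm (Fin n))
    (u v : Fin n → ℝ) : Prop where
  le : ∀ i j, A i j ≤ (u i + v j : ℝ)
  eq : ∀ i, A i (π i) = (u i + v (π i) : ℝ)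

/-- Potentials that are tight only on the permutation `π`. -/
structure IsStrictPotential {n : ℕ} (A : Matrix (Fin n) (Fin n) TropNum)
    (π : Equiv.Perm (Fin n)) (u v : Fin n → ℝ) : Prop where
  lt : ∀ i j, j ≠ π i → A i j < (u i + v j : ℝ)
  eq : ∀ i, A i (π i) = (u i + v (π i) : ℝ)

lemma IsStrictPotential.isPotential {n : ℕ} {A : Matrix (Fin n) (Fin n) TropNum}
    {π : Equiv.Perm (Fin n)} {u v : Fin n → ℝ} (h : IsStrictPotential A π u v) :
    IsPotential A π u v where
  le i j := by
    by_cases hj : j = π i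
    · rw [hj, h.eq]
    · exact (h.lt i j hj).le
  eq := h.eq

lemma coe_sum_tropNum {ι : Type*} (s : Finset ι) (f : ι → ℝ) :
    ((∑ i ∈ s, f i : ℝ) : TropNum) = ∑ i ∈ s, (f i : TropNum) :=
  map_sum (WithBot.addHom : ℝ →+ WithBot ℝ) f s

/-- Weak duality of the assignment problem. -/
lemma permWeight_le {n : ℕ} {A : Matrix (Fin n) (Fin n) TropNum} {u v : Fin n → ℝ}
    (h : ∀ i j, A i j ≤ (u i + v j : ℝ)) (τ : Equiv.Perm (Fin n)) :
    permWeight A τ ≤ (∑ i, u i + ∑ j, v j : ℝ) := by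
  rw [← Equiv.sum_comp τ v, ← Finset.sum_add_distrib, coe_sum_tropNum]
  exact Finset.sum_le_sum fun i _ => h i (τ i)

lemma IsPotential.permWeight_eq {n : ℕ} {A : Matrix (Fin n) (Fin n) TropNum}
    {π : Equiv.Perm (Fin n)} {u v : Fin n → ℝ} (h : IsPotential A π u v) :
    permWeight A π = (∑ i, u i + ∑ j, v j : ℝ) := by
  rw [← Equiv.sum_comp π v, ← Finset.sum_add_distrib, coe_sum_tropNum]
  exact Finset.sum_congr rfl fun i _ => h.eq i

lemma tropNum_sum_lt_sum {ι : Type*} [Fintype ι] {f : ι → TropNum} {g : ι → ℝ}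
    (h : ∀ i, f i ≤ g i) {k : ι} (hk : f k < g k) : ∑ i, f i < (∑ i, g i : ℝ) := by
  by_cases hf : ∃ i, f i = ⊥
  · obtain ⟨i, hi⟩ := hf
    rw [WithBot.sum_eq_bot_iff.2 ⟨i, Finset.mem_univ i, hi⟩]
    exact WithBot.bot_lt_coe _
  · push Not at hf
    lift f to ι → ℝ using hf
    rw [← coe_sum_tropNum]
    norm_cast at *
    exact Finset.sum_lt_sum (fun i _ => WithBot.coe_le_coe.1 (h i))
      ⟨k, Finset.mem_univ k, WithBot.coe_lt_coe.1 hk⟩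

lemma IsStrictPotential.permWeight_lt {n : ℕ} {A : Matrix (Fin n) (Fin n) TropNum}
    {π τ : Equiv.Perm (Fin n)} {u v : Fin n → ℝ} (h : IsStrictPotential A π u v) (hτ : τ ≠ π) :
    permWeight A τ < permWeight A π := by
  rw [h.isPotential.permWeight_eq, ← Equiv.sum_comp τ v, ← Finset.sum_add_distrib]
  obtain ⟨k, hk⟩ : ∃ k, τ k ≠ π k := by
    by_contra! h'
    exact hτ (Equiv.ext h')
  exact tropNum_sum_lt_sum (fun i => h.isPotential.le i (τ i)) (h.lt k (τ k) hk)

lemma permWeight_le_tdet {n : ℕ} (A : Matrix (Fin n) (Fin n) TropNum) (τ : Equiv.Perm (Fin n)) :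
    permWeight A τ ≤ tdet A := Finset.le_sup (f := permWeight A) (Finset.mem_univ τ)

lemma exists_permWeight_eq_tdet {n : ℕ} (A : Matrix (Fin n) (Fin n) TropNum) :
    ∃ π, permWeight A π = tdet A := by
  obtain ⟨π, -, h⟩ := Finset.exists_mem_eq_sup Finset.univ ⟨1, Finset.mem_univ _⟩ (permWeight A)
  exact ⟨π, h.symm⟩

lemma IsPotential.permWeight_eq_tdet {n : ℕ} {A : Matrix (Fin n) (Fin n) TropNum}
    {π : Equiv.Perm (Fin n)} {u v : Fin n → ℝ} (h : IsPotential A π u v) :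
    permWeight A π = tdet A := by
  refine (permWeight_le_tdet A π).antisymm (Finset.sup_le fun τ _ => ?_)
  rw [h.permWeight_eq]
  exact permWeight_le h.le τ

lemma IsStrictPotential.nonsingular {n : ℕ} {A : Matrix (Fin n) (Fin n) TropNum}
    {π : Equiv.Perm (Fin n)} {u v : Fin n → ℝ} (h : IsStrictPotential A π u v) :
    Nonsingular A := by
  have key : ∀ τ, permWeight A τ = tdet A → τ = π := by
    intro τ hτ
    by_contra hne
    exact ((h.permWeight_lt hne).trans_le (permWeight_le_tdet A π)).ne hτ
  exact fun σ τ hσ hτ => (key σ hσ).trans (key τ hτ).symm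

/-- If the determinant were -∞, every permutation would attain it, and for n ≥ 2 there are at least
two. With n = d + 1 this is the assumption d ≥ 1. -/
lemma Nonsingular.tdet_ne_bot {n : ℕ} (hn : 2 ≤ n) {A : Matrix (Fin n) (Fin n) TropNum}
    (h : Nonsingular A) : tdet A ≠ ⊥ := by
  intro h0
  have h1 : ∀ τ, permWeight A τ = tdet A := fun τ =>
    (permWeight_le_tdet A τ).antisymm (h0 ▸ bot_le)
  have : Nontrivial (Fin n) := Fin.nontrivial_iff_two_le.2 hn
  obtain ⟨σ, τ, hne⟩ := exists_pair_ne (Equiv.Perm (Fin n))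
  exact hne (h σ τ (h1 σ) (h1 τ))

/-- A complete matching is a permutation. -/
lemma PartialMatching.exists_perm {B : ℕ → ℕ → TropNum} {n : ℕ} {p : ℕ → ℕ} {U V : ℕ → ℝ}
    (hp : PartialMatching B n n p U V) :
    ∃ π : Equiv.Perm (Fin n), ∀ i : Fin n, p (π i) = i := by
  choose q hq hq' using hp.surj
  have hinj : Function.Injective fun i : Fin n => (⟨q i i.2, hq i i.2⟩ : Fin n) := by
    intro i k hik
    have h1 : q i i.2 = q k k.2 := congrArg Fin.val hik
    have h2 := hq' i i.2
    rw [h1, hq' k k.2] at h2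
    exact Fin.ext h2.symm
  exact ⟨Equiv.ofBijective _ (Finite.injective_iff_bijective.1 hinj), fun i => hq' i i.2⟩

lemma PartialMatching.lt_of_lt {B : ℕ → ℕ → TropNum} {n : ℕ} {p : ℕ → ℕ} {U V : ℕ → ℝ}
    (hp : PartialMatching B n n p U V) {j : ℕ} (hj : j < n) : p j < n := by
  obtain ⟨π, hπ⟩ := hp.exists_perm
  have := hπ (π.symm ⟨j, hj⟩)
  rw [Equiv.apply_symm_apply] at this
  rw [this]
  exact Fin.is_lt _

lemma PartialMatching.isPotential {n : ℕ} {A : Matrix (Fin n) (Fin n) TropNum}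
    {B : ℕ → ℕ → TropNum} (hAB : ∀ i j : Fin n, B i j = A i j) {p : ℕ → ℕ} {U V : ℕ → ℝ}
    (hp : PartialMatching B n n p U V) {π : Equiv.Perm (Fin n)}
    (hπ : ∀ i : Fin n, p (π i) = i) : IsPotential A π (fun i => U i) fun j => V j where
  le i j := by
    rw [← hAB]
    exact hp.le i i.2 j j.2
  eq i := by
    have h := (hp.tight (π i) (π i).2 (by rw [hπ]; exact i.2.le)).2
    rw [hπ] at h
    rw [← hAB, h]

lemma hasPerfectMatching_of_tdet_ne_bot {n : ℕ} {A : Matrix (Fin n) (Fin n) TropNum}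
    {B : ℕ → ℕ → TropNum} (hAB : ∀ i j : Fin n, B i j = A i j) (hA : tdet A ≠ ⊥) :
    HasPerfectMatching B n := by
  obtain ⟨π, hπ⟩ := exists_permWeight_eq_tdet A
  have h1 : ∀ i, A i (π i) ≠ ⊥ := fun i hi =>
    hA (by rw [← hπ, permWeight, WithBot.sum_eq_bot_iff.2 ⟨i, Finset.mem_univ i, hi⟩])
  refine ⟨fun i => if h : i < n then π ⟨i, h⟩ else 0, fun i hi => ?_, fun i hi k hk hik => ?_⟩
  · simp only [hi, dite_true]
    exact ⟨Fin.is_lt _, by simpa using (hAB ⟨i, hi⟩ (π ⟨i, hi⟩)).trans_ne (h1 ⟨i, hi⟩)⟩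
  · simp only [hi, hk, dite_true] at hik
    simpa using π.injective (Fin.ext hik)

/-- A square matrix with finite determinant has potentials that are tight on some permutation:
the program finds them. -/
theorem exists_isPotential {n : ℕ} {A : Matrix (Fin n) (Fin n) TropNum} (hA : tdet A ≠ ⊥) :
    ∃ π u v, IsPotential A π u v := by
  set B : ℕ → ℕ → TropNum := fun i j => if h : i < n ∧ j < n then A ⟨i, h.1⟩ ⟨j, h.2⟩ else ⊥
  have hAB : ∀ i j : Fin n, B i j = A i j := fun i j => by simp [B]
  -- The potentials are read off from a run of the program. The chosen memory holds n in every
  -- entry, in particular as the size, and B in every tropical array.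
  obtain ⟨-, s, -, -, h, -⟩ := runs_hungarian (s := ⟨fun _ _ => n, fun _ => B⟩) (n := n) rfl
  rcases h with ⟨-, U, V, -, hp⟩ | ⟨-, h⟩
  · obtain ⟨π, hπ⟩ := hp.exists_perm
    exact ⟨π, _, _, hp.isPotential hAB hπ⟩
  · exact absurd (hasPerfectMatching_of_tdet_ne_bot hAB hA) h

/-- Raise all entries off the unique optimal permutation by a small ε > 0. This permutation stays
optimal, so potentials of the raised matrix are tight on it, and elsewhere they exceed the entries
of A strictly. -/
lemma Nonsingular.exists_isStrictPotential {n : ℕ} (hn : 2 ≤ n)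
    {A : Matrix (Fin n) (Fin n) TropNum} (h : Nonsingular A) :
    ∃ π u v, IsStrictPotential A π u v := by
  classical
  obtain ⟨π, hπ⟩ := exists_permWeight_eq_tdet A
  have hdet := h.tdet_ne_bot hn
  obtain ⟨w, hw⟩ := WithBot.ne_bot_iff_exists.1 hdet
  have hlt : ∀ τ ≠ π, permWeight A τ < w := fun τ hτ => by
    rw [hw]
    exact (permWeight_le_tdet A τ).lt_of_ne fun he => hτ (h τ π he hπ)
  -- A permutation gains at most n ε from raising the entries.
  have hev : ∀ᶠ ε in 𝓝[>] (0 : ℝ), ∀ τ ≠ π, permWeight A τ + (n * ε : ℝ) < w := by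
    refine eventually_all.2 fun τ => ?_
    by_cases hτ : τ = π
    · simp [hτ]
    have h1 := hlt τ hτ
    generalize permWeight A τ = b at h1
    induction b using WithBot.recBotCoe with
    | bot => simp
    | coe b =>
      norm_cast at h1
      have hc : Continuous fun ε : ℝ => b + n * ε := by fun_prop
      have := (hc.tendsto 0).eventually_lt_const (u := w) (by simpa using h1)
      filter_upwards [nhdsWithin_le_nhds this] with ε hε _
      exact_mod_cast hε
  obtain ⟨ε, hε, hε0⟩ := (hev.and self_mem_nhdsWithin).exists
  replace hε0 : 0 < ε := hε0
  set B : Matrix (Fin n) (Fin n) TropNum :=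
    fun i j => if j = π i then A i j else A i j + (ε : TropNum) with hB
  have hBπ : permWeight B π = w := by
    rw [hw, ← hπ]
    exact Finset.sum_congr rfl fun i _ => by simp [hB]
  have hBτ : ∀ τ ≠ π, permWeight B τ < w := by
    intro τ hτ
    refine lt_of_le_of_lt ?_ (hε τ hτ)
    have h1 : ((n * ε : ℝ) : TropNum) = ∑ _i : Fin n, (ε : TropNum) := by
      rw [← coe_sum_tropNum]; simp
    rw [h1, permWeight, permWeight, ← Finset.sum_add_distrib]
    refine Finset.sum_le_sum fun i _ => ?_
    simp only [hB]
    split_ifs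
    · exact le_add_of_nonneg_right (by exact_mod_cast hε0.le)
    · exact le_rfl
  obtain ⟨p, u, v, hp⟩ := exists_isPotential (A := B) fun h0 => by
    have := permWeight_le_tdet B π
    rw [h0, hBπ] at this
    simp at this
  have hpπ : p = π := by
    by_contra hne
    have h1 := permWeight_le_tdet B π
    rw [hBπ, ← hp.permWeight_eq_tdet] at h1
    exact (hBτ p hne).not_ge h1
  subst hpπ
  refine ⟨p, u, v, fun i j hj => ?_, fun i => ?_⟩
  · have h1 := hp.le i j
    simp only [hB, if_neg hj] at h1
    generalize A i j = a at h1
    induction a using WithBot.recBotCoe with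
    | bot => exact WithBot.bot_lt_coe _
    | coe a => norm_cast at *; linarith
  · have h1 := hp.eq i
    simpa [hB] using h1

/-! ### Tropical simplices -/

lemma homog_column {d m : ℕ} (M : Matrix (Fin d) (Fin m) TropNum) (i : Fin (d + 1)) (j : Fin m) :
    homog (fun k => M k j) i = augment M i j := rfl

/-- The real points for which the permutation `π` is part of the covector. -/
def tightRegion {d : ℕ} (M : Matrix (Fin d) (Fin (d + 1)) TropNum)
    (π : Equiv.Perm (Fin (d + 1))) : Set (Fin d → ℝ) :=
  {y | ∀ i, Tight (fun k => M k (π i)) y i}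

/-- Row potentials are points up to the normalization z_i = u_i - u_0; tightness on π then
determines the column potentials. -/
lemma exists_isStrictPotential_iff {d : ℕ} {M : Matrix (Fin d) (Fin (d + 1)) TropNum}
    {π : Equiv.Perm (Fin (d + 1))} :
    (∃ u v, IsStrictPotential (augment M) π u v) ↔
      ∃ z, ∀ i, StrictlyTight (fun k => M k (π i)) z i := by
  constructor
  · rintro ⟨u, v, h⟩
    refine ⟨fun i => u i.succ - u 0, fun i k hk => ?_⟩
    have hz : ∀ i, rhomog (fun i : Fin d => u i.succ - u 0) i = u i - u 0 := fun i => by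
      induction i using Fin.cases <;> simp
    have h1 := h.lt k (π i) (fun he => hk (π.injective he).symm)
    rw [homog_column, homog_column, hz, hz, h.eq]
    generalize augment M k (π i) = a at *
    induction a using WithBot.recBotCoe with
    | bot => rw [WithBot.bot_add, ← WithBot.coe_add]; exact WithBot.bot_lt_coe _
    | coe a => norm_cast at *; linarith
  · rintro ⟨z, hz⟩
    refine ⟨rhomog z, fun j => (augment M (π.symm j) j).unbotD 0 - rhomog z (π.symm j),
      fun i j hj => ?_, fun i => ?_⟩
    · have h1 := hz (π.symm j) i fun he => hj (by rw [he]; simp)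
      have h2 := (hz (π.symm j)).tight.ne_bot
      rw [Equiv.apply_symm_apply] at h1 h2
      rw [homog_column] at h1 h2
      rw [homog_column] at h1
      obtain ⟨b, hb⟩ := WithBot.ne_bot_iff_exists.1 h2
      rw [← hb] at h1 ⊢
      generalize augment M i j = a at *
      induction a using WithBot.recBotCoe with
      | bot => exact WithBot.bot_lt_coe _
      | coe a =>
        norm_cast at *
        simp only [WithBot.unbotD_coe]
        linarith
    · have h2 := (hz i).tight.ne_bot
      rw [homog_column] at h2
      obtain ⟨b, hb⟩ := WithBot.ne_bot_iff_exists.1 h2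
      simp [← hb]

/-- A column cannot be strictly tight in two coordinates at the same point, so the d + 1 chosen
columns are distinct. -/
lemma ofReal_mem_trunk_columns {d m : ℕ} {M : Matrix (Fin d) (Fin m) TropNum} {y : Fin d → ℝ} :
    ofReal y ∈ trunk d (tconv (columns M)) ↔ ∃ q : Fin (d + 1) → Fin m, Function.Injective q ∧
      (∃ z, ∀ i, StrictlyTight (fun k => M k (q i)) z i) ∧
        ∀ i, Tight (fun k => M k (q i)) y i := by
  refine (ofReal_mem_trunk (Set.finite_range _)).trans ⟨?_, ?_⟩
  · rintro ⟨σ, hσ, ⟨z, hz⟩, hy⟩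
    choose q hq using hσ
    obtain rfl : (fun i k => M k (q i)) = σ := funext hq
    exact ⟨q, fun i j hij => (hz j).eq_of_tight (by simpa [hij] using (hz i).tight), ⟨z, hz⟩, hy⟩
  · rintro ⟨q, -, hz, hy⟩
    exact ⟨fun i k => M k (q i), fun i => ⟨q i, rfl⟩, hz, hy⟩

/-- Any choice of columns in `ofReal_mem_trunk_columns` is a permutation with strict potentials,
hence optimal, and π is the only optimal one. -/
lemma ofReal_mem_trunk_simplex {d : ℕ} {M : Matrix (Fin d) (Fin (d + 1)) TropNum}
    {π : Equiv.Perm (Fin (d + 1))} {u v : Fin (d + 1) → ℝ}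
    (h : IsStrictPotential (augment M) π u v) {y : Fin d → ℝ} :
    ofReal y ∈ trunk d (tconv (columns M)) ↔ y ∈ tightRegion M π := by
  rw [ofReal_mem_trunk_columns]
  constructor
  · rintro ⟨q, hq, hz, hy⟩
    obtain ⟨π', rfl⟩ : ∃ π' : Equiv.Perm (Fin (d + 1)), π' = q :=
      ⟨Equiv.ofBijective q (Finite.injective_iff_bijective.1 hq), rfl⟩
    obtain ⟨u', v', h'⟩ := exists_isStrictPotential_iff.2 hz
    rwa [h.nonsingular π π' h.isPotential.permWeight_eq_tdet h'.isPotential.permWeight_eq_tdet]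
  · intro hy
    exact ⟨π, π.injective, exists_isStrictPotential_iff.1 ⟨u, v, h⟩, hy⟩

lemma mem_tightRegion_iff {d : ℕ} {M : Matrix (Fin d) (Fin (d + 1)) TropNum}
    {π : Equiv.Perm (Fin (d + 1))} {y : Fin d → ℝ} : y ∈ tightRegion M π ↔
      ∀ i k, augment M k (π i) + (rhomog y i : ℝ) ≤ augment M i (π i) + (rhomog y k : ℝ) :=
  Iff.rfl

/-- Each inequality bounds one coordinate by another plus a constant, so componentwise suprema stay
in the region; the inequalities against coordinate 0 bound it from above. -/
lemma exists_isGreatest_tightRegion {d : ℕ} {M : Matrix (Fin d) (Fin (d + 1)) TropNum}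
    {π : Equiv.Perm (Fin (d + 1))} (hne : (tightRegion M π).Nonempty) :
    ∃ b, IsGreatest (tightRegion M π) b := by
  have hfin : ∀ i, ∃ a : ℝ, (a : TropNum) = augment M i (π i) := fun i =>
    WithBot.ne_bot_iff_exists.1 (hne.some_mem i).ne_bot
  choose a ha using hfin
  have hbdd : BddAbove (tightRegion M π) := by
    refine ⟨fun i => a i.succ, fun y hy i => ?_⟩
    have := hy i.succ 0
    rw [homog_column, homog_column, ← ha] at this
    simp only [rhomog_succ, rhomog_zero] at this
    have h0 : augment M 0 (π i.succ) = 0 := rfl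
    rw [h0] at this
    norm_cast at this
    linarith
  set b : Fin d → ℝ := fun i => ⨆ y : tightRegion M π, y.1 i with hb
  have : Nonempty (tightRegion M π) := hne.to_subtype
  obtain ⟨B, hB⟩ := hbdd
  have hbdd' : ∀ i, BddAbove (Set.range fun y : tightRegion M π => y.1 i) := fun i =>
    ⟨B i, by rintro _ ⟨y, rfl⟩; exact hB y.2 i⟩
  have hle : ∀ y ∈ tightRegion M π, y ≤ b := fun y hy i =>
    le_ciSup (hbdd' i) (⟨y, hy⟩ : tightRegion M π)
  have hrle : ∀ y ∈ tightRegion M π, ∀ k, rhomog y k ≤ rhomog b k := fun y hy k => by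
    induction k using Fin.cases with
    | zero => simp
    | succ k => simpa using hle y hy k
  have hsup : ∀ i c, (∀ y ∈ tightRegion M π, rhomog y i ≤ c) → rhomog b i ≤ c := by
    intro i c hc
    induction i using Fin.cases with
    | zero => simpa using hc _ hne.some_mem
    | succ i => exact ciSup_le fun y => hc y.1 y.2
  refine ⟨b, fun i k => ?_, hle⟩
  rw [homog_column, homog_column, ← ha]
  rcases eq_or_ne (augment M k (π i)) ⊥ with h | h
  · simp [h]
  obtain ⟨c, hc⟩ := WithBot.ne_bot_iff_exists.1 h
  rw [← hc]
  norm_cast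
  have := hsup i (a i + rhomog b k - c) fun y hy => by
    have h1 := hy i k
    rw [homog_column, homog_column, ← ha, ← hc] at h1
    norm_cast at h1
    linarith [hrle y hy k]
  linarith

/-! ### Maxima over trunks -/

/-- A full-dimensional cell consists of real points and lies in the trunk itself, so every trunk
point is a limit of real ones. -/
lemma trunk_subset_closure {d : ℕ} {V : Set (Fin d → TropNum)} (x : Fin d → TropNum)
    (hx : x ∈ trunk d (tconv V)) :
    ∃ S : Set (Fin d → ℝ), (∀ y ∈ S, ofReal y ∈ trunk d (tconv V)) ∧ S.Nonempty ∧
      x ∈ closure (ofReal '' S) := by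
  obtain ⟨F, ⟨hF, _, ⟨z, hzP, rfl⟩, hdim, hFG⟩, hxF⟩ := hx
  change d ≤ cellDim (cellOf (tconv V) z) at hdim
  change F ⊆ closure (cellOf (tconv V) z) at hFG
  obtain ⟨hz, -⟩ := exists_strictlyTight_of_le_cellDim hdim
  have hreal : cellOf (tconv V) z ⊆ Set.range ofReal := fun y hy =>
    exists_ofReal_eq fun j hj => hz j ((hy.2.1 j).1 hj)
  refine ⟨ofReal ⁻¹' cellOf (tconv V) z, fun y hy => ?_, ?_, ?_⟩
  · exact ⟨cellOf (tconv V) z, ⟨cellOf_mem_cells hzP, _, cellOf_mem_cells hzP, hdim,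
      subset_closure⟩, hy⟩
  · obtain ⟨z', rfl⟩ := exists_ofReal_eq hz
    exact ⟨z', mem_cellOf_self hzP⟩
  · rw [Set.image_preimage_eq_of_subset hreal]
    exact hFG hxF

lemma isGreatest_trunk {d : ℕ} {V : Set (Fin d → TropNum)} {b : Fin d → ℝ}
    (h : IsGreatest {y | ofReal y ∈ trunk d (tconv V)} b) :
    IsGreatest (trunk d (tconv V)) (ofReal b) := by
  refine ⟨h.1, fun x hx => ?_⟩
  obtain ⟨S, hS, -, hxS⟩ := trunk_subset_closure x hx
  have h1 : ofReal '' S ⊆ Set.Iic (ofReal b) := by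
    rintro _ ⟨y, hy, rfl⟩ i
    exact WithBot.coe_le_coe.2 (h.2 (hS y hy) i)
  exact closure_minimal h1 isClosed_Iic hxS

lemma trunkBarycenter_eq {d : ℕ} {S : Set (Fin d → TropNum)} {b : Fin d → TropNum}
    (h : IsGreatest (trunk d S) b) : trunkBarycenter S = b := by
  funext i
  refine IsGreatest.csSup_eq ⟨⟨b, h.1, rfl⟩, ?_⟩
  rintro _ ⟨x, hx, rfl⟩
  exact h.2 hx i

lemma coordSum_ofReal {d : ℕ} (y : Fin d → ℝ) : coordSum (ofReal y) = (∑ i, y i : ℝ) :=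
  (coe_sum_tropNum _ _).symm

lemma coordSum_mono {d : ℕ} {x y : Fin d → TropNum} (h : x ≤ y) : coordSum x ≤ coordSum y :=
  Finset.sum_le_sum fun i _ => h i

/-- The barycenter of the trunk of a non-singular simplex. -/
theorem trunkBarycenter_simplex {d : ℕ} {M : Matrix (Fin d) (Fin (d + 1)) TropNum}
    {π : Equiv.Perm (Fin (d + 1))} {u v : Fin (d + 1) → ℝ}
    (h : IsStrictPotential (augment M) π u v) {b : Fin d → ℝ}
    (hb : IsGreatest (tightRegion M π) b) :
    IsGreatest (trunk d (tconv (columns M))) (ofReal b) ∧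
      trunkBarycenter (tconv (columns M)) = ofReal b := by
  have h1 : {y | ofReal y ∈ trunk d (tconv (columns M))} = tightRegion M π :=
    Set.ext fun y => ofReal_mem_trunk_simplex h
  have h2 := isGreatest_trunk (h1 ▸ hb)
  exact ⟨h2, trunkBarycenter_eq h2⟩

theorem isGreatest_trunkBarycenter {d : ℕ} (hd : 1 ≤ d)
    {M : Matrix (Fin d) (Fin (d + 1)) TropNum} (hM : Nonsingular (augment M)) :
    IsGreatest (trunk d (tconv (columns M))) (trunkBarycenter (tconv (columns M))) := by
  obtain ⟨π, u, v, h⟩ := hM.exists_isStrictPotential (by omega)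
  obtain ⟨z, hz⟩ := exists_isStrictPotential_iff.1 ⟨u, v, h⟩
  obtain ⟨b, hb⟩ := exists_isGreatest_tightRegion ⟨z, fun i => (hz i).tight⟩
  obtain ⟨h1, h2⟩ := trunkBarycenter_simplex h hb
  rwa [h2]

lemma colSubmatrix_apply {d m k : ℕ} (M : Matrix (Fin d) (Fin m) TropNum)
    (J : {J : Finset (Fin m) // J.card = k}) (i : Fin d) (j : Fin k) :
    colSubmatrix M J i j = M i (J.1.orderEmbOfFin J.2 j) := rfl

/-- The real part of the trunk is the union of the trunks of the non-singular simplices. -/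
theorem ofReal_mem_trunk_iff_exists_simplex {d m : ℕ} {M : Matrix (Fin d) (Fin m) TropNum}
    {y : Fin d → ℝ} : ofReal y ∈ trunk d (tconv (columns M)) ↔
      ∃ J : {J : Finset (Fin m) // J.card = d + 1}, Nonsingular (augment (colSubmatrix M J)) ∧
        ofReal y ∈ trunk d (tconv (columns (colSubmatrix M J))) := by
  constructor
  · intro h
    obtain ⟨q, hq, ⟨z, hz⟩, hy⟩ := ofReal_mem_trunk_columns.1 h
    set J : {J : Finset (Fin m) // J.card = d + 1} :=
      ⟨Finset.univ.image q, by rw [Finset.card_image_of_injective _ hq]; simp⟩ with hJ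
    have hex : ∀ i, ∃ j, J.1.orderEmbOfFin J.2 j = q i := fun i => by
      have h1 : q i ∈ Set.range (J.1.orderEmbOfFin J.2) := by
        rw [Finset.range_orderEmbOfFin]; simp [hJ]
      exact h1
    choose r hr using hex
    have hrinj : Function.Injective r := fun i k hik => hq (by rw [← hr, ← hr, hik])
    obtain ⟨π, rfl⟩ : ∃ π : Equiv.Perm (Fin (d + 1)), π = r :=
      ⟨Equiv.ofBijective r (Finite.injective_iff_bijective.1 hrinj), rfl⟩
    have hz' : ∀ i, StrictlyTight (fun k => colSubmatrix M J k (π i)) z i := fun i => by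
      simp only [colSubmatrix_apply, hr]; exact hz i
    obtain ⟨u, v, huv⟩ := exists_isStrictPotential_iff.2 ⟨z, hz'⟩
    refine ⟨J, huv.nonsingular, ofReal_mem_trunk_columns.2 ⟨π, π.injective, ⟨z, hz'⟩, fun i => ?_⟩⟩
    simp only [colSubmatrix_apply, hr]
    exact hy i
  · rintro ⟨J, -, h⟩
    obtain ⟨q, hq, hz, hy⟩ := ofReal_mem_trunk_columns.1 h
    exact ofReal_mem_trunk_columns.2 ⟨fun i => J.1.orderEmbOfFin J.2 (q i),
      (J.1.orderEmbOfFin J.2).injective.comp hq, hz, hy⟩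

open Classical in
/-- The candidate value for the barycentric volume. -/
noncomputable def simplexSup {d m : ℕ} (M : Matrix (Fin d) (Fin m) TropNum) : TropNum :=
  (Finset.univ.filter fun J : {J : Finset (Fin m) // J.card = d + 1} =>
    Nonsingular (augment (colSubmatrix M J))).sup
    fun J => coordSum (trunkBarycenter (tconv (columns (colSubmatrix M J))))

/-- A nonempty trunk has a real point, which yields a non-singular simplex, so the supremum is a
value at some barycenter. Points with a coordinate -∞ have sum -∞ and cannot exceed it. -/
theorem isGreatest_simplexSup {d m : ℕ} (hd : 1 ≤ d) (M : Matrix (Fin d) (Fin m) TropNum)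
    (hne : (trunk d (tconv (columns M))).Nonempty) :
    IsGreatest (coordSum '' trunk d (tconv (columns M))) (simplexSup M) := by
  classical
  constructor
  · obtain ⟨x, hx⟩ := hne
    obtain ⟨S, hS, ⟨y, hy⟩, -⟩ := trunk_subset_closure x hx
    obtain ⟨J, hJ, -⟩ := ofReal_mem_trunk_iff_exists_simplex.1 (hS y hy)
    obtain ⟨J', hJ', hmax⟩ := Finset.exists_mem_eq_sup
      (Finset.univ.filter fun J : {J : Finset (Fin m) // J.card = d + 1} =>
        Nonsingular (augment (colSubmatrix M J))) ⟨J, by simpa using hJ⟩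
      fun J => coordSum (trunkBarycenter (tconv (columns (colSubmatrix M J))))
    simp only [Finset.mem_filter, Finset.mem_univ, true_and] at hJ'
    obtain ⟨π, u, v, h⟩ := hJ'.exists_isStrictPotential (by omega)
    obtain ⟨z, hz⟩ := exists_isStrictPotential_iff.1 ⟨u, v, h⟩
    obtain ⟨b, hb⟩ := exists_isGreatest_tightRegion ⟨z, fun i => (hz i).tight⟩
    obtain ⟨h1, h2⟩ := trunkBarycenter_simplex h hb
    refine ⟨ofReal b, ofReal_mem_trunk_iff_exists_simplex.2 ⟨J', hJ', h1.1⟩, ?_⟩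
    rw [simplexSup, hmax, h2]
  · rintro _ ⟨x, hx, rfl⟩
    by_cases hbot : ∃ i, x i = ⊥
    · obtain ⟨i, hi⟩ := hbot
      rw [coordSum, WithBot.sum_eq_bot_iff.2 ⟨i, Finset.mem_univ i, hi⟩]
      exact bot_le
    · push Not at hbot
      obtain ⟨y, rfl⟩ := exists_ofReal_eq hbot
      obtain ⟨J, hJ, hy⟩ := ofReal_mem_trunk_iff_exists_simplex.1 hx
      refine (coordSum_mono ((isGreatest_trunkBarycenter hd hJ).2 hy)).trans ?_
      exact Finset.le_sup
        (f := fun J => coordSum (trunkBarycenter (tconv (columns (colSubmatrix M J)))))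
        (by simpa using hJ)

theorem tlvol_eq_simplexSup {d m : ℕ} (hd : 1 ≤ d) (M : Matrix (Fin d) (Fin m) TropNum) :
    tlvol (tconv (columns M)) = simplexSup M := by
  by_cases hne : (trunk d (tconv (columns M))).Nonempty
  · exact (isGreatest_simplexSup hd M hne).csSup_eq
  · have h0 := Set.not_nonempty_iff_eq_empty.1 hne
    have h1 : tlvol (tconv (columns M)) = ⊥ := by
      rw [tlvol, h0]; simp
    rw [h1, simplexSup, eq_comm, Finset.sup_eq_bot_iff]
    intro J hJ
    simp only [Finset.mem_filter, Finset.mem_univ, true_and] at hJ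
    obtain ⟨π, u, v, h⟩ := hJ.exists_isStrictPotential (by omega)
    obtain ⟨z, hz⟩ := exists_isStrictPotential_iff.1 ⟨u, v, h⟩
    have h2 : ofReal z ∈ trunk d (tconv (columns (colSubmatrix M J))) :=
      (ofReal_mem_trunk_simplex h).2 fun i => (hz i).tight
    exact absurd ⟨_, ofReal_mem_trunk_iff_exists_simplex.2 ⟨J, hJ, h2⟩⟩ hne

end TropVol

namespace TropVol
open Function

/-! ### Uniqueness of optimal matchings and barycenters of simplices -/

/-- Complementary slackness: a single slack edge would push the weight strictly below the optimum.
-/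
lemma IsPotential.eq_of_permWeight_eq {n : ℕ} {A : Matrix (Fin n) (Fin n) TropNum}
    {π τ : Equiv.Perm (Fin n)} {u v : Fin n → ℝ} (h : IsPotential A π u v)
    (hτ : permWeight A τ = tdet A) (i : Fin n) : A i (τ i) = (u i + v (τ i) : ℝ) := by
  refine (h.le i (τ i)).eq_of_not_lt fun hlt => ?_
  have h1 := tropNum_sum_lt_sum (fun i => h.le i (τ i)) hlt
  rw [Finset.sum_add_distrib, Equiv.sum_comp τ v, ← h.permWeight_eq, h.permWeight_eq_tdet,
    ← hτ] at h1
  exact lt_irrefl _ h1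

/-- If the tight edges are acyclic then the optimal matching is unique. -/
lemma IsPotential.nonsingular {n : ℕ} {A : Matrix (Fin n) (Fin n) TropNum}
    {π : Equiv.Perm (Fin n)} {u v : Fin n → ℝ} (h : IsPotential A π u v) {f : Fin n → ℕ}
    (hf : ∀ i j, j ≠ π i → ¬ A i j < (u i + v j : ℝ) → f (π i) < f j) : Nonsingular A := by
  have key : ∀ τ, permWeight A τ = tdet A → τ = π := by
    intro τ hτ
    have hlt : ∀ i, τ i ≠ π i → f (π i) < f (τ i) := fun i hi =>
      hf i _ hi (by rw [h.eq_of_permWeight_eq hτ]; exact lt_irrefl _)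
    by_contra hne
    obtain ⟨k, hk⟩ : ∃ k, τ k ≠ π k := by
      by_contra! h'
      exact hne (Equiv.ext h')
    -- Each deviation from π increases f, although both sums run over all columns once.
    have h1 : ∑ i, f (π i) < ∑ i, f (τ i) := Finset.sum_lt_sum (fun i _ => by
      by_cases hi : τ i = π i
      · rw [hi]
      · exact (hlt i hi).le) ⟨k, Finset.mem_univ k, hlt k hk⟩
    rw [Equiv.sum_comp π f, Equiv.sum_comp τ f] at h1
    exact lt_irrefl _ h1
  exact fun σ τ hσ hτ => (key σ hσ).trans (key τ hτ).symm

/-- If the optimal matching is unique then the tight edges are acyclic. -/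
lemma Nonsingular.exists_rank {n : ℕ} (hn : 2 ≤ n) {A : Matrix (Fin n) (Fin n) TropNum}
    (hA : Nonsingular A) {π : Equiv.Perm (Fin n)} {u v : Fin n → ℝ} (h : IsPotential A π u v) :
    ∃ f : Fin n → ℝ, ∀ i j, j ≠ π i → ¬ A i j < (u i + v j : ℝ) → f (π i) < f j := by
  obtain ⟨π', u', v', h'⟩ := hA.exists_isStrictPotential hn
  obtain rfl := hA π' π h'.isPotential.permWeight_eq_tdet h.permWeight_eq_tdet
  -- A column is ranked by how far the potential of its row exceeds the strict one. On a tight edge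
  -- u_i + v_j ≤ a_ij < u'_i + v'_j, and u + v = u' + v' on π turns this into an increase of rank.
  refine ⟨fun j => u (π'.symm j) - u' (π'.symm j), fun i j hj hlt => ?_⟩
  have h1 := (not_lt.1 hlt).trans_lt (h'.lt i j hj)
  have h2 := h.eq (π'.symm j)
  rw [h'.eq] at h2
  rw [Equiv.apply_symm_apply] at h2
  simp only [Equiv.symm_apply_apply]
  norm_cast at h1 h2
  linarith

/-- The barycenter of a simplex from a tree of longest paths. -/
lemma IsPotential.isGreatest_tightRegion {d : ℕ} {N : Matrix (Fin d) (Fin (d + 1)) TropNum}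
    {π : Equiv.Perm (Fin (d + 1))} {u v : Fin (d + 1) → ℝ} (h : IsPotential (augment N) π u v)
    {c : ℝ} (hc : ∀ j, -c ≤ v j) (f : Fin (d + 1) → ℕ)
    (hf : ∀ i, v (π i) = -c ∨ ∃ k, f k < f i ∧ augment N k (π i) = (u k + v (π i) : ℝ)) :
    u 0 = c ∧ IsGreatest (tightRegion N π) fun i => u i.succ - c := by
  have hrow : ∀ j, augment N 0 j = ((0 : ℝ) : TropNum) := fun j => rfl
  -- Row 0 consists of zeros, like the artificial row with potential c. Its matched edge gives u 0 ≤
  -- c; a row with minimal f hangs directly on the artificial row and gives u 0 ≥ c.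
  have hu : u 0 = c := by
    refine le_antisymm ?_ ?_
    · have h1 := h.eq 0
      rw [hrow] at h1
      norm_cast at h1
      linarith [hc (π 0)]
    · obtain ⟨i, -, hi⟩ := Finset.exists_min_image Finset.univ f ⟨0, Finset.mem_univ _⟩
      rcases hf i with h1 | ⟨k, hk, -⟩
      · have h2 := h.le 0 (π i)
        rw [hrow] at h2
        norm_cast at h2
        linarith
      · exact absurd (hi k (Finset.mem_univ k)) hk.not_ge
  have hz : ∀ i, rhomog (fun i : Fin d => u i.succ - c) i = u i - c := fun i => by
    induction i using Fin.cases with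
    | zero => simp [hu]
    | succ i => simp
  refine ⟨hu, mem_tightRegion_iff.2 fun i k => ?_, fun y hy => ?_⟩
  · have h1 := h.le k (π i)
    rw [hz, hz, h.eq]
    generalize augment N k (π i) = a at *
    induction a using WithBot.recBotCoe with
    | bot => simp
    | coe a => norm_cast at *; linarith
  · rw [mem_tightRegion_iff] at hy
    -- Along a tree edge the region bounds y_i - y_k by u_i - u_k; telescoping down to the
    -- artificial row gives y_i ≤ u_i - c.
    have key : ∀ m i, f i = m → rhomog y i ≤ u i - c := by
      intro m
      induction m using Nat.strong_induction_on with
      | _ m ih =>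
        intro i hi
        rcases hf i with h1 | ⟨k, hk, h1⟩
        · have h2 := hy i 0
          rw [hrow, h.eq, rhomog_zero] at h2
          norm_cast at h2
          linarith
        · have h2 := hy i k
          rw [h1, h.eq] at h2
          have h3 := ih (f k) (hi ▸ hk) k rfl
          norm_cast at h2
          linarith
    intro i
    simpa using key _ i.succ rfl

/-- The barycenter of a simplex from a complete search that starts in an additional row of
zeros. -/
lemma SearchResult.exists_isGreatest {d n : ℕ} (hnd : n = d + 1)
    {N : Matrix (Fin d) (Fin (d + 1)) TropNum} {W : ℕ → ℕ → TropNum}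
    (hW : ∀ i j : Fin (d + 1), W i j = augment N i j) (hWn : ∀ j < n, W n j = 0)
    {p used way : ℕ → ℕ} {U V : ℕ → ℝ} {D : ℕ → TropNum} {last t : ℕ}
    (hp : PartialMatching W n n p U V) (hpn : p n = n)
    (h : SearchResult W n p U V used way D last t) {π : Equiv.Perm (Fin (d + 1))}
    (hπ : ∀ i : Fin (d + 1), p (π i) = i) :
    (∀ j < n, D j ≠ ⊥) ∧ ∃ b, IsGreatest (tightRegion N π) b ∧
      ∑ i, b i = ∑ j ∈ Finset.range n, (U (p j) - (D j).unbotD 0 - U n) := by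
  have hpj : ∀ j ≤ n, p j ≤ n := fun j hj => by
    rcases hj.lt_or_eq with h | rfl
    · exact (hp.lt_of_lt h).le
    · exact hpn.le
  obtain ⟨hT, -, hall⟩ := h.resolve_left fun h => (hpj _ h.1.last_le).not_gt h.2
  have hroot := fun j hj => hT.relaxed n le_rfl (by simp [hT.used_root]) (.inr trivial) j hj
  simp only [hT.dist_root, hpn, zero_add] at hroot
  -- The artificial row has only finite entries, so every column is reached.
  have hD : ∀ j < n, D j ≠ ⊥ := fun j hj h0 => by
    have h1 := hroot j hj
    rw [hWn j hj, h0, WithBot.bot_add] at h1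
    simp at h1
  have hused : ∀ j < n, used j ≠ 0 := fun j hj h0 => hD j hj (hall j hj h0)
  refine ⟨hD, ?_⟩
  set D' : ℕ → ℝ := fun j => (D j).unbotD 0 with hD'
  have hdist : ∀ j < n, D j = (D' j : TropNum) := fun j hj => hT.exists_dist hj.le (hused j hj)
  subst hnd
  -- Shifting the potentials by the distances keeps them feasible; the tree edges will be tight for
  -- them.
  have hrel : ∀ i j : Fin (d + 1), augment N i j ≤ (U i - D' (π i) + (V j + D' j) : ℝ) := by
    intro i j
    have h1 := hT.relaxed (π i) (π i).2.le (hused _ (π i).2) (.inr trivial) j j.2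
    rw [hπ, hW, hdist _ (π i).2, hdist _ j.2] at h1
    generalize augment N i j = a at *
    induction a using WithBot.recBotCoe with
    | bot => simp
    | coe a => norm_cast at *; linarith
  have hpot : IsPotential (augment N) π (fun i => U i - D' (π i)) fun j => V j + D' j := by
    refine ⟨hrel, fun i => ?_⟩
    rw [(hp.isPotential hW hπ).eq i]
    norm_cast
    ring
  obtain ⟨h1, h2⟩ := hpot.isGreatest_tightRegion (c := U (d + 1)) (fun j => by
    have h1 := hroot j j.2
    rw [hWn j j.2, hdist j j.2] at h1
    norm_cast at h1
    linarith) (fun i => used (π i)) fun i => by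
    obtain ⟨h3, h4, h5, h6, h7⟩ := hT.way (π i) (π i).2 (hD _ (π i).2)
    rcases h3.lt_or_eq with h8 | h8
    · refine .inr ⟨π.symm ⟨way (π i), h8⟩, ?_, ?_⟩
      · rw [Equiv.apply_symm_apply]
        exact h6 (hused _ (π i).2)
      · have h9 := hπ (π.symm ⟨way (π i), h8⟩)
        rw [Equiv.apply_symm_apply] at h9 ⊢
        simp only at h9 ⊢
        rw [h9, hW, hdist _ h8, hdist _ (π i).2] at h7
        generalize augment N _ _ = a at *
        induction a using WithBot.recBotCoe with
        | bot => simp [← WithBot.coe_add] at h7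
        | coe a => norm_cast at *; linarith
    · left
      rw [h8, hT.dist_root, hpn, hWn _ (π i).2, hdist _ (π i).2, zero_add, ← WithBot.coe_zero] at h7
      norm_cast at h7
      linarith
  refine ⟨_, h2, ?_⟩
  -- The summand of row 0 vanishes because its potential equals that of the artificial row, so the
  -- sum may run over all columns.
  have h3 : ∑ i : Fin d, (U (i.succ : Fin (d + 1)) - D' (π i.succ) - U (d + 1)) =
      ∑ i : Fin (d + 1), (U i - D' (π i) - U (d + 1)) := by
    rw [Fin.sum_univ_succ, h1]
    simp
  rw [Finset.sum_range]
  refine h3.trans (.trans (Finset.sum_congr rfl fun i _ => ?_)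
    (Equiv.sum_comp π fun j : Fin (d + 1) => U (p j) - D' j - U (d + 1)))
  rw [hπ]

end TropVol

namespace TropVol
open Function

/-! ### Processing a simplex -/

lemma Memory.storeTrop_trop_apply (s : Memory) (a i j i' j' : ℕ) (v : TropNum) :
    (s.storeTrop a i j v).trop a i' j' = if i' = i ∧ j' = j then v else s.trop a i' j' := by
  rw [Memory.storeTrop_trop_self]
  by_cases hi : i' = i
  · subst hi
    by_cases hj : j' = j <;> simp [hj]
  · simp [hi]

/-- The column `j` of the matrix in `s'` is the homogenization of the selected column in `s`. -/
structure Copied (s : Memory) (d j : ℕ) (s' : Memory) : Prop where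
  zero : s'.trop 2 0 j = 0
  last : s'.trop 2 (d + 1) j = 0
  succ : ∀ i < d, s'.trop 2 (i + 1) j = s.trop 0 i (s.nat 2 j)

theorem runs_copy {s : Memory} {d : ℕ} (hd : s.nat 0 0 = d) (hn : s.nat 10 0 = d + 1) :
    Runs Prog.copy s (100 * (d + 2) ^ 2) fun s' => ∀ j < d + 1, Copied s d j s' := by
  refine Runs.le (.for (n := d + 1) (B := d * 30 + 60) (fun k s' => ∀ j < k, Copied s d j s')
    (by decide) (fun s' hS => ?_) (by simp) (fun k hk s' hI hs' hS => Runs.le (.seq (.setTrop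
      (.seq (.setTrop (.for (n := d) (B := 15) (fun i s'' => (∀ j < k, Copied s d j s'') ∧
        s''.trop 2 0 k = 0 ∧ s''.trop 2 (d + 1) k = 0 ∧
        ∀ i' < i, s''.trop 2 (i' + 1) k = s.trop 0 i' (s.nat 2 k)) (by decide)
        (fun s'' hS' => ?_) ?_ (fun i hi s'' ⟨h1, h2, h3, h4⟩ hs'' hS' => .le (.setTrop fun _ => ?_)
          (by decide)) fun s'' ⟨h1, h2, h3, h4⟩ _ _ _ j hj => ?_))))) ?_) fun s' h _ _ => h) ?_
  · simp [hS.nat 10 (by decide), hn]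
  · simp [hS'.nat 0 (by decide), hS.nat 0 (by decide), hd]
  · have e10 := hS.nat 10 (by decide)
    simp only [NatExpr.eval, TropExpr.eval, Memory.storeNat_trop, Memory.storeTrop_nat, hs', e10, hn,
      Memory.storeTrop_trop_apply]
    refine ⟨fun j hj => ?_, by simp, by simp, by simp⟩
    obtain ⟨h1, h2, h3⟩ := hI j hj
    constructor <;> simp [Memory.storeTrop_trop_apply, hj.ne] <;> assumption
  · have e20 := hS'.nat 20 (by decide)
    have e2 := (hS'.nat 2 (by decide)).trans (hS.nat 2 (by decide))
    have t0 : s''.trop 0 = s.trop 0 := by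
      rw [hS'.trop 0 (by decide)]
      simpa using hS.trop 0 (by decide)
    simp only [Memory.storeTrop_nat] at e20
    simp only [NatExpr.eval, TropExpr.eval, Memory.storeNat_trop, hs'', e20, hs', e2, t0,
      Memory.storeTrop_trop_apply]
    refine ⟨fun j hj => ?_, by simpa using h2, ?_, fun i' hi' => ?_⟩
    · obtain ⟨h1, h2, h3⟩ := h1 j hj
      constructor <;> simp [Memory.storeTrop_trop_apply, hj.ne] <;> assumption
    · rw [if_neg (by omega)]
      exact h3
    · by_cases hii : i' = i
      · simp [hii]
      · rw [if_neg (by omega)]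
        exact h4 i' (by omega)
  · rcases Nat.lt_succ_iff_lt_or_eq.1 hj with h | rfl
    · obtain ⟨h1, h2, h3⟩ := h1 j h
      exact ⟨h1, h2, h3⟩
    · exact ⟨h2, h3, h4⟩
  · simp only [NatExpr.cost, TropExpr.cost]
    omega
  · simp only [NatExpr.cost]
    nlinarith

theorem runs_record {s : Memory} {n : ℕ} {U V D : ℕ → ℝ} (hn : s.nat 10 0 = n)
    (hpot : s.HasPotentials n U V) (hD : ∀ j < n, s.trop 5 0 j = (D j : TropNum))
    (hp : ∀ j < n, s.nat 3 j ≤ n) :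
    Runs Prog.record s (100 * (n + 1)) fun s' => s'.trop 1 0 0 =
      s.trop 1 0 0 ⊔ (∑ j ∈ Finset.range n, (U (s.nat 3 j) - D j - U n) : ℝ) := by
  refine Runs.le (.seq (.setTrop (.seq_same (.for (n := n) (B := 40) (fun k s' => s'.trop 8 0 0 =
      (∑ j ∈ Finset.range k, (U (s.nat 3 j) - D j - U n) : ℝ)) (by decide)
    (fun s' hS => ?_) ?_ (fun k hk s' hI hs' hS => .le (.setTrop fun _ => ?_) (by decide))
    fun s' hI _ _ hS => .setTrop ?_)))) ?_
  · simp [hS.nat 10 (by decide), hn]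
  · simp
  · have e3 := hS.nat 3 (by decide)
    have e10 := hS.nat 10 (by decide)
    have t3 := hS.trop 3 (by decide)
    have t5 := hS.trop 5 (by decide)
    simp at e3 e10 t3 t5
    simp only [NatExpr.eval, TropExpr.eval, Memory.storeNat_trop, Memory.storeTrop_trop_apply,
      e3, e10, t3, t5, hs', hI, hn, hpot.row _ (hp k hk), hpot.row n le_rfl, hD k hk,
      Finset.sum_range_succ, and_self, if_true]
    simp only [WithBot.map_coe, ← WithBot.coe_add]
    congr 1
  · have t1 := hS.trop 1 (by decide)
    simp at t1
    simp [t1, hI]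
  · simp only [NatExpr.cost, TropExpr.cost]
    omega

open Classical in
/-- The contribution of a simplex to the barycentric volume. -/
noncomputable def simplexValue {d : ℕ} (N : Matrix (Fin d) (Fin (d + 1)) TropNum) : TropNum :=
  if Nonsingular (augment N) then coordSum (trunkBarycenter (tconv (columns N))) else ⊥

theorem runs_simplex {s : Memory} {d : ℕ} (hd : 1 ≤ d) (hs : s.nat 0 0 = d)
    (hn : s.nat 10 0 = d + 1) {N : Matrix (Fin d) (Fin (d + 1)) TropNum}
    (hN : ∀ (i : Fin d) (j : Fin (d + 1)), s.trop 0 i (s.nat 2 j) = N i j) :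
    Runs Prog.simplex s (3000 * (d + 2) ^ 3) fun s' =>
      s'.trop 1 0 0 = s.trop 1 0 0 ⊔ simplexValue N := by
  have hfin : ∀ s₁ : Memory, s₁.nat 10 0 = d + 1 → (∀ j < d + 1, Copied s d j s₁) →
      s₁.trop 1 = s.trop 1 → Runs (.seq Prog.hungarian (.ite (.natLt (.var 13) (.const 1))
        (.seq Prog.search (.seq Prog.peel (.ite (.natLt (.const 0) (.var 15)) Prog.record .skip)))
        .skip)) s₁ (2000 * (d + 2) ^ 3) fun s' =>
          s'.trop 1 0 0 = s.trop 1 0 0 ⊔ simplexValue N := by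
    intro s₁ e10 hcopy t1
    have hW : ∀ i j : Fin (d + 1), s₁.trop 2 i j = augment N i j := fun i j => by
      obtain ⟨h1, h2, h3⟩ := hcopy j j.2
      induction i using Fin.cases with
      | zero => exact h1
      | succ i =>
        rw [Fin.val_succ, h3 i i.2, hN]
        rfl
    refine Runs.le (.seq_same ((runs_hungarian e10).mono le_rfl fun s₂ ⟨hM, h22⟩ hS₂ _ =>
      .ite (B := 700 * (d + 2) ^ 3) (fun hb => ?_) fun hb => .skip ?_)) ?_
    · rcases hM with ⟨h13, U, V, hpot, hp⟩ | ⟨h13, -⟩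
      swap
      · simp at hb; exact absurd hb h13
      have e10' : s₂.nat 10 0 = d + 1 := by rw [hS₂.nat 10 (by decide), e10]
      have t2 : s₂.trop 2 = s₁.trop 2 := hS₂.trop 2 (by decide)
      -- Variable 22 equals d + 1 after the matching phase, so this search starts in the artificial
      -- row of zeros.
      refine Runs.le (.seq_same ((runs_search e10' (by omega) h22 le_rfl hpot (by rwa [t2])).mono
        le_rfl fun s₃ ⟨h3, hR⟩ hS₃ _ => .seq_same (B' := 700 * (d + 2)) ((runs_peel (n := d + 1) (U := U) (V := V) ?_
          ?_ ?_).mono le_rfl fun s₄ ⟨hf, hf'⟩ hS₄ _ => ?_))) ?_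
      · rw [hS₃.nat 10 (by decide), e10']
      · exact ⟨by rw [hS₃.trop 3 (by decide)]; exact hpot.row,
          by rw [hS₃.trop 4 (by decide)]; exact hpot.col⟩
      · intro k hk
        rw [h3, update_of_ne hk.ne]
        exact hp.lt_of_lt hk
      · have hp3 : PartialMatching (s₁.trop 2) (d + 1) (d + 1) (s₃.nat 3) U V :=
          hp.congr fun j hj => by rw [h3, update_of_ne hj.ne]
        have t2' : s₃.trop 2 = s₁.trop 2 := (hS₃.trop 2 (by decide)).trans t2
        rw [t2'] at hf hf'
        rw [t2] at hR
        obtain ⟨π, hπ⟩ := hp3.exists_perm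
        have hpotl := hp3.isPotential hW hπ
        have htight : ∀ i j : Fin (d + 1), j ≠ π i → ¬ augment N i j < (U i + V j : ℝ) →
            TightEdge (s₁.trop 2) (s₃.nat 3) U V (π i) j := fun i j hj hij => by
          refine ⟨fun he => hj (Fin.ext he).symm, ?_⟩
          rwa [hπ, hW]
        have t1' : s₄.trop 1 = s.trop 1 := by
          rw [hS₄.trop 1 (by decide), hS₃.trop 1 (by decide), hS₂.trop 1 (by decide), t1]
        refine Runs.le (.ite (B := 100 * (d + 1 + 1)) (fun hb' => ?_) fun hb' => .skip ?_) ?_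
        · have h15 : s₄.nat 15 0 ≠ 0 := by simpa [Nat.pos_iff_ne_zero] using hb'
          obtain ⟨f, hf⟩ := hf h15
          have hns : Nonsingular (augment N) := hpotl.nonsingular (f := fun j => f j)
            fun i j hj hij => hf j j.2 _ (π i).2 (htight i j hj hij)
          obtain ⟨hD, b, hb, hsum⟩ := hR.exists_isGreatest rfl hW (fun j hj => (hcopy j hj).last)
            hp3 (by rw [h3, update_self]) hπ
          obtain ⟨π', u, v, h'⟩ := hns.exists_isStrictPotential (by omega)
          obtain rfl := hns π' π h'.isPotential.permWeight_eq_tdet hpotl.permWeight_eq_tdet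
          refine (runs_record (n := d + 1) (U := U) (V := V)
            (D := fun j => (s₃.trop 5 0 j).unbotD 0) ?_ ?_ (fun j hj => ?_) fun j hj => ?_).mono
            le_rfl fun s₅ h5 _ => ?_
          · rw [hS₄.nat 10 (by decide), hS₃.nat 10 (by decide), e10']
          · exact ⟨by rw [hS₄.trop 3 (by decide), hS₃.trop 3 (by decide)]; exact hpot.row,
              by rw [hS₄.trop 4 (by decide), hS₃.trop 4 (by decide)]; exact hpot.col⟩
          · rw [hS₄.trop 5 (by decide)]
            obtain ⟨a, ha⟩ := WithBot.ne_bot_iff_exists.1 (hD j hj)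
            simp [← ha]
          · rw [hS₄.nat 3 (by decide)]
            exact (hp3.lt_of_lt hj).le
          · rw [h5, t1', simplexValue, if_pos hns, (trunkBarycenter_simplex h' hb).2,
              coordSum_ofReal, hsum, hS₄.nat 3 (by decide)]
        · have h15 : s₄.nat 15 0 = 0 := by simpa [Nat.pos_iff_ne_zero] using hb'
          have hns : ¬ Nonsingular (augment N) := fun hns => by
            obtain ⟨f, hf⟩ := hns.exists_rank (by omega) hpotl
            refine hf' (fun j => if h : j < d + 1 then f ⟨j, h⟩ else 0)
              (fun j hj k hk hkj => ?_) h15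
            simp only [hj, hk, dite_true]
            have h1 := hp3.lt_of_lt hk
            have h2 : π ⟨s₃.nat 3 k, h1⟩ = ⟨k, hk⟩ := Fin.ext
              (hp3.inj _ (Fin.is_lt _) k hk (by rw [hπ]; exact h1.le) (hπ _))
            have h3 := hf ⟨s₃.nat 3 k, h1⟩ ⟨j, hj⟩ (by
              rw [h2]
              intro he
              exact hkj.1 (Fin.ext_iff.1 he).symm) (by
              rw [← hW]
              exact hkj.2)
            rwa [h2] at h3
          rw [t1', simplexValue, if_neg hns, sup_bot_eq]
        · simp only [NatExpr.cost, Test.cost]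
          omega
      · nlinarith [Nat.zero_le (d ^ 3), Nat.zero_le (d ^ 2)]
    · rcases hM with ⟨h13, -⟩ | ⟨-, hM⟩
      · simp at hb; exact absurd h13 hb
      have hns : ¬ Nonsingular (augment N) := fun hns =>
        hM (hasPerfectMatching_of_tdet_ne_bot hW (hns.tdet_ne_bot (by omega)))
      rw [simplexValue, if_neg hns, sup_bot_eq, hS₂.trop 1 (by decide), t1]
    · simp only [NatExpr.cost, Test.cost]
      have : 1 ≤ (d + 2) ^ 3 := Nat.one_le_pow _ _ (by omega)
      rw [max_eq_left (by omega), show d + 1 + 1 = d + 2 from rfl]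
      omega
  refine Runs.le (.seq_same ((runs_copy hs hn).mono le_rfl fun s₁ h hS _ =>
    hfin s₁ (by rw [hS.nat 10 (by decide), hn]) h (hS.trop 1 (by decide)))) ?_
  nlinarith [Nat.zero_le (d ^ 3), Nat.zero_le (d ^ 2)]

end TropVol

namespace TropVol
open Function

/-! ### Enumerating the simplices -/

/-- The numbers `c j` for `j < n` form an increasing sequence of numbers less than `m`, followed
by `m`. -/
structure IsSelection (n m : ℕ) (c : ℕ → ℕ) : Prop where
  lt : ∀ j < n, c j < c (j + 1)
  last : c n = m

/-- The position of an increasing sequence in the colexicographic order. -/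
def colexRank (n : ℕ) (c : ℕ → ℕ) : ℕ := ∑ j ∈ Finset.range n, (c j).choose (j + 1)

lemma colexRank_congr {n : ℕ} {c c' : ℕ → ℕ} (h : ∀ j < n, c' j = c j) :
    colexRank n c' = colexRank n c :=
  Finset.sum_congr rfl fun j hj => by rw [h j (Finset.mem_range.1 hj)]

lemma colexRank_succ (n : ℕ) (c : ℕ → ℕ) :
    colexRank (n + 1) c = colexRank n c + (c n).choose (n + 1) := Finset.sum_range_succ _ _

lemma colexRank_id (n : ℕ) : colexRank n id = 0 :=
  Finset.sum_eq_zero fun j _ => Nat.choose_succ_self j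

/-- The state before round `t` of the search for the successor of `c`; `flag` says whether
the search goes on. -/
def NextState (n m : ℕ) (c : ℕ → ℕ) (t : ℕ) (c' : ℕ → ℕ) (flag : ℕ) : Prop :=
  (flag = 1 ∧ (∀ j < t, c' j = j) ∧ (∀ j, t ≤ j → c' j = c j) ∧
    colexRank t c + 1 = (c t).choose t) ∨
  (flag = 0 ∧ IsSelection n m c' ∧ colexRank n c' = colexRank n c + 1)

lemma le_of_isSelection {n m : ℕ} {c : ℕ → ℕ} (h : IsSelection n m c) : ∀ j ≤ n, j ≤ c j := by
  intro j
  induction j with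
  | zero => simp
  | succ j ih => exact fun hj => (ih (by omega)).trans_lt (h.lt j (by omega))

/-- The first t entries contribute C(c_t, t) - 1 before the change and 0 after it, while entry t
gains C(c_t, t) by Pascal's rule. -/
lemma colexRank_update {n t : ℕ} (ht : t < n) {c c' : ℕ → ℕ} (h1 : ∀ j < t, c' j = j)
    (h2 : ∀ j, t < j → c' j = c j) (h3 : c' t = c t + 1)
    (h4 : colexRank t c + 1 = (c t).choose t) : colexRank n c' = colexRank n c + 1 := by
  induction n with
  | zero => omega
  | succ n ih =>
    rw [colexRank_succ, colexRank_succ]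
    rcases Nat.lt_succ_iff_lt_or_eq.1 ht with h | rfl
    · rw [ih h, h2 n h]
      omega
    · rw [colexRank_congr (c := id) h1, colexRank_id, h3, Nat.choose_succ_succ']
      omega

/-- The entry m behind the selection is a sentinel. If every entry is followed by its successor up
to m, the invariant at t = n says that the rank is C(m, n) - 1, the last one. -/
theorem runs_next {s : Memory} {n m : ℕ} (hn : s.nat 10 0 = n) (hc : IsSelection n m (s.nat 2)) :
    Runs Prog.next s (100 * (n + 1)) fun s' =>
      (s'.nat 14 0 = 1 ∧ IsSelection n m (s'.nat 2) ∧
        colexRank n (s'.nat 2) = colexRank n (s.nat 2) + 1) ∨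
      (s'.nat 14 0 = 0 ∧ colexRank n (s.nat 2) + 1 = m.choose n) := by
  refine Runs.le (.seq (.setNat (.seq (.for (n := n) (B := 50)
    (fun t s' => NextState n m (s.nat 2) t (s'.nat 2) (s'.nat 15 0)) (by decide)
    (fun s' hS => ?_) ?_ (fun t ht s' hI hs' hS => ?_) fun s' hI _ hS => .setNat ?_)))) ?_
  · simp [hS.nat 10 (by decide), hn]
  · left
    simp [colexRank]
  · rcases hI with ⟨h15, h1, h2, h3⟩ | ⟨h15, h1⟩
    · refine Runs.le (.ite_pos (by simp [h15]) (.ite (fun hb => .seq (.setNat (.setNat fun _ => ?_)))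
        fun hb => .setNat fun _ => ?_)) (by decide)
      · have hlt : s.nat 2 t + 1 < s.nat 2 (t + 1) := by
          simpa [hs', h2 t le_rfl, h2 (t + 1) (by omega)] using hb
        right
        simp only [NatExpr.eval, hs', h2 t le_rfl]
        rw [Memory.storeNat_nat_of_ne _ _ _ (by decide), Memory.storeNat_nat_self, update_self,
          Memory.storeNat_nat_of_ne _ _ _ (by decide), Memory.storeNat_nat_of_ne _ _ _ (by decide),
          Memory.storeNat_nat_self]
        have h4 : ∀ j < t, update (s'.nat 2) t (s.nat 2 t + 1) j = j := fun j hj => by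
          rw [update_of_ne hj.ne, h1 j hj]
        have h5 : ∀ j, t < j → update (s'.nat 2) t (s.nat 2 t + 1) j = s.nat 2 j := fun j hj => by
          rw [update_of_ne hj.ne', h2 j hj.le]
        refine ⟨rfl, ⟨fun j hj => ?_, ?_⟩, colexRank_update ht h4 h5 (by simp) h3⟩
        · rcases lt_trichotomy j t with h | rfl | h
          · rw [h4 j h]
            rcases lt_or_eq_of_le (Nat.succ_le_of_lt h) with h' | h'
            · rw [h4 _ h']
              omega
            · rw [show j + 1 = t from h', update_self]
              have := le_of_isSelection hc t ht.le
              omega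
          · rw [update_self, h5 _ (by omega)]
            exact hlt
          · rw [h5 j h, h5 _ (by omega)]
            exact hc.lt j hj
        · rw [h5 n ht]
          exact hc.last
      · have hlt : ¬ s.nat 2 t + 1 < s.nat 2 (t + 1) := by
          simpa [hs', h2 t le_rfl, h2 (t + 1) (by omega)] using hb
        have heq : s.nat 2 (t + 1) = s.nat 2 t + 1 := by
          have := hc.lt t ht
          omega
        left
        simp only [NatExpr.eval, hs']
        rw [Memory.storeNat_nat_of_ne _ _ _ (by decide), Memory.storeNat_nat_of_ne _ _ _ (by decide),
          Memory.storeNat_nat_of_ne _ _ _ (by decide), Memory.storeNat_nat_self]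
        refine ⟨h15, fun j hj => ?_, fun j hj => ?_, ?_⟩
        · by_cases hjt : j = t
          · rw [hjt, update_self]
          · rw [update_of_ne hjt]
            exact h1 j (by omega)
        · rw [update_of_ne (by omega)]
          exact h2 j (by omega)
        · rw [colexRank_succ, heq, Nat.choose_succ_succ']
          omega
    · refine Runs.le (.ite_neg (B := 1) (by simp [h15]) (.skip fun _ => .inr ?_)) (by decide)
      simpa [h15] using h1
  · rcases hI with ⟨h15, -, -, h3⟩ | ⟨h15, h1⟩
    · right
      rw [hc.last] at h3
      simpa [h15] using h3
    · left
      simpa [h15] using h1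
  · simp only [NatExpr.cost]
    omega

theorem runs_start {s : Memory} {d m : ℕ} (hd : s.nat 0 0 = d) (hm : s.nat 0 1 = m) (hdm : d < m) :
    Runs Prog.start s (100 * (d + 1)) fun s' => s'.nat 10 0 = d + 1 ∧
      IsSelection (d + 1) m (s'.nat 2) ∧ colexRank (d + 1) (s'.nat 2) = 0 ∧ s'.nat 14 0 = 1 := by
  refine Runs.le (.seq (.setNat (.seq (.for (n := d + 1) (B := 10)
    (fun t s' => ∀ j < t, s'.nat 2 j = j) (by decide)
    (fun s' hS => ?_) (by simp) (fun t ht s' hI hs' hS => .le (.setNat fun _ j hj => ?_) (by decide))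
    fun s' hI _ hS => .seq (.setNat (.setNat ?_)))))) ?_
  · simp [hS.nat 10 (by decide), hd]
  · by_cases hjt : j = t
    · simp [hjt, hs']
    · simpa [hjt, hs'] using hI j (by omega)
  · have e0 := hS.nat 0 (by decide)
    have e10 := hS.nat 10 (by decide)
    simp [hd] at e0 e10
    have e2 : ∀ j < d + 1, update (s'.nat 2) (d + 1) m j = j := fun j hj => by
      rw [update_of_ne hj.ne, hI j hj]
    simp only [NatExpr.eval, e10, e0, update_self, hm]
    rw [Memory.storeNat_nat_of_ne _ _ _ (by decide), Memory.storeNat_nat_of_ne _ _ _ (by decide),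
      Memory.storeNat_nat_of_ne _ _ _ (by decide), Memory.storeNat_nat_self, e10]
    refine ⟨by simp, ⟨fun j hj => ?_, by simp⟩, ?_, by simp⟩
    · rw [e2 j hj]
      rcases lt_or_eq_of_le (Nat.succ_le_of_lt hj) with h | h
      · rw [e2 _ h]
        omega
      · rw [show j + 1 = d + 1 from h, update_self]
        omega
    · rw [colexRank_congr (c := id) e2, colexRank_id]
  · simp only [NatExpr.cost]
    omega

lemma IsSelection.exists_finset {n m : ℕ} {c : ℕ → ℕ} (h : IsSelection n m c) :
    ∃ J : {J : Finset (Fin m) // J.card = n}, ∀ j, (J.1.orderEmbOfFin J.2 j : ℕ) = c j := by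
  have hmono : ∀ k ≤ n, ∀ j < k, c j < c k := by
    intro k
    induction k with
    | zero => simp
    | succ k ih =>
      intro hk j hj
      rcases Nat.lt_succ_iff_lt_or_eq.1 hj with h' | rfl
      · exact (ih (by omega) j h').trans (h.lt k hk)
      · exact h.lt j hk
  set e : Fin n → Fin m := fun j => ⟨c j, h.last ▸ hmono n le_rfl j j.2⟩
  have he : StrictMono e := fun j k hjk => hmono k k.2.le j hjk
  refine ⟨⟨Finset.univ.image e, by rw [Finset.card_image_of_injective _ he.injective]; simp⟩,
    fun j => ?_⟩
  rw [← Finset.orderEmbOfFin_unique _ (f := e) (by simp) he]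

lemma simplexSup_eq_sup {d m : ℕ} (M : Matrix (Fin d) (Fin m) TropNum) :
    simplexSup M = Finset.univ.sup fun J => simplexValue (colSubmatrix M J) := by
  classical
  simp only [simplexSup, simplexValue]
  rw [Finset.sup_ite]
  simp

/-- The position of a set in the colexicographic order. -/
def setRank {n m : ℕ} (J : {J : Finset (Fin m) // J.card = n}) : ℕ :=
  ∑ j : Fin n, (J.1.orderEmbOfFin J.2 j : ℕ).choose (j + 1)

/-- Induction on the number `r` of sets still to come, where `S` collects the processed ones. Ranks
increase, so each set is new, and counting shows that `S` ends up with all sets; injectivity of the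
rank is not needed. -/
theorem runs_loop {d m : ℕ} (hd : 1 ≤ d) (M : Matrix (Fin d) (Fin m) TropNum) (r : ℕ) :
    ∀ (s : Memory) (S : Finset {J : Finset (Fin m) // J.card = d + 1}), s.nat 0 0 = d →
      s.trop 0 = (inputMemory M).trop 0 → s.nat 10 0 = d + 1 → s.nat 14 0 = 1 →
      IsSelection (d + 1) m (s.nat 2) → colexRank (d + 1) (s.nat 2) + r = m.choose (d + 1) →
      S.card = colexRank (d + 1) (s.nat 2) → (∀ J ∈ S, setRank J < colexRank (d + 1) (s.nat 2)) →
      s.trop 1 0 0 = S.sup (fun J => simplexValue (colSubmatrix M J)) →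
      Runs (.loop (.natLt (.const 0) (.var 14)) (.seq Prog.simplex Prog.next)) s
        (r * (3200 * (d + 2) ^ 3) + 5) fun s' => s'.trop 1 0 0 = simplexSup M := by
  classical
  have hcard : Fintype.card {J : Finset (Fin m) // J.card = d + 1} = m.choose (d + 1) := by
    rw [Fintype.card_finset_len, Fintype.card_fin]
  induction r with
  | zero =>
    intro s S hs ht hn h14 hc hr hS hlt hout
    obtain ⟨J, hJ⟩ := hc.exists_finset
    have h1 : setRank J = colexRank (d + 1) (s.nat 2) := by
      simp only [setRank, colexRank, hJ, Finset.sum_range]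
    -- By counting, `S` would already contain the current set, whose rank is not below itself.
    have h2 : S = Finset.univ := Finset.eq_univ_of_card S (by rw [hS, hcard]; omega)
    exact absurd (hlt J (h2 ▸ Finset.mem_univ J)) (by omega)
  | succ r ih =>
    intro s S hs ht hn h14 hc hr hS hlt hout
    obtain ⟨J, hJ⟩ := hc.exists_finset
    have h1 : setRank J = colexRank (d + 1) (s.nat 2) := by
      simp only [setRank, colexRank, hJ, Finset.sum_range]
    have hJS : J ∉ S := fun h => (hlt J h).ne h1
    have hN : ∀ (i : Fin d) (j : Fin (d + 1)), s.trop 0 i (s.nat 2 j) = colSubmatrix M J i j := by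
      intro i j
      rw [ht, ← hJ, colSubmatrix_apply]
      simp [inputMemory]
    have hbody : Runs (.seq Prog.simplex Prog.next) s (3100 * (d + 2) ^ 3) fun s' =>
        SameOutside (.seq Prog.simplex Prog.next) s s' ∧
        s'.trop 1 0 0 = (insert J S).sup (fun J => simplexValue (colSubmatrix M J)) ∧
        ((s'.nat 14 0 = 1 ∧ IsSelection (d + 1) m (s'.nat 2) ∧
          colexRank (d + 1) (s'.nat 2) = colexRank (d + 1) (s.nat 2) + 1) ∨
        (s'.nat 14 0 = 0 ∧ colexRank (d + 1) (s.nat 2) + 1 = m.choose (d + 1))) := by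
      refine Runs.mono (Runs.seq_same ((runs_simplex hd hs hn hN).mono le_rfl fun s₁ h hS₁ _ =>
        (runs_next (n := d + 1) (m := m) (by rw [hS₁.nat 10 (by decide), hn])
          (by rwa [hS₁.nat 2 (by decide)])).mono le_rfl
          (Q' := fun s' => s'.trop 1 0 0 = (insert J S).sup
            (fun J => simplexValue (colSubmatrix M J)) ∧
        ((s'.nat 14 0 = 1 ∧ IsSelection (d + 1) m (s'.nat 2) ∧
          colexRank (d + 1) (s'.nat 2) = colexRank (d + 1) (s.nat 2) + 1) ∨
        (s'.nat 14 0 = 0 ∧ colexRank (d + 1) (s.nat 2) + 1 = m.choose (d + 1))))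
          fun s₂ h' hS₂ => ?_)) ?_ fun s' h hS => ⟨hS, h⟩
      · rw [hS₁.nat 2 (by decide)] at h'
        refine ⟨?_, h'⟩
        rw [hS₂.trop 1 (by decide), h, hout, Finset.sup_insert, sup_comm]
      · nlinarith [Nat.zero_le (d ^ 3), Nat.zero_le (d ^ 2)]
    obtain ⟨t, s', he, ht', hS', hout', h⟩ := hbody
    have hb : Test.eval s (.natLt (.const 0) (.var 14)) := by simp [h14]
    rcases h with ⟨h14', hc', hr'⟩ | ⟨h14', hr'⟩
    · obtain ⟨t₂, s₂, he₂, ht₂, h₂⟩ := ih s' (insert J S) (by rw [hS'.nat 0 (by decide), hs])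
        (by rw [hS'.trop 0 (by decide), ht]) (by rw [hS'.nat 10 (by decide), hn]) h14' hc'
        (by omega) (by rw [Finset.card_insert_of_notMem hJS, hS, hr']) (fun K hK => by
          rcases Finset.mem_insert.1 hK with rfl | hK
          · omega
          · have := hlt K hK
            omega) hout'
      refine ⟨_, s₂, .loopTrue hb he he₂, ?_, h₂⟩
      simp only [Test.cost, NatExpr.cost]
      have : 1 ≤ (d + 2) ^ 3 := Nat.one_le_pow _ _ (by omega)
      rw [Nat.succ_mul]
      omega
    · refine ⟨_, s', .loopTrue hb he (.loopFalse (by simp [h14'])), ?_, ?_⟩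
      · simp only [Test.cost, NatExpr.cost]
        have : 1 ≤ (d + 2) ^ 3 := Nat.one_le_pow _ _ (by omega)
        rw [Nat.succ_mul]
        omega
      · refine hout'.trans ?_
        rw [simplexSup_eq_sup, Finset.eq_univ_of_card (insert J S)
          (by rw [Finset.card_insert_of_notMem hJS, hS, hcard, hr'])]

/-- The program computes the tropical barycentric volume. -/
theorem runs_main {d m : ℕ} (hd : 1 ≤ d) (M : Matrix (Fin d) (Fin m) TropNum) :
    Runs Prog.main (inputMemory M) (100000 * (m.choose (d + 1) * d ^ 3 + 1)) fun s =>
      s.output = tlvol (tconv (columns M)) := by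
  rw [tlvol_eq_simplexSup hd]
  have h0 : (inputMemory M).nat 0 0 = d := by simp [inputMemory]
  have h1 : (inputMemory M).nat 0 1 = m := by simp [inputMemory]
  have ht1 : (inputMemory M).trop 1 0 0 = ⊥ := by simp [inputMemory]
  by_cases hdm : d < m
  · refine Runs.le (.ite_pos (by simp [h0, h1, hdm]) (.seq_same ((runs_start h0 h1 hdm).mono le_rfl
      fun s₁ ⟨e10, hc, hr, h14⟩ hS _ => runs_loop hd M (m.choose (d + 1)) s₁ ∅ ?_ ?_ e10 h14 hc
        (by omega) (by simp [hr]) (by simp) ?_))) ?_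
    · rw [hS.nat 0 (by decide), h0]
    · exact hS.trop 0 (by decide)
    · rw [hS.trop 1 (by decide), ht1, Finset.sup_empty]
    · simp only [Test.cost, NatExpr.cost]
      have hpos : 1 ≤ m.choose (d + 1) := Nat.choose_pos hdm
      -- Here d ≥ 1 enters as d + 2 ≤ 3 d.
      have h2 : (d + 2) ^ 3 ≤ 27 * d ^ 3 := by
        calc (d + 2) ^ 3 ≤ (3 * d) ^ 3 := Nat.pow_le_pow_left (by omega) 3
          _ = 27 * d ^ 3 := by ring
      have h3 : m.choose (d + 1) * (3200 * (d + 2) ^ 3) ≤ 86400 * (m.choose (d + 1) * d ^ 3) := by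
        calc m.choose (d + 1) * (3200 * (d + 2) ^ 3)
            ≤ m.choose (d + 1) * (3200 * (27 * d ^ 3)) := by gcongr
          _ = 86400 * (m.choose (d + 1) * d ^ 3) := by ring
      -- There is at least one simplex, so the linear cost of the preparation is absorbed.
      have h4 : d ≤ m.choose (d + 1) * d ^ 3 :=
        (Nat.le_self_pow (by decide) d).trans (Nat.le_mul_of_pos_left _ hpos)
      omega
  · have hempty : IsEmpty {J : Finset (Fin m) // J.card = d + 1} := ⟨fun J => by
      have := J.1.card_le_univ
      rw [J.2, Fintype.card_fin] at this
      omega⟩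
    refine Runs.le (.ite_neg (by simp [h0, h1, hdm]) (.skip ?_)) ?_
    · rw [simplexSup_eq_sup, Finset.univ_eq_empty, Finset.sup_empty]
      exact ht1
    · simp only [Test.cost, NatExpr.cost]
      omega

end TropVol

/-! ### The volume formula and the running time -/

open Classical in
theorem mainTheorem12 :
    -- the volume as a maximum over tropical simplices
    (∀ (d m : ℕ) (_ : 1 ≤ d) (M : Matrix (Fin d) (Fin m) TropVol.TropNum),
      -- the barycenters occurring in the formula exist
      (∀ J : {J : Finset (Fin m) // J.card = d + 1},
        TropVol.Nonsingular (TropVol.augment (TropVol.colSubmatrix M J)) →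
          IsGreatest
            (TropVol.trunk d (TropVol.tconv (TropVol.columns (TropVol.colSubmatrix M J))))
            (TropVol.trunkBarycenter
              (TropVol.tconv (TropVol.columns (TropVol.colSubmatrix M J))))) ∧
      -- the maximum that defines the volume is attained unless the trunk is empty
      ((TropVol.trunk d (TropVol.tconv (TropVol.columns M))).Nonempty →
        IsGreatest
          (TropVol.coordSum '' TropVol.trunk d (TropVol.tconv (TropVol.columns M)))
          (TropVol.tlvol (TropVol.tconv (TropVol.columns M)))) ∧
      -- the formula; the maximum of the empty set is `-∞`
      TropVol.tlvol (TropVol.tconv (TropVol.columns M)) =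
        (Finset.univ.filter fun J : {J : Finset (Fin m) // J.card = d + 1} =>
          TropVol.Nonsingular (TropVol.augment (TropVol.colSubmatrix M J))).sup
          fun J => TropVol.coordSum (TropVol.trunkBarycenter
            (TropVol.tconv (TropVol.columns (TropVol.colSubmatrix M J))))) ∧
    -- the running time; the summand 1 only matters for `m ≤ d`
    (∃ (p : TropVol.Program) (C : ℕ),
      ∀ (d m : ℕ) (_ : 1 ≤ d) (M : Matrix (Fin d) (Fin m) TropVol.TropNum),
        ∃ (t : ℕ) (s : TropVol.Memory),
          TropVol.Exec p (TropVol.inputMemory M) t s ∧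
          t ≤ C * (m.choose (d + 1) * d ^ 3 + 1) ∧
          s.output = TropVol.tlvol (TropVol.tconv (TropVol.columns M))) := by
  refine ⟨fun d m hd M => ⟨fun J hJ => TropVol.isGreatest_trunkBarycenter hd hJ, fun hne => ?_,
    TropVol.tlvol_eq_simplexSup hd M⟩, TropVol.Prog.main, 100000, fun d m hd M =>
      TropVol.runs_main hd M⟩
  rw [TropVol.tlvol_eq_simplexSup hd]
  exact TropVol.isGreatest_simplexSup hd M hne
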